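/- Let $\triangle$ be the triangular grid with vertices $\varphi(x,y,z)$, the classes of $(x,y,z)\in\mathbb Z^3$ modulo $(1,1,1)$; every edge joins some $v$ to $v+\varphi(u_i)$, where $u_1,u_2,u_3$ are the unit vectors. The lozenge overlapping an edge is the union of the two triangles adjacent to it; its orientation is the direction of that edge. Let $R$ be a bounded simply connected region, i.e. a nonempty finite set of triangles that is connected and whose complement in $\triangle$ is connected (both across edges). Write $|R|$ for its number of triangles and $\partial R$ for the set of its boundary edges. Let $X_1,X_2$ be finite sets of edges. The problem $\mathtt{Tiling}(R,X_1,X_2)$ asks for a tiling of $R$ by lozenges in which no edge of $X_1\cup X_2$ is overlapped by a lozenge and, for every edge of $X_2$, the two lozenges adjacent to it have different orientations (no condition on orientations if the edge is not adjacent to two lozenges of the tiling). A cube $c\in\mathbb Z^3$ has height the sum of its coordinates. The enhanced ascendant graph $\mathcal H_R^{X_1,X_2}$ has as vertices the cubes $c$ with $\varphi(c)$ a vertex of $R$. Its edges are $c\to c+u_i$ whenever the edge $\varphi(c),\varphi(c+u_i)$ belongs to $R$; also $c+u_i\to c$ if moreover that edge belongs to $\partial R\cup X_1\cup X_2$; and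 $c-u_j\leftrightarrow c-u_k$, $\{i,j,k\}=\{1,2,3\}$, if that edge belongs to $X_2$ and both triangles adjacent to it belong to $R$. A dicut is a partition of the cubes into two nonempty parts, bottom and top, with no edge from top to bottom. Its projection is the set of the lozenges overlapping the edges $\varphi(c),\varphi(c+u_i)$ of $R$ with $c$ in the bottom and $c+u_i$ in the top. The advancing surface algorithm works as follows. First step: it lifts the boundary of $R$ to a cycle $L$ of cubes of $\mathcal H_R^{\emptyset,\emptyset}$ by computing heights along $\partial R$, and computes with a Dijkstra-like procedure the lower cut, whose bottom consists of the cubes from which $L$ can be reached in $\mathcal H_R^{\emptyset,\emptyset}$, and the upper cut, whose top consists of the cubes reachable from $L+(1,1,1)$ in $\mathcal H_R^{\emptyset,\emptyset}$. It rejects if the boundary heights are inconsistent or if a shortcut changes the height of a boundary vertex. Second step: starting from the bottom of the lower cut, it adds, by backward graph traversal, all cubes with an edge of $\mathcal H_R^{X_1,X_2}$ leading to the current bottom part. It rejects if a cube of the top of the upper cut has to be added; otherwise it outputs the projection of the resulting cut. **Theorem.** The advancing surface algorithm solves $\mathtt{Tiling}(R,X_1,X_2)$ for every bounded simply connected region $R$: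 it always halts, it outputs a solution if there is one, and it rejects otherwise. The first step rejects if and only if $R$ has no lozenge tiling at all; otherwise it provides the lower and upper cuts, which are dicuts of $\mathcal H_R^{\emptyset,\emptyset}$. If the second step does not reject, its final bottom part is the set of all cubes from which the bottom of the lower cut can be reached in $\mathcal H_R^{X_1,X_2}$, and is the bottom of a dicut of $\mathcal H_R^{X_1,X_2}$. On a random access machine with integer registers and directly addressed integer tables, where every addition, subtraction, comparison, Boolean operation and memory access costs one unit, and whose input consists of lists (without repetition) of the triangles of $R$ and of the edges of $X_1$ and of $X_2$, the running time is at most $C\cdot(|\partial R|\cdot|R|+m)$, where $C$ is an absolute constant and $m$ is the number of edges of $X_1\cup X_2$ that are not edges of $R$. In particular the running time is $O(|\partial R|\cdot|R|)$ when $X_1$ and $X_2$ consist of edges of $R$. -/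

import Mathlib

namespace Calisson

/-! ## The triangular grid, regions, tilings -/

/-- A vertex of the triangular grid. The vertex `φ(x,y,z)`, the class of `(x,y,z) ∈ ℤ³` modulo
`(1,1,1)`, is stored as `(x - z, y - z)`. -/
abbrev Vertex := ℤ × ℤ

/-- The three positive directions `φ(1,0,0)`, `φ(0,1,0)`, `φ(0,0,1)`; their sum is zero. -/
def vec : Fin 3 → Vertex := ![(1, 0), (0, 1), (-1, -1)]

/-- An edge of the grid, joining `base` to `base + vec dir`. -/
structure Edge where
  base : Vertex
  dir : Fin 3
deriving DecidableEq

/-- A triangle of the grid, with vertices `base`, `base + vec kind`, `base + vec 0 + vec 1`. -/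
structure Tri where
  base : Vertex
  kind : Fin 2
deriving DecidableEq

/-- The second endpoint of an edge. -/
def Edge.tip (e : Edge) : Vertex := e.base + vec e.dir

/-- The triangle of kind `0` adjacent to an edge. -/
def Edge.left (e : Edge) : Tri :=
  ⟨![e.base, e.base - vec 0, e.base + vec 2] e.dir, 0⟩

/-- The triangle of kind `1` adjacent to an edge. -/
def Edge.right (e : Edge) : Tri :=
  ⟨![e.base - vec 1, e.base, e.base + vec 2] e.dir, 1⟩

/-- The lozenge overlapping the edge `e`: the union of the two triangles adjacent to `e`.
Its orientation is the direction of `e`. -/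
def Edge.lozenge (e : Edge) : Finset Tri := {e.left, e.right}

/-- The three vertices of a triangle. -/
def Tri.verts (t : Tri) : Finset Vertex :=
  {t.base, t.base + ![vec 0, vec 1] t.kind, t.base + vec 0 + vec 1}

/-- The three edges of a triangle. -/
def Tri.edges (t : Tri) : Finset Edge :=
  {⟨t.base, ![0, 1] t.kind⟩, ⟨t.base + ![vec 0, vec 1] t.kind, ![1, 0] t.kind⟩,
    ⟨t.base + vec 0 + vec 1, 2⟩}

/-- A bounded region is given by the finite set of its triangles; these are its vertices `R⁰`. -/
def verts (R : Finset Tri) : Finset Vertex := R.biUnion Tri.verts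

/-- The edges `R¹` of a region. -/
def edges (R : Finset Tri) : Finset Edge := R.biUnion Tri.edges

/-- The boundary edges `∂R`: the edges of `R` not adjacent to two triangles of `R`. -/
def boundary (R : Finset Tri) : Finset Edge := (edges R).filter fun e => ¬ e.lozenge ⊆ R

/-- The vertices on the boundary. -/
def boundaryVerts (R : Finset Tri) : Finset Vertex :=
  (boundary R).biUnion fun e => {e.base, e.tip}

/-- Two triangles are adjacent when they are the two sides of an edge. -/
def triGraph : SimpleGraph Tri :=
  SimpleGraph.fromRel fun s t => ∃ e : Edge, s = e.left ∧ t = e.right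

/-- A bounded region is simply connected: it is connected, and has no holes (its complement in the
infinite triangular grid is connected). Both connections are across edges, so that the boundary
does not pass several times through the same vertex. -/
structure IsSimplyConnectedRegion (R : Finset Tri) : Prop where
  connected : (triGraph.induce (R : Set Tri)).Connected
  no_holes : (triGraph.induce ((R : Set Tri)ᶜ)).Connected

/-- A lozenge tiling of `R`; each lozenge is given by the edge that it overlaps. -/
structure IsTiling (R : Finset Tri) (T : Set Edge) : Prop where
  inside : ∀ e ∈ T, e.lozenge ⊆ R
  cover : ∀ t ∈ R, ∃! e, e ∈ T ∧ t ∈ e.lozenge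

/-- `T` is a solution of `Tiling(R, X₁, X₂)`. The saliency constraint says that the two lozenges
adjacent to an edge of `X₂` have different orientations. -/
structure Solves (R : Finset Tri) (X₁ X₂ : Finset Edge) (T : Set Edge) : Prop where
  tiling : IsTiling R T
  non_overlapping : ∀ e ∈ X₁ ∪ X₂, e ∉ T
  saliency : ∀ e ∈ X₂, ∀ f ∈ T, ∀ g ∈ T,
    e.left ∈ f.lozenge → e.right ∈ g.lozenge → f.dir ≠ g.dir

/-! ## Cubes, ascendant graphs and dicuts -/

/-- The cube `(x,y,z) + [0,1]³`. -/
abbrev Cube := ℤ × ℤ × ℤ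

/-- The projection of (the base point of) a cube along `(1,1,1)`. -/
def proj (c : Cube) : Vertex := (c.1 - c.2.2, c.2.1 - c.2.2)

/-- The height of a cube. -/
def height (c : Cube) : ℤ := c.1 + c.2.1 + c.2.2

/-- The three unit vectors. -/
def unit : Fin 3 → Cube := ![(1, 0, 0), (0, 1, 0), (0, 0, 1)]

/-- The cubes whose base points project into `R`. -/
def cubes (R : Finset Tri) : Set Cube := {c | proj c ∈ verts R}

/-- The edges of the enhanced ascendant graph of `R`: the ascending edges, the descending copies
of those over `∂R`, `X₁`, `X₂`, and the pairs of opposite edges joining the cubes on the two sides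
of an interior edge of `X₂`. For `X₁ = X₂ = ∅` only the constraints of `∂R` remain. -/
inductive Arc (R : Finset Tri) (X₁ X₂ : Finset Edge) : Cube → Cube → Prop
  | up (c : Cube) (i : Fin 3) (h : (⟨proj c, i⟩ : Edge) ∈ edges R) :
      Arc R X₁ X₂ c (c + unit i)
  | down (c : Cube) (i : Fin 3) (h : (⟨proj c, i⟩ : Edge) ∈ edges R)
      (hX : (⟨proj c, i⟩ : Edge) ∈ boundary R ∪ X₁ ∪ X₂) :
      Arc R X₁ X₂ (c + unit i) c
  | lateral (c : Cube) (i j k : Fin 3) (hij : i ≠ j) (hjk : j ≠ k) (hik : i ≠ k)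
      (h : (⟨proj c, i⟩ : Edge).lozenge ⊆ R) (hX : (⟨proj c, i⟩ : Edge) ∈ X₂) :
      Arc R X₁ X₂ (c - unit j) (c - unit k)

/-- `c` is joined to `c'` by a directed path. -/
def Reaches (R : Finset Tri) (X₁ X₂ : Finset Edge) : Cube → Cube → Prop :=
  Relation.ReflTransGen (Arc R X₁ X₂)

/-- `B` is the bottom part of a dicut of the enhanced ascendant graph. -/
structure IsDicut (R : Finset Tri) (X₁ X₂ : Finset Edge) (B : Set Cube) : Prop where
  subset : B ⊆ cubes R
  bottom_nonempty : B.Nonempty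
  top_nonempty : (cubes R \ B).Nonempty
  directed : ∀ c c', Arc R X₁ X₂ c c' → c' ∈ B → c ∈ B

/-- The projection of a dicut: the lozenges that are the projections of the faces between a cube
of the bottom part and a cube of the top part. -/
def projection (R : Finset Tri) (B : Set Cube) : Set Edge :=
  {e | e ∈ edges R ∧ ∃ c ∈ B, proj c = e.base ∧ c + unit e.dir ∉ B}

/-- `L` is (the set of cubes of) a lift of the boundary cycle to the cubes. -/
structure IsBoundaryLift (R : Finset Tri) (L : Set Cube) : Prop where
  bij : Set.BijOn proj L (boundaryVerts R)
  step : ∀ c ∈ L, ∀ i, (⟨proj c, i⟩ : Edge) ∈ boundary R → c + unit i ∈ L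

/-- The bottom part of the lower cut defined by a lift `L` of the boundary: the cubes
from which `L` can be reached. -/
def lowerCutBottom (R : Finset Tri) (L : Set Cube) : Set Cube :=
  {c | c ∈ cubes R ∧ ∃ c' ∈ L, Reaches R ∅ ∅ c c'}

/-- The top part of the upper cut defined by a lift `L` of the boundary: the cubes
that can be reached from the translate of `L` by `(1,1,1)`. -/
def upperCutTop (R : Finset Tri) (L : Set Cube) : Set Cube :=
  {c | c ∈ cubes R ∧ ∃ c' ∈ L, Reaches R ∅ ∅ (c' + (1, 1, 1)) c}

/-- The cubes from which a set `B` can be reached in the enhanced ascendant graph: the result of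
growing `B` by backward traversal. -/
def grown (R : Finset Tri) (X₁ X₂ : Finset Edge) (B : Set Cube) : Set Cube :=
  {c | c ∈ cubes R ∧ ∃ c' ∈ B, Reaches R X₁ X₂ c c'}

/-! ## The machine: integer registers, integer tables, one time unit per elementary operation -/

/-- Registers. -/
inductive Reg
  | nT | n1 | n2 | nV | j | x | y | d | a | b | k | lo | hi | sp | settled | ok | fail | status
deriving DecidableEq

/-- Tables. Each has three integer indices. -/
inductive Tab
  | inT | in1 | in2 | tri | con1 | con2 | seen | vtx | cnt | stk | bset | bh
  | lset | low | uset | upp | hgt | tile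
deriving DecidableEq

/-- The content of the memory. -/
structure State where
  reg : Reg → ℤ
  tab : Tab → ℤ → ℤ → ℤ → ℤ

/-- Integer expressions. The machine can add, subtract, and read memory. -/
inductive Expr
  | lit (n : ℤ)
  | reg (r : Reg)
  | get (t : Tab) (p q r : Expr)
  | add (e f : Expr)
  | sub (e f : Expr)

instance : Coe Reg Expr := ⟨Expr.reg⟩
instance (n : ℕ) : OfNat Expr n := ⟨Expr.lit n⟩
instance : Add Expr := ⟨Expr.add⟩
instance : Sub Expr := ⟨Expr.sub⟩

/-- The value of an expression. -/
def Expr.val (s : State) : Expr → ℤ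
  | lit n => n
  | reg r => s.reg r
  | get t p q r => s.tab t (p.val s) (q.val s) (r.val s)
  | add e f => e.val s + f.val s
  | sub e f => e.val s - f.val s

/-- The number of elementary operations in the evaluation of an expression. -/
def Expr.cost : Expr → ℕ
  | lit _ => 1
  | reg _ => 1
  | get _ p q r => p.cost + q.cost + r.cost + 1
  | add e f => e.cost + f.cost + 1
  | sub e f => e.cost + f.cost + 1

/-- Tests. -/
inductive Test
  | eq (e f : Expr)
  | lt (e f : Expr)
  | not (p : Test)
  | and (p q : Test)
  | or (p q : Test)

/-- The truth value of a test. -/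
def Test.holds (s : State) : Test → Prop
  | eq e f => e.val s = f.val s
  | lt e f => e.val s < f.val s
  | not p => ¬ p.holds s
  | and p q => p.holds s ∧ q.holds s
  | or p q => p.holds s ∨ q.holds s

/-- The number of elementary operations in a test. -/
def Test.cost : Test → ℕ
  | eq e f => e.cost + f.cost + 1
  | lt e f => e.cost + f.cost + 1
  | not p => p.cost + 1
  | and p q => p.cost + q.cost + 1
  | or p q => p.cost + q.cost + 1

/-- Programs. -/
inductive Cmd
  | skip
  | set (r : Reg) (e : Expr)
  | store (t : Tab) (p q r e : Expr)
  | seq (c c' : Cmd)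
  | ite (p : Test) (c c' : Cmd)
  | loop (p : Test) (c : Cmd)

/-- Writing a register. -/
def State.setReg (s : State) (r : Reg) (n : ℤ) : State :=
  { s with reg := Function.update s.reg r n }

/-- Writing a table entry. -/
def State.setTab (s : State) (t : Tab) (p q r n : ℤ) : State :=
  { s with tab := fun t' p' q' r' =>
      if t' = t ∧ p' = p ∧ q' = q ∧ r' = r then n else s.tab t' p' q' r' }

/-- `Exec c s n s'`: started in memory `s`, the program `c` halts after exactly `n` elementary
operations, with memory `s'`. -/
inductive Exec : Cmd → State → ℕ → State → Prop
  | skip (s : State) : Exec .skip s 1 s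
  | set (r : Reg) (e : Expr) (s : State) :
      Exec (.set r e) s (e.cost + 1) (s.setReg r (e.val s))
  | store (t : Tab) (p q r e : Expr) (s : State) :
      Exec (.store t p q r e) s (p.cost + q.cost + r.cost + e.cost + 1)
        (s.setTab t (p.val s) (q.val s) (r.val s) (e.val s))
  | seq {c c' : Cmd} {s s' s'' : State} {m n : ℕ}
      (h : Exec c s m s') (h' : Exec c' s' n s'') : Exec (.seq c c') s (m + n) s''
  | ite_true {p : Test} {c c' : Cmd} {s s' : State} {n : ℕ}
      (hp : p.holds s) (h : Exec c s n s') : Exec (.ite p c c') s (p.cost + 1 + n) s'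
  | ite_false {p : Test} {c c' : Cmd} {s s' : State} {n : ℕ}
      (hp : ¬ p.holds s) (h : Exec c' s n s') : Exec (.ite p c c') s (p.cost + 1 + n) s'
  | loop_done {p : Test} {c : Cmd} {s : State}
      (hp : ¬ p.holds s) : Exec (.loop p c) s (p.cost + 1) s
  | loop_step {p : Test} {c : Cmd} {s s' s'' : State} {m n : ℕ}
      (hp : p.holds s) (h : Exec c s m s') (h' : Exec (.loop p c) s' n s'') :
      Exec (.loop p c) s (p.cost + 1 + m + n) s''

/-- Sequential composition of a list of programs. -/
def block : List Cmd → Cmd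
  | [] => .skip
  | c :: cs => .seq c (block cs)

/-- A conditional without alternative. -/
def when (p : Test) (cs : List Cmd) : Cmd := .ite p (block cs) .skip

/-- A loop with a body that is a list of programs. -/
def loop (p : Test) (cs : List Cmd) : Cmd := .loop p (block cs)

/-- `for j = 0, …, n - 1 do …`. -/
def forEach (n : Reg) (cs : List Cmd) : Cmd :=
  block [.set .j 0, loop (.lt Reg.j n) [block cs, .set .j (Reg.j + 1)]]

/-- The same program text for each of the three directions. -/
def forDirs (f : Fin 3 → Cmd) : Cmd := block [f 0, f 1, f 2]

/-! ## The advancing surface algorithm -/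

open Reg Tab

/-- The literals for the coordinates of a direction. -/
def dx (i : Fin 3) : Expr := .lit (vec i).1
/-- See `dx`. -/
def dy (i : Fin 3) : Expr := .lit (vec i).2
/-- The literal for a direction. -/
def lit (i : Fin 3) : Expr := .lit (i : ℕ)

/-- Push a vertex on the stack. -/
def push (p q : Expr) : Cmd :=
  block [.store stk sp 0 0 p, .store stk sp 1 0 q, .set sp (sp + 1)]

/-- Pop a vertex from the stack into `(x, y)`. -/
def pop : Cmd :=
  block [.set sp (sp - 1), .set x (.get stk sp 0 0), .set y (.get stk sp 1 0)]

/-- Load the `j`-th vertex into `(x, y)`. -/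
def fetch : Cmd := block [.set x (.get vtx j 0 0), .set y (.get vtx j 1 0)]

/-- Append a vertex to the list of vertices, if it is new. -/
def addVertex (p q : Expr) : Cmd :=
  when (.eq (.get seen p q 0) 0)
    [.store seen p q 0 1, .store vtx nV 0 0 p, .store vtx nV 1 0 q, .set nV (nV + 1)]

/-- Read the input: tables for the triangles and the constraints, the list of the vertices, and
for each edge the number `cnt` of adjacent triangles of the region (`2` for an interior edge,
`1` for a boundary edge). -/
def readInput : Cmd := block [
  .set nV 0,
  forEach nT [
    .set x (.get inT j 0 0), .set y (.get inT j 1 0), .set d (.get inT j 2 0),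
    .store tri x y d 1,
    addVertex x y,
    addVertex (x + 1) (y + 1),
    .ite (.eq d 0) (addVertex (x + 1) y) (addVertex x (y + 1))],
  forEach n1 [.store con1 (.get in1 j 0 0) (.get in1 j 1 0) (.get in1 j 2 0) 1],
  forEach n2 [.store con2 (.get in2 j 0 0) (.get in2 j 1 0) (.get in2 j 2 0) 1],
  forEach nV [
    fetch,
    .store cnt x y 0 (.get tri x y 0 + .get tri x (y - 1) 1),
    .store cnt x y 1 (.get tri (x - 1) y 0 + .get tri x y 1),
    .store cnt x y 2 (.get tri (x - 1) (y - 1) 0 + .get tri (x - 1) (y - 1) 1)]]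

/-- The boundary vertex `(p, q)` is seen with height `h`: record the height, or compare it with
the recorded one. -/
def visit (p q h : Expr) : Cmd :=
  .ite (.eq (.get bset p q 0) 0)
    (block [.store bset p q 0 1, .store bh p q 0 h, push p q])
    (when (.not (.eq (.get bh p q 0) h)) [.set ok 0])

/-- Lift the boundary: traverse it from some boundary vertex and compute the heights `bh` of its
vertices. A nonzero total weight of the boundary cycle clears `ok`. -/
def liftBoundary : Cmd := block [
  .set ok 1,
  forEach nV [
    fetch,
    forDirs fun i => when (.eq (.get cnt x y (lit i)) 1) [.set a x, .set b y]],
  .set sp 0,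
  .store bset a b 0 1, .store bh a b 0 (a + b), push a b,
  loop (.lt 0 sp) [
    pop,
    .set k (.get bh x y 0),
    forDirs fun i => block [
      when (.eq (.get cnt x y (lit i)) 1) [visit (x + dx i) (y + dy i) (k + 1)],
      when (.eq (.get cnt (x - dx i) (y - dy i) (lit i)) 1)
        [visit (x - dx i) (y - dy i) (k - 1)]]]]

/-- Start the tables `low` and `upp` with the boundary heights; `lo` and `hi` become the extreme
boundary heights. -/
def initCuts : Cmd := block [
  .set lo (a + b), .set hi (a + b),
  forEach nV [
    fetch,
    when (.eq (.get bset x y 0) 1) [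
      .set k (.get bh x y 0),
      .store lset x y 0 1, .store low x y 0 k,
      .store uset x y 0 1, .store upp x y 0 k,
      when (.lt k lo) [.set lo k],
      when (.lt hi k) [.set hi k]]]]

/-- The lower cut, by a Dijkstra-like procedure: the vertices are settled level by level, in the
order of decreasing heights, and each settled vertex updates its predecessors. -/
def lowerCut : Cmd := block [
  .set k hi, .set settled 0,
  loop (.lt settled nV) [
    forEach nV [
      fetch,
      when (.and (.eq (.get lset x y 0) 1) (.eq (.get low x y 0) k)) [
        .set settled (settled + 1),
        forDirs fun i =>
          when (.lt 0 (.get cnt (x - dx i) (y - dy i) (lit i))) [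
            when (.or (.eq (.get lset (x - dx i) (y - dy i) 0) 0)
                (.lt (.get low (x - dx i) (y - dy i) 0) (k - 1))) [
              .store lset (x - dx i) (y - dy i) 0 1,
              .store low (x - dx i) (y - dy i) 0 (k - 1)]]]],
    .set k (k - 1)]]

/-- The upper cut, dually. -/
def upperCut : Cmd := block [
  .set k lo, .set settled 0,
  loop (.lt settled nV) [
    forEach nV [
      fetch,
      when (.and (.eq (.get uset x y 0) 1) (.eq (.get upp x y 0) k)) [
        .set settled (settled + 1),
        forDirs fun i =>
          when (.lt 0 (.get cnt x y (lit i))) [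
            when (.or (.eq (.get uset (x + dx i) (y + dy i) 0) 0)
                (.lt (k + 1) (.get upp (x + dx i) (y + dy i) 0))) [
              .store uset (x + dx i) (y + dy i) 0 1,
              .store upp (x + dx i) (y + dy i) 0 (k + 1)]]]],
    .set k (k + 1)]]

/-- A change of the height of a boundary vertex is a shortcut: it clears `ok`. -/
def checkShortcuts : Cmd :=
  forEach nV [
    fetch,
    when (.and (.eq (.get bset x y 0) 1)
      (.not (.and (.eq (.get low x y 0) (.get bh x y 0)) (.eq (.get upp x y 0) (.get bh x y 0)))))
      [.set ok 0]]

/-- The first step: the lower and upper cuts, ignoring the interior constraints. -/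
def firstStep : Cmd := block [
  liftBoundary,
  when (.eq ok 1) [initCuts, lowerCut, upperCut, checkShortcuts]]

/-- The cube of height `h` over the vertex `(p, q)` has an edge leading to the bottom part. If it
is not yet in the bottom part, then it is in the top part of the upper cut and the algorithm fails,
or it is added to the bottom part, with the missing cubes under it, and put on the stack. -/
def addCube (p q h : Expr) : Cmd :=
  when (.lt (.get hgt p q 0) h) [
    .ite (.lt (.get upp p q 0) h)
      (.set fail 1)
      (block [.store hgt p q 0 h, push p q])]

/-- The second step: grow the bottom part of the lower cut by backward graph traversal. Entry
`(p, q)` of the table `hgt` is the height of the highest cube over `(p, q)` in the bottom part. -/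
def secondStep : Cmd := block [
  .set fail 0, .set sp 0,
  forEach nV [fetch, .store hgt x y 0 (.get low x y 0), push x y],
  loop (.and (.lt 0 sp) (.eq fail 0)) [
    pop,
    .set k (.get hgt x y 0),
    forDirs fun i => block [
      -- the ascending edge of direction `i` that ends in the cube
      when (.lt 0 (.get cnt (x - dx i) (y - dy i) (lit i)))
        [addCube (x - dx i) (y - dy i) (k - 1)],
      -- the descending edge of direction `i` that ends in the cube
      when (.or (.eq (.get cnt x y (lit i)) 1)
          (.and (.eq (.get cnt x y (lit i)) 2)
            (.or (.eq (.get con1 x y (lit i)) 1) (.eq (.get con2 x y (lit i)) 1))))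
        [addCube (x + dx i) (y + dy i) (k + 1)],
      -- the two lateral edges across an edge of direction `i` that end in the cube
      when (.and (.eq (.get cnt (x + dx (i + 1)) (y + dy (i + 1)) (lit i)) 2)
          (.eq (.get con2 (x + dx (i + 1)) (y + dy (i + 1)) (lit i)) 1))
        [addCube (x + dx (i + 1) - dx (i + 2)) (y + dy (i + 1) - dy (i + 2)) k],
      when (.and (.eq (.get cnt (x + dx (i + 2)) (y + dy (i + 2)) (lit i)) 2)
          (.eq (.get con2 (x + dx (i + 2)) (y + dy (i + 2)) (lit i)) 1))
        [addCube (x + dx (i + 2) - dx (i + 1)) (y + dy (i + 2) - dy (i + 1)) k]]]]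

/-- Project the dicut: the lozenges of the tiling are the ones overlapping the cut edges. -/
def writeTiling : Cmd :=
  forEach nV [
    fetch,
    forDirs fun i =>
      when (.and (.lt 0 (.get cnt x y (lit i)))
        (.not (.eq (.get hgt (x + dx i) (y + dy i) 0) (.get hgt x y 0 + 1))))
        [.store tile x y (lit i) 1]]

/-- The advancing surface algorithm. It ends with `status` equal to `0` if the first step rejects,
`1` if the second step rejects, `2` if a tiling has been written. -/
def advancingSurface : Cmd := block [
  readInput,
  firstStep,
  .ite (.eq ok 0) (.set status 0) (block [
    secondStep,
    .ite (.eq fail 1) (.set status 1) (block [writeTiling, .set status 2])])]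

/-! ## Input and output -/

/-- A list of triples of integers as the content of a table. -/
def rows (l : List (ℤ × ℤ × ℤ)) (p q r : ℤ) : ℤ :=
  if 0 ≤ p ∧ p < l.length ∧ r = 0 then
    if q = 0 then (l.getD p.toNat 0).1
    else if q = 1 then (l.getD p.toNat 0).2.1
    else if q = 2 then (l.getD p.toNat 0).2.2
    else 0
  else 0

/-- The initial memory: the lists of the triangles of `R` and of the edges in `X₁` and in `X₂`,
with their lengths; everything else is zero. -/
def input (lR : List Tri) (l₁ l₂ : List Edge) : State where
  reg
    | .nT => lR.length
    | .n1 => l₁.length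
    | .n2 => l₂.length
    | _ => 0
  tab
    | .inT => rows (lR.map fun t => (t.base.1, t.base.2, (t.kind : ℕ)))
    | .in1 => rows (l₁.map fun e => (e.base.1, e.base.2, (e.dir : ℕ)))
    | .in2 => rows (l₂.map fun e => (e.base.1, e.base.2, (e.dir : ℕ)))
    | _ => fun _ _ _ => 0

/-- The list `l` enumerates the finite set `S` without repetition. -/
def Enumerates {α : Type} [DecidableEq α] (l : List α) (S : Finset α) : Prop :=
  l.Nodup ∧ l.toFinset = S

/-- The set of lozenges written in the memory. -/
def output (s : State) : Set Edge :=
  {e | s.tab .tile e.base.1 e.base.2 (e.dir : ℕ) = 1}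

/-- The set of cubes described by a table of heights: the cubes over the vertices of `R` that are
not higher than the entry of the vertex. -/
def below (R : Finset Tri) (s : State) (t : Tab) : Set Cube :=
  {c | c ∈ cubes R ∧ height c ≤ s.tab t (proj c).1 (proj c).2 0}

end Calisson

open Calisson

/-! The bridge between tilings and dicuts is the height function. The cubes over a vertex of `R`
form a column whose heights fill one residue class modulo 3, so a function `H` on the vertices with
values in these classes (`Lattice`) describes the set of cubes below it (`belowFn`). That no arc
goes from above `H` to below `H` (`Closed`) means three things: `H` rises by at most 1 along every
edge of `R`, by exactly 1 along the edges of `∂R`, `X₁`, `X₂`, and it agrees at the two vertices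
opposite to an interior edge of `X₂`. All increments are 1 modulo 3, and each triangle is a directed
cycle of three edges, with total increment 0; hence exactly one edge of each triangle falls, by 2.
The falling edges are the lozenges of a tiling (`isTiling_tilingOf`), and equal opposite heights
express saliency (`solves_tilingOf`). Conversely, a tiling prescribes increments 1 and -2 with sum 0
around every triangle; on a simply connected region such data integrate to a function
(`exists_region_potential`), and for a solution this function is closed (`closed_of_solves`).

The boundary is connected (`boundary_connected`), so its heights are determined by one of them. The
lower cut is the maximum over boundary vertices of boundary height minus directed distance, the
upper cut is the dual minimum. Without shortcuts they are the least and the greatest functions with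
the given boundary values that rise by at most 1 along edges. The lower one already gives a tiling,
and a tiling excludes inconsistencies and shortcuts, so the first step rejects exactly when there is
no tiling. The height function of a solution lies between the two cuts and is closed, so it stays
above everything that backward traversal adds to the lower cut (`Cuts.grown_subset_of_solves`).
Crossing the upper cut therefore refutes solvability; if this never happens, the traversal ends with
a closed function, which is a solution.

For the running time, let `B` be the number of boundary vertices. Boundary heights have spread at
most `B` (`boundary_heights_sub_le`), and each vertex is within `B` horizontal steps of the boundary
(`exists_near_boundary`). Hence the searches visit `O(B)` levels, scanning all vertices at each, and
the two cuts differ by at most `3 * B` at each vertex, which bounds the work of the second step.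

On the program side, text without loops is evaluated as a function (`Cmd.eval`), loops are treated
by an invariant and a decreasing measure (`exec_loop`), and both cuts are instances of one generic
search (`Search.exec`). -/

namespace Calisson

/-! ## Execution of programs -/

/-- The command contains no loop. -/
def Cmd.flat : Cmd → Bool
  | skip => true
  | set _ _ => true
  | store _ _ _ _ _ => true
  | seq c c' => c.flat && c'.flat
  | ite _ c c' => c.flat && c'.flat
  | loop _ _ => false

open Classical in
/-- The effect of a command without loop. -/
noncomputable def Cmd.eval : Cmd → State → State
  | skip, s => s
  | set r e, s => s.setReg r (e.val s)
  | store t p q r e, s => s.setTab t (p.val s) (q.val s) (r.val s) (e.val s)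
  | seq c c', s => c'.eval (c.eval s)
  | ite p c c', s => if p.holds s then c.eval s else c'.eval s
  | loop _ _, s => s

/-- A bound on the running time of a command without loop. -/
def Cmd.bound : Cmd → ℕ
  | skip => 1
  | set _ e => e.cost + 1
  | store _ p q r e => p.cost + q.cost + r.cost + e.cost + 1
  | seq c c' => c.bound + c'.bound
  | ite p c c' => p.cost + 1 + (c.bound + c'.bound)
  | loop _ _ => 0

/-- The command may write the register `r`. -/
def Cmd.modReg (r : Reg) : Cmd → Bool
  | skip => false
  | set r' _ => decide (r = r')
  | store _ _ _ _ _ => false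
  | seq c c' => c.modReg r || c'.modReg r
  | ite _ c c' => c.modReg r || c'.modReg r
  | loop _ c => c.modReg r

/-- The command may write the table `t`. -/
def Cmd.modTab (t : Tab) : Cmd → Bool
  | skip => false
  | set _ _ => false
  | store t' _ _ _ _ => decide (t = t')
  | seq c c' => c.modTab t || c'.modTab t
  | ite _ c c' => c.modTab t || c'.modTab t
  | loop _ c => c.modTab t

@[simp] theorem State.setReg_reg (s : State) (r r' : Reg) (n : ℤ) :
    (s.setReg r n).reg r' = if r' = r then n else s.reg r' := by
  simp [State.setReg, Function.update_apply]

@[simp] theorem State.setReg_tab (s : State) (r : Reg) (n : ℤ) : (s.setReg r n).tab = s.tab := rfl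

@[simp] theorem State.setTab_reg (s : State) (t : Tab) (p q r n : ℤ) :
    (s.setTab t p q r n).reg = s.reg := rfl

theorem State.setTab_tab (s : State) (t t' : Tab) (p q r n p' q' r' : ℤ) :
    (s.setTab t p q r n).tab t' p' q' r' =
      if t' = t ∧ p' = p ∧ q' = q ∧ r' = r then n else s.tab t' p' q' r' := rfl

@[simp] theorem State.setTab_tab_of_ne (s : State) {t t' : Tab} (p q r n : ℤ) (h : t' ≠ t) :
    (s.setTab t p q r n).tab t' = s.tab t' := by
  funext p' q' r'
  simp [State.setTab_tab, h]

@[simp] theorem State.setTab_tab_self (s : State) (t : Tab) (p q r n p' q' r' : ℤ) :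
    (s.setTab t p q r n).tab t p' q' r' =
      if p' = p ∧ q' = q ∧ r' = r then n else s.tab t p' q' r' := by
  simp [State.setTab_tab]

/-- Frame rule. The side condition is a computation on the program text, so uses of it are closed by
`rfl`; this carries data from one phase of the algorithm to the next. -/
theorem Exec.reg_eq {c : Cmd} {s s' : State} {n : ℕ} (h : Exec c s n s') {r : Reg}
    (hr : c.modReg r = false) : s'.reg r = s.reg r := by
  induction h with
  | skip => rfl
  | set r' e s => simp [Cmd.modReg] at hr; simp [hr]
  | store => rfl
  | seq _ _ ih ih' => simp [Cmd.modReg] at hr; rw [ih' hr.2, ih hr.1]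
  | ite_true _ _ ih => simp [Cmd.modReg] at hr; rw [ih hr.1]
  | ite_false _ _ ih => simp [Cmd.modReg] at hr; rw [ih hr.2]
  | loop_done => rfl
  | loop_step _ _ _ ih ih' => rw [ih' hr, ih hr]

theorem Exec.tab_eq {c : Cmd} {s s' : State} {n : ℕ} (h : Exec c s n s') {t : Tab}
    (ht : c.modTab t = false) : s'.tab t = s.tab t := by
  induction h with
  | skip => rfl
  | set r' e s => rfl
  | store t' p q r e s => simp [Cmd.modTab] at ht; simp [ht]
  | seq _ _ ih ih' => simp [Cmd.modTab] at ht; rw [ih' ht.2, ih ht.1]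
  | ite_true _ _ ih => simp [Cmd.modTab] at ht; rw [ih ht.1]
  | ite_false _ _ ih => simp [Cmd.modTab] at ht; rw [ih ht.2]
  | loop_done => rfl
  | loop_step _ _ _ ih ih' => rw [ih' ht, ih ht]

/-- `Cmd.bound` adds the bounds of both branches of a conditional, so a single number serves for
every initial memory. This replaces the relation `Exec` by a function wherever there is no loop. -/
theorem exec_eval (c : Cmd) (hc : c.flat = true) (s : State) :
    ∃ n, n ≤ c.bound ∧ Exec c s n (c.eval s) := by
  induction c generalizing s with
  | skip => exact ⟨_, le_rfl, .skip s⟩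
  | set r e => exact ⟨_, le_rfl, .set r e s⟩
  | store t p q r e => exact ⟨_, le_rfl, .store t p q r e s⟩
  | seq c c' ih ih' =>
    simp only [Cmd.flat, Bool.and_eq_true] at hc
    obtain ⟨n, hn, h⟩ := ih hc.1 s
    obtain ⟨n', hn', h'⟩ := ih' hc.2 (c.eval s)
    exact ⟨_, Nat.add_le_add hn hn', .seq h h'⟩
  | ite p c c' ih ih' =>
    simp only [Cmd.flat, Bool.and_eq_true] at hc
    by_cases hp : p.holds s
    · obtain ⟨n, hn, h⟩ := ih hc.1 s
      refine ⟨_, ?_, by simpa only [Cmd.eval, if_pos hp] using Exec.ite_true hp h⟩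
      simp only [Cmd.bound]; omega
    · obtain ⟨n, hn, h⟩ := ih' hc.2 s
      refine ⟨_, ?_, by simpa only [Cmd.eval, if_neg hp] using Exec.ite_false hp h⟩
      simp only [Cmd.bound]; omega
  | loop p c => simp [Cmd.flat] at hc

theorem Cmd.eval_reg (c : Cmd) (s : State) {r : Reg} (hr : c.modReg r = false) :
    (c.eval s).reg r = s.reg r := by
  induction c generalizing s with
  | skip => rfl
  | set r' e => simp [Cmd.modReg] at hr; simp [Cmd.eval, hr]
  | store t p q r e => rfl
  | seq c c' ih ih' => simp [Cmd.modReg] at hr; simp [Cmd.eval, ih' _ hr.2, ih _ hr.1]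
  | ite p c c' ih ih' =>
    simp [Cmd.modReg] at hr
    by_cases hp : p.holds s <;> simp [Cmd.eval, hp, ih' _ hr.2, ih _ hr.1]
  | loop p c => rfl

theorem Cmd.eval_tab (c : Cmd) (s : State) {t : Tab} (ht : c.modTab t = false) :
    (c.eval s).tab t = s.tab t := by
  induction c generalizing s with
  | skip => rfl
  | set r' e => rfl
  | store t' p q r e => simp [Cmd.modTab] at ht; simp [Cmd.eval, ht]
  | seq c c' ih ih' => simp [Cmd.modTab] at ht; simp [Cmd.eval, ih' _ ht.2, ih _ ht.1]
  | ite p c c' ih ih' =>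
    simp [Cmd.modTab] at ht
    by_cases hp : p.holds s <;> simp [Cmd.eval, hp, ih' _ ht.2, ih _ ht.1]
  | loop p c => rfl

/-! ### Evaluation rules -/

@[simp] theorem eval_set (r : Reg) (e : Expr) (s : State) :
    (Cmd.set r e).eval s = s.setReg r (e.val s) := rfl
@[simp] theorem eval_store (t : Tab) (p q r e : Expr) (s : State) :
    (Cmd.store t p q r e).eval s = s.setTab t (p.val s) (q.val s) (r.val s) (e.val s) := rfl
@[simp] theorem eval_seq (c c' : Cmd) (s : State) :
    (Cmd.seq c c').eval s = c'.eval (c.eval s) := rfl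
theorem eval_ite_pos {p : Test} {s : State} (h : p.holds s) (c c' : Cmd) :
    (Cmd.ite p c c').eval s = c.eval s := if_pos h
theorem eval_ite_neg {p : Test} {s : State} (h : ¬ p.holds s) (c c' : Cmd) :
    (Cmd.ite p c c').eval s = c'.eval s := if_neg h
@[simp] theorem eval_block_nil (s : State) : (block []).eval s = s := rfl
@[simp] theorem eval_block_cons (c : Cmd) (cs : List Cmd) (s : State) :
    (block (c :: cs)).eval s = (block cs).eval (c.eval s) := rfl
theorem eval_when_pos {p : Test} {s : State} (h : p.holds s) (cs : List Cmd) :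
    (when p cs).eval s = (block cs).eval s := if_pos h
theorem eval_when_neg {p : Test} {s : State} (h : ¬ p.holds s) (cs : List Cmd) :
    (when p cs).eval s = s := if_neg h

@[simp] theorem val_zero (s : State) : (0 : Expr).val s = 0 := rfl
@[simp] theorem val_two (s : State) : (2 : Expr).val s = 2 := rfl
@[simp] theorem val_one (s : State) : (1 : Expr).val s = 1 := rfl
@[simp] theorem val_reg (r : Reg) (s : State) : (Expr.reg r).val s = s.reg r := rfl
@[simp] theorem val_get (t : Tab) (p q r : Expr) (s : State) :
    (Expr.get t p q r).val s = s.tab t (p.val s) (q.val s) (r.val s) := rfl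
@[simp] theorem val_add (e f : Expr) (s : State) : (e + f).val s = e.val s + f.val s := rfl
@[simp] theorem val_sub (e f : Expr) (s : State) : (e - f).val s = e.val s - f.val s := rfl
@[simp] theorem val_dx (i : Fin 3) (s : State) : (dx i).val s = (vec i).1 := rfl
@[simp] theorem val_dy (i : Fin 3) (s : State) : (dy i).val s = (vec i).2 := rfl
@[simp] theorem val_dir (i : Fin 3) (s : State) : (lit i).val s = ((i : ℕ) : ℤ) := rfl
@[simp] theorem holds_eq (e f : Expr) (s : State) :
    (Test.eq e f).holds s ↔ e.val s = f.val s := Iff.rfl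
@[simp] theorem holds_lt (e f : Expr) (s : State) :
    (Test.lt e f).holds s ↔ e.val s < f.val s := Iff.rfl
@[simp] theorem holds_not (p : Test) (s : State) : (Test.not p).holds s ↔ ¬ p.holds s := Iff.rfl
@[simp] theorem holds_and (p q : Test) (s : State) :
    (Test.and p q).holds s ↔ p.holds s ∧ q.holds s := Iff.rfl
@[simp] theorem holds_or (p q : Test) (s : State) :
    (Test.or p q).holds s ↔ p.holds s ∨ q.holds s := Iff.rfl

@[simp] theorem cost_zero : (0 : Expr).cost = 1 := rfl
@[simp] theorem cost_one : (1 : Expr).cost = 1 := rfl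
@[simp] theorem cost_reg (r : Reg) : (Expr.reg r).cost = 1 := rfl
@[simp] theorem cost_two : (2 : Expr).cost = 1 := rfl
@[simp] theorem cost_get (t : Tab) (p q r : Expr) :
    (Expr.get t p q r).cost = p.cost + q.cost + r.cost + 1 := rfl
@[simp] theorem cost_add (e f : Expr) : (e + f).cost = e.cost + f.cost + 1 := rfl
@[simp] theorem cost_lt (e f : Expr) : (Test.lt e f).cost = e.cost + f.cost + 1 := rfl

/-! ### Loops -/

/-- Strong induction on the measure `μ`: the body is executed at most `μ s` times and the test at
most once more. -/
theorem exec_loop {p : Test} {c : Cmd} (I : State → Prop) (μ : State → ℕ) (K : ℕ)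
    (hstep : ∀ s, I s → p.holds s → ∃ n s', n ≤ K ∧ Exec c s n s' ∧ I s' ∧ μ s' < μ s)
    (s : State) (hs : I s) :
    ∃ n s', n ≤ (μ s + 1) * (p.cost + 1 + K) ∧ Exec (.loop p c) s n s' ∧ I s' ∧ ¬ p.holds s' := by
  induction hm : μ s using Nat.strong_induction_on generalizing s with
  | _ m ih =>
    subst hm
    by_cases hp : p.holds s
    · obtain ⟨n, s', hn, he, hI, hμ⟩ := hstep s hs hp
      obtain ⟨n', s'', hn', he', hI', hp'⟩ := ih _ hμ s' hI rfl
      refine ⟨_, s'', ?_, .loop_step hp he he', hI', hp'⟩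
      have : (μ s' + 1 + 1) * (p.cost + 1 + K) ≤ (μ s + 1) * (p.cost + 1 + K) :=
        Nat.mul_le_mul_right _ (by omega)
      rw [Nat.add_mul (μ s' + 1)] at this
      omega
    · refine ⟨_, s, ?_, .loop_done hp, hs, hp⟩
      have : 1 * (p.cost + 1 + K) ≤ (μ s + 1) * (p.cost + 1 + K) :=
        Nat.mul_le_mul_right _ (by omega)
      omega

/-- The body writes neither the counter nor the register `r`, so the number of rounds is fixed at
the start. The constant 20 absorbs the test, the increment and the initialization. -/
theorem exec_forEach {r : Reg} {cs : List Cmd} (hflat : (block cs).flat = true)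
    (hj : (block cs).modReg .j = false) (hr : (block cs).modReg r = false) (hrj : r ≠ .j)
    {s : State} {N : ℕ} (hN : s.reg r = N) (I : ℕ → State → Prop)
    (h0 : I 0 (s.setReg .j 0))
    (hstep : ∀ i < N, ∀ s : State, s.reg .j = (i : ℤ) → I i s →
      I (i + 1) (((block cs).eval s).setReg .j (i + 1))) :
    ∃ n s', n ≤ (N + 1) * ((block cs).bound + 20) ∧ Exec (forEach r cs) s n s' ∧ I N s' := by
  obtain ⟨n, s', hn, he, ⟨hI, i, hi, hji, hri⟩, hp⟩ := exec_loop (p := .lt Reg.j r)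
    (c := block [block cs, .set .j (Reg.j + 1)])
    (fun s => s.reg r = N ∧ ∃ i : ℕ, i ≤ N ∧ s.reg .j = i ∧ I i s)
    (fun s => (N - s.reg .j).toNat) ((block cs).bound + 5) (by
      rintro s ⟨hN, i, hi, hji, hI⟩ hp
      simp only [holds_lt, val_reg, hN, hji] at hp
      have hi' : i < N := by omega
      obtain ⟨n, hn, h⟩ := exec_eval (block cs) hflat s
      refine ⟨_, _, ?_, .seq h (.seq (.set .j _ _) (.skip _)), ⟨?_, i + 1, hi', ?_, ?_⟩, ?_⟩
      · simp only [cost_add, cost_reg, cost_one]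
        omega
      · simp [hrj, Cmd.eval_reg _ _ hr, hN]
      · simp [Cmd.eval_reg _ _ hj, hji]
      · simpa [Cmd.eval_reg _ _ hj, hji] using hstep i hi' s hji hI
      · simp [Cmd.eval_reg _ _ hj, hji]; omega)
    (s.setReg .j 0) ⟨by simp [hrj, hN], 0, by omega, by simp, h0⟩
  refine ⟨_, s', ?_, .seq (.set .j 0 s) (.seq he (.skip _)), ?_⟩
  · simp only [cost_lt, cost_reg, State.setReg_reg, if_true, sub_zero, Int.toNat_natCast,
      cost_zero] at hn ⊢
    nlinarith
  · simp only [holds_lt, val_reg, hI, hji] at hp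
    obtain rfl : i = N := by omega
    exact hri

/-! ## Topology of the triangular grid -/

theorem Tri.mem_edges {e : Edge} {t : Tri} : e ∈ t.edges ↔ t = e.left ∨ t = e.right := by
  obtain ⟨⟨a, b⟩, d⟩ := e
  obtain ⟨⟨p, q⟩, k⟩ := t
  fin_cases d <;> fin_cases k <;> simp [Tri.edges, Edge.left, Edge.right, vec] <;> omega

theorem mem_edges {R : Finset Tri} {e : Edge} : e ∈ edges R ↔ e.left ∈ R ∨ e.right ∈ R := by
  simp only [edges, Finset.mem_biUnion, Tri.mem_edges]
  constructor
  · rintro ⟨t, ht, rfl | rfl⟩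
    exacts [.inl ht, .inr ht]
  · rintro (h | h)
    exacts [⟨_, h, .inl rfl⟩, ⟨_, h, .inr rfl⟩]

theorem Edge.left_ne_right (e : Edge) : e.left ≠ e.right := by
  simp [Edge.left, Edge.right]

theorem lozenge_subset {R : Finset Tri} {e : Edge} :
    e.lozenge ⊆ R ↔ e.left ∈ R ∧ e.right ∈ R := by
  simp [Edge.lozenge, Finset.insert_subset_iff]

theorem mem_boundary {R : Finset Tri} {e : Edge} :
    e ∈ boundary R ↔ (e.left ∈ R ↔ e.right ∉ R) := by
  simp only [boundary, Finset.mem_filter, mem_edges, lozenge_subset]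
  tauto

theorem boundary_subset_edges {R : Finset Tri} {e : Edge} (h : e ∈ boundary R) : e ∈ edges R :=
  (Finset.mem_filter.1 h).1

theorem mem_boundaryVerts {R : Finset Tri} {v : Vertex} :
    v ∈ boundaryVerts R ↔ ∃ e ∈ boundary R, v = e.base ∨ v = e.tip := by
  simp [boundaryVerts]

theorem Tri.verts_of_edges {e : Edge} {t : Tri} (h : e ∈ t.edges) :
    e.base ∈ t.verts ∧ e.tip ∈ t.verts := by
  rw [Tri.mem_edges] at h
  obtain ⟨⟨a, b⟩, d⟩ := e
  rcases h with rfl | rfl <;> fin_cases d <;>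
    simp [Edge.left, Edge.right, Edge.tip, Tri.verts, vec]

theorem base_mem_verts {R : Finset Tri} {e : Edge} (h : e ∈ edges R) : e.base ∈ verts R := by
  simp only [edges, verts, Finset.mem_biUnion] at h ⊢
  obtain ⟨t, ht, h⟩ := h
  exact ⟨t, ht, (Tri.verts_of_edges h).1⟩

theorem tip_mem_verts {R : Finset Tri} {e : Edge} (h : e ∈ edges R) : e.tip ∈ verts R := by
  simp only [edges, verts, Finset.mem_biUnion] at h ⊢
  obtain ⟨t, ht, h⟩ := h
  exact ⟨t, ht, (Tri.verts_of_edges h).2⟩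

theorem boundaryVerts_subset {R : Finset Tri} {v : Vertex} (h : v ∈ boundaryVerts R) :
    v ∈ verts R := by
  obtain ⟨e, he, rfl | rfl⟩ := mem_boundaryVerts.1 h
  exacts [base_mem_verts (boundary_subset_edges he), tip_mem_verts (boundary_subset_edges he)]

theorem mem_tri_verts {v : Vertex} {t : Tri} :
    v ∈ t.verts ↔ ∃ i : Fin 3, t = (⟨v, i⟩ : Edge).left ∨ t = (⟨v, i⟩ : Edge).right := by
  obtain ⟨a, b⟩ := v
  obtain ⟨⟨p, q⟩, k⟩ := t
  fin_cases k <;> simp [Tri.verts, Edge.left, Edge.right, vec, Fin.exists_fin_succ] <;> omega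

theorem mem_verts {R : Finset Tri} {v : Vertex} :
    v ∈ verts R ↔ ∃ i : Fin 3, (⟨v, i⟩ : Edge) ∈ edges R := by
  simp only [verts, Finset.mem_biUnion, mem_tri_verts, mem_edges]
  constructor
  · rintro ⟨t, ht, i, rfl | rfl⟩
    exacts [⟨i, .inl ht⟩, ⟨i, .inr ht⟩]
  · rintro ⟨i, h | h⟩
    exacts [⟨_, h, i, .inl rfl⟩, ⟨_, h, i, .inr rfl⟩]

/-- The cyclic order of the edges and triangles around a vertex. -/
theorem star_triangles (v : Vertex) :
    (⟨v, 0⟩ : Edge).left = (⟨v - vec 2, 2⟩ : Edge).left ∧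
    (⟨v, 1⟩ : Edge).left = (⟨v - vec 0, 0⟩ : Edge).left ∧
    (⟨v, 2⟩ : Edge).left = (⟨v - vec 1, 1⟩ : Edge).left ∧
    (⟨v, 0⟩ : Edge).right = (⟨v - vec 1, 1⟩ : Edge).right ∧
    (⟨v, 1⟩ : Edge).right = (⟨v - vec 2, 2⟩ : Edge).right ∧
    (⟨v, 2⟩ : Edge).right = (⟨v - vec 0, 0⟩ : Edge).right := by
  obtain ⟨a, b⟩ := v
  simp [Edge.left, Edge.right, vec, sub_eq_add_neg]

/-- None of the six edges at `v` separates `R` from its complement, so membership in `R` propagates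
around the star. One of the six triangles belongs to `R`, hence all do. -/
theorem interior_star {R : Finset Tri} {v : Vertex} (hv : v ∈ verts R)
    (hb : v ∉ boundaryVerts R) (i : Fin 3) :
    (⟨v, i⟩ : Edge) ∈ edges R ∧ (⟨v - vec i, i⟩ : Edge) ∈ edges R := by
  have h1 : ∀ i, ((⟨v, i⟩ : Edge).left ∈ R ↔ (⟨v, i⟩ : Edge).right ∈ R) := by
    intro i
    have := mt (fun h => mem_boundaryVerts.2 ⟨(⟨v, i⟩ : Edge), h, .inl rfl⟩) hb
    rw [mem_boundary] at this
    tauto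
  have h2 : ∀ i, ((⟨v - vec i, i⟩ : Edge).left ∈ R ↔ (⟨v - vec i, i⟩ : Edge).right ∈ R) := by
    intro i
    have := mt (fun h => mem_boundaryVerts.2
      ⟨(⟨v - vec i, i⟩ : Edge), h, .inr (by simp [Edge.tip])⟩) hb
    rw [mem_boundary] at this
    tauto
  obtain ⟨e1, e2, e3, e4, e5, e6⟩ := star_triangles v
  have b0 := h2 0
  have b1 := h2 1
  have b2 := h2 2
  rw [← e2, ← e6] at b0
  rw [← e3, ← e4] at b1
  rw [← e1, ← e5] at b2
  have c1 : (⟨v, 1⟩ : Edge).left ∈ R ↔ (⟨v, 0⟩ : Edge).left ∈ R :=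
    (b0.trans (h1 2).symm).trans (b1.trans (h1 0).symm)
  have c2 : (⟨v, 2⟩ : Edge).left ∈ R ↔ (⟨v, 0⟩ : Edge).left ∈ R := b1.trans (h1 0).symm
  have hall : ∀ i, (⟨v, i⟩ : Edge).left ∈ R ↔ (⟨v, 0⟩ : Edge).left ∈ R := by
    intro i
    fin_cases i
    exacts [Iff.rfl, c1, c2]
  obtain ⟨l, hl⟩ := mem_verts.1 hv
  rw [mem_edges, ← h1, or_self, hall] at hl
  refine ⟨mem_edges.2 (.inl ((hall i).2 hl)), mem_edges.2 (.inl ?_)⟩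
  have : (⟨v - vec i, i⟩ : Edge).left = (⟨v, i + 1⟩ : Edge).left := by
    fin_cases i
    exacts [e2.symm, e3.symm, e1.symm]
  rw [this]
  exact (hall _).2 hl

/-! ### Induction on connected sets of triangles -/

theorem connected_induction {A : Set Tri} (h : (triGraph.induce A).Preconnected) (P : Tri → Prop)
    (hP : ∀ e : Edge, e.left ∈ A → e.right ∈ A → (P e.left ↔ P e.right)) {s t : Tri}
    (hs : s ∈ A) (ht : t ∈ A) (h0 : P s) : P t := by
  obtain ⟨w⟩ := h ⟨s, hs⟩ ⟨t, ht⟩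
  generalize hs' : (⟨s, hs⟩ : A) = s' at w
  generalize ht' : (⟨t, ht⟩ : A) = t' at w
  induction w generalizing s with
  | nil => cases hs'; cases ht'; exact h0
  | @cons u v w hadj p ih =>
    subst hs'
    refine ih v.2 ?_ rfl ht'
    simp only [SimpleGraph.comap_adj, triGraph, SimpleGraph.fromRel_adj] at hadj
    obtain ⟨-, ⟨e, h1, h2⟩ | ⟨e, h1, h2⟩⟩ := hadj
    · have := hP e (h1 ▸ hs) (h2 ▸ v.2)
      rw [← h2, ← h1] at this
      exact this.1 h0
    · have := hP e (h1 ▸ v.2) (h2 ▸ hs)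
      rw [← h2, ← h1] at this
      exact this.2 h0

/-! ### Closed forms on the plane are exact -/

theorem exists_primitive (f : ℤ → ℤ) : ∃ F : ℤ → ℤ, ∀ n, F (n + 1) = F n + f n := by
  refine ⟨fun n => match n with
    | .ofNat m => ∑ i ∈ Finset.range m, f i
    | .negSucc m => - ∑ i ∈ Finset.range (m + 1), f (-(i + 1)), fun n => ?_⟩
  rcases n with m | m
  · have : (Int.ofNat m + 1 : ℤ) = Int.ofNat (m + 1) := rfl
    rw [this]
    simp [Finset.sum_range_succ]
  · rcases m with _ | m
    · have : (Int.negSucc 0 + 1 : ℤ) = Int.ofNat 0 := rfl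
      rw [this]
      simp
    · have : (Int.negSucc (m + 1) + 1 : ℤ) = Int.negSucc m := rfl
      rw [this]
      have h2 : (Int.negSucc (m + 1) : ℤ) = -(((m + 1 : ℕ) : ℤ) + 1) := rfl
      simp only [Finset.sum_range_succ _ (m + 1)]
      rw [h2]
      ring

/-- Integrate `A` along the horizontal axis, then `B` vertically. The hypothesis says that the form
closes up around unit squares, which makes horizontal increments correct in every row. -/
theorem exists_potential (A B : ℤ → ℤ → ℤ)
    (h : ∀ x y, A x y + B (x + 1) y = B x y + A x (y + 1)) :
    ∃ g : ℤ → ℤ → ℤ, (∀ x y, g (x + 1) y = g x y + A x y) ∧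
      ∀ x y, g x (y + 1) = g x y + B x y := by
  obtain ⟨F, hF⟩ := exists_primitive fun x => A x 0
  choose G hG using fun x => exists_primitive (B x)
  refine ⟨fun x y => F x + (G x y - G x 0), fun x y => ?_, fun x y => ?_⟩
  · induction y using Int.induction_on with
    | zero => simp [hF]
    | succ n ih =>
      have := h x n
      simp only [hG] at ih ⊢
      linarith
    | pred n ih =>
      have h1 := h x (-n - 1)
      have h2 := hG x (-n - 1)
      have h3 := hG (x + 1) (-n - 1)
      rw [sub_add_cancel] at h1 h2 h3
      linarith
  · simp only [hG]
    ring

/-- The sum of the values of a function of edges around a triangle. -/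
def curl (ω : Edge → ℤ) (t : Tri) : ℤ :=
  ω ⟨t.base, ![0, 1] t.kind⟩ + ω ⟨t.base + ![vec 0, vec 1] t.kind, ![1, 0] t.kind⟩ +
    ω ⟨t.base + vec 0 + vec 1, 2⟩

theorem curl_eq_zero_of_edges {ω : Edge → ℤ} {t : Tri} (h : ∀ e ∈ t.edges, ω e = 0) :
    curl ω t = 0 := by
  simp only [Tri.edges, Finset.mem_insert, Finset.mem_singleton, forall_eq_or_imp, forall_eq] at h
  simp [curl, h]

theorem curl_congr {ω ω' : Edge → ℤ} {t : Tri} (h : ∀ e ∈ t.edges, ω e = ω' e) :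
    curl ω t = curl ω' t := by
  simp only [Tri.edges, Finset.mem_insert, Finset.mem_singleton, forall_eq_or_imp, forall_eq] at h
  simp [curl, h]

/-- Each triangle, of either kind, is a directed cycle, so both triangles adjacent to an edge count
it with the sign `+`. -/
theorem curl_single (e : Edge) (t : Tri) :
    curl (Pi.single e 1) t = (if t = e.left then 1 else 0) + (if t = e.right then 1 else 0) := by
  obtain ⟨⟨a, b⟩, d⟩ := e
  obtain ⟨⟨p, q⟩, k⟩ := t
  fin_cases d <;> fin_cases k <;>
    simp [curl, Edge.left, Edge.right, vec, Pi.single_apply, ← sub_eq_add_neg] <;>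
    split_ifs <;> omega

/-- Subtracting the conditions of the two triangles of a unit square cancels their common diagonal
and leaves the condition of `exists_potential`; the values on the diagonals are then forced. -/
theorem exists_vertex_potential (ω : Edge → ℤ) (h : ∀ t, curl ω t = 0) :
    ∃ g : Vertex → ℤ, ∀ e : Edge, g e.tip = g e.base + ω e := by
  obtain ⟨g, h0, h1⟩ := exists_potential (fun x y => ω ⟨(x, y), 0⟩) (fun x y => ω ⟨(x, y), 1⟩) (by
    intro x y
    have a0 := h ⟨(x, y), 0⟩
    have a1 := h ⟨(x, y), 1⟩
    simp [curl, vec] at a0 a1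
    linarith)
  refine ⟨fun v => g v.1 v.2, ?_⟩
  rintro ⟨⟨x, y⟩, d⟩
  fin_cases d
  · simp [Edge.tip, vec, h0]
  · simp [Edge.tip, vec, h1]
  · have a0 := h ⟨(x - 1, y - 1), 0⟩
    have b0 := h0 (x - 1) (y - 1)
    have b1 := h1 x (y - 1)
    simp [curl, vec] at a0 b0 b1
    simp [Edge.tip, vec, ← sub_eq_add_neg]
    linarith

/-- The dual statement: a flow with equal inflow and outflow at every vertex is the jump of a
function of the triangles. The potential is integrated on triangles of kind `0`, each step crossing
two edges, and extended to kind `1` across the diagonal edges. -/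
theorem exists_triangle_potential (ω : Edge → ℤ)
    (h : ∀ v, ω ⟨v, 0⟩ + ω ⟨v, 1⟩ + ω ⟨v, 2⟩ =
      ω ⟨v - vec 0, 0⟩ + ω ⟨v - vec 1, 1⟩ + ω ⟨v - vec 2, 2⟩) :
    ∃ f : Tri → ℤ, ∀ e : Edge, f e.left = f e.right + ω e := by
  obtain ⟨g, h0, h1⟩ := exists_potential
    (fun x y => ω ⟨(x + 2, y + 1), 2⟩ - ω ⟨(x + 1, y), 1⟩)
    (fun x y => ω ⟨(x, y + 1), 0⟩ - ω ⟨(x + 1, y + 1), 2⟩) (by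
    intro x y
    have a := h (x + 1, y + 1)
    simp [vec, add_assoc] at a
    simp [add_assoc]
    linarith)
  refine ⟨fun t => ![g t.base.1 t.base.2,
    g t.base.1 t.base.2 - ω ⟨(t.base.1 + 1, t.base.2 + 1), 2⟩] t.kind, ?_⟩
  rintro ⟨⟨x, y⟩, d⟩
  fin_cases d
  · have b1 := h1 x (y - 1)
    simp at b1
    simp [Edge.left, Edge.right, vec]
    linarith
  · have b0 := h0 (x - 1) y
    have e : x - 1 + 2 = x + 1 := by ring
    simp [e] at b0
    simp [Edge.left, Edge.right, vec]
    linarith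
  · simp [Edge.left, Edge.right, vec]

/-! ### The boundary of a simply connected region is connected -/

/-- Keep only the boundary edges that lie in `S`, each with its jump of the indicator `χ` of `R`. As
`S` contains both ends of a boundary edge or none, this is a conserved flow, hence the jump of some
function `f`. But `f` is constant on `R` and on its complement, so its jump across `∂R`, from inside
to outside, is everywhere the same: it cannot be 1 on the part in `S` and 0 elsewhere. -/
theorem boundary_connected {R : Finset Tri} (hR : IsSimplyConnectedRegion R) {S : Set Vertex}
    (hS : ∀ e ∈ boundary R, (e.base ∈ S ↔ e.tip ∈ S)) {v : Vertex} (hv : v ∈ boundaryVerts R)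
    (hvS : v ∈ S) {w : Vertex} (hw : w ∈ boundaryVerts R) : w ∈ S := by
  classical
  let χ : Tri → ℤ := fun t => if t ∈ R then 1 else 0
  let ω : Edge → ℤ := fun e => if e.base ∈ S then χ e.left - χ e.right else 0
  have hχ : ∀ e : Edge, e ∉ boundary R → χ e.left = χ e.right := by
    intro e he
    rw [mem_boundary] at he
    by_cases h1 : e.left ∈ R <;> by_cases h2 : e.right ∈ R <;> simp [χ, h1, h2] at he ⊢
  have hω : ∀ e : Edge, ω e = if e.tip ∈ S then χ e.left - χ e.right else 0 := by
    intro e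
    by_cases he : e ∈ boundary R
    · simp only [ω, hS e he]
    · simp [ω, hχ e he]
  have hin : ∀ u i, ω ⟨u - vec i, i⟩ = if u ∈ S then
      χ (⟨u - vec i, i⟩ : Edge).left - χ (⟨u - vec i, i⟩ : Edge).right else 0 := by
    intro u i
    rw [hω]
    simp [Edge.tip]
  obtain ⟨f, hf⟩ := exists_triangle_potential ω (by
    intro u
    rw [hin, hin, hin]
    by_cases hu : u ∈ S
    -- At a vertex of `S` nothing is cut off, and the jumps of `χ` telescope around the star.
    · obtain ⟨e1, e2, e3, e4, e5, e6⟩ := star_triangles u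
      simp only [ω, hu, if_true, e1, e2, e3, e4, e5, e6]
      ring
    · simp [ω, hu])
  have hconst : ∀ A : Set Tri, (A = (R : Set Tri) ∨ A = (R : Set Tri)ᶜ) →
      ∀ s ∈ A, ∀ t ∈ A, f t = f s := by
    intro A hA s hs t ht
    refine connected_induction (A := A) ?_ (fun t => f t = f s) ?_ hs ht rfl
    · rcases hA with rfl | rfl
      exacts [hR.connected.preconnected, hR.no_holes.preconnected]
    · intro e he1 he2
      have : e ∉ boundary R := by
        rw [mem_boundary]
        rcases hA with rfl | rfl <;> simp at he1 he2 <;> simp [he1, he2]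
      have h1 : f e.left = f e.right := by rw [hf]; simp [ω, hχ e this]
      simp only [h1]
  -- The four cases say on which side of each of the two edges `R` lies.
  have key : ∀ e ∈ boundary R, ∀ e' ∈ boundary R, e.base ∈ S → e'.base ∈ S := by
    intro e he e' he' hb
    by_contra hb'
    have h1 := hf e
    have h2 := hf e'
    simp only [ω, hb, hb', if_true, if_false] at h1 h2
    rw [mem_boundary] at he he'
    have hRc := hconst R (.inl rfl)
    have hOc := hconst _ (.inr rfl)
    simp only [Finset.mem_coe, Set.mem_compl_iff] at hRc hOc
    by_cases c1 : e.left ∈ R <;> by_cases c2 : e'.left ∈ R <;> simp only [c1, c2, true_iff,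
      false_iff, not_not] at he he' <;> simp only [χ, c1, he, if_true, if_false] at h1
    · have := hRc _ c1 _ c2
      have := hOc _ he _ he'
      omega
    · have := hRc _ c1 _ he'
      have := hOc _ he _ c2
      omega
    · have := hRc _ he _ c2
      have := hOc _ c1 _ he'
      omega
    · have := hRc _ he _ he'
      have := hOc _ c1 _ c2
      omega
  obtain ⟨e, he, hev⟩ := mem_boundaryVerts.1 hv
  obtain ⟨e', he', hew⟩ := mem_boundaryVerts.1 hw
  have hb : e.base ∈ S := by
    rcases hev with rfl | rfl
    exacts [hvS, (hS e he).2 hvS]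
  have hb' := key e he e' he' hb
  rcases hew with rfl | rfl
  exacts [hb', (hS e' he').1 hb']

/-! ### Closed forms on a simply connected region are exact -/

/-- A unit of curl can be pushed off to infinity through the complement of `R`, which is connected.
Crossing an edge `e` replaces `η` by `Pi.single e 1 - η`, since the edge form has curl 1 on both
sides. -/
theorem exists_curl_eq_single {R : Finset Tri} (hR : IsSimplyConnectedRegion R) {t : Tri}
    (ht : t ∉ R) : ∃ η : Edge → ℤ, (∀ e ∈ edges R, η e = 0) ∧ curl η = Pi.single t 1 := by
  classical
  -- The induction starts from a triangle to the right of the whole region.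
  obtain ⟨X, hX⟩ : ∃ X : ℤ, ∀ t ∈ R, t.base.1 < X := by
    obtain ⟨X, hX⟩ := (R.image fun t => t.base.1).exists_le
    exact ⟨X + 1, fun t ht => by
      have := hX _ (Finset.mem_image_of_mem (fun t : Tri => t.base.1) ht); omega⟩
  refine connected_induction (A := (R : Set Tri)ᶜ) hR.no_holes.preconnected
    (fun t => ∃ η : Edge → ℤ, (∀ e ∈ edges R, η e = 0) ∧ curl η = Pi.single t 1) ?_
    (s := ⟨(X, 0), 0⟩) (by simpa using fun h => lt_irrefl _ (hX _ h)) (by simpa using ht) ?_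
  · intro e h1 h2
    simp only [Set.mem_compl_iff, Finset.mem_coe] at h1 h2
    have he : ∀ e' ∈ edges R, (Pi.single e 1 : Edge → ℤ) e' = 0 := by
      intro e' he'
      rw [Pi.single_apply, if_neg]
      rintro rfl
      rw [mem_edges] at he'
      tauto
    have hsub : ∀ (η : Edge → ℤ) t, curl (Pi.single e 1 - η) t = curl (Pi.single e 1) t - curl η t := by
      intro η t
      simp only [curl, Pi.sub_apply]
      ring
    constructor <;> rintro ⟨η, hη, hc⟩ <;>
      refine ⟨Pi.single e 1 - η, fun e' he' => by simp [he e' he', hη e' he'], ?_⟩ <;>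
      funext t <;> rw [hsub, hc, curl_single] <;> simp [Pi.single_apply]
  -- Alternating signs on the edges crossed by a strip that runs to the right: they cancel in every
  -- triangle of the strip except the first.
  · refine ⟨fun e => (if e.base.2 = 0 ∧ X < e.base.1 ∧ e.dir = 1 then 1 else 0) -
      (if e.base.2 = 1 ∧ X + 1 < e.base.1 ∧ e.dir = 2 then 1 else 0), ?_, ?_⟩
    · rintro ⟨⟨p, q⟩, d⟩ he
      have : p < X + 1 ∨ d = 0 ∨ (d = 2 ∧ p < X + 2) := by
        rw [mem_edges] at he
        rcases he with h | h <;> have := hX _ h <;> fin_cases d <;>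
          simp [Edge.left, Edge.right, vec] at this ⊢ <;> omega
      fin_cases d <;> simp at this ⊢ <;> omega
    · funext t
      obtain ⟨⟨p, q⟩, k⟩ := t
      fin_cases k <;> simp [curl, vec, Pi.single_apply] <;> (split_ifs <;> first | rfl | omega)

/-- Extend `ω` by zero outside `R`. Nonzero curl can only appear in the finitely many outer
triangles touching an edge of `R`; it is removed by the forms of `exists_curl_eq_single`, which
vanish on the edges of `R`. The corrected form is exact on the whole plane. -/
theorem exists_region_potential {R : Finset Tri} (hR : IsSimplyConnectedRegion R) (ω : Edge → ℤ)
    (h : ∀ t ∈ R, curl ω t = 0) :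
    ∃ g : Vertex → ℤ, ∀ e ∈ edges R, g e.tip = g e.base + ω e := by
  classical
  let ω₀ : Edge → ℤ := fun e => if e ∈ edges R then ω e else 0
  have hω₀ : ∀ t ∈ R, curl ω₀ t = 0 := by
    intro t ht
    rw [← h t ht]
    refine curl_congr fun e he => if_pos ?_
    exact Finset.mem_biUnion.2 ⟨t, ht, he⟩
  let S : Finset Tri := (((edges R).image Edge.left) ∪ (edges R).image Edge.right).filter (· ∉ R)
  have hex : ∀ t, ∃ η : Edge → ℤ, (∀ e ∈ edges R, η e = 0) ∧
      (t ∉ R → curl η = Pi.single t 1) := by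
    intro t
    by_cases ht : t ∈ R
    · exact ⟨0, by simp, fun h => absurd ht h⟩
    · obtain ⟨η, h1, h2⟩ := exists_curl_eq_single hR ht
      exact ⟨η, h1, fun _ => h2⟩
  choose η hη hc using hex
  let η' : Edge → ℤ := fun e => ∑ t ∈ S, curl ω₀ t * η t e
  have hη' : ∀ e ∈ edges R, η' e = 0 :=
    fun e he => Finset.sum_eq_zero fun t _ => by rw [hη t e he, mul_zero]
  have hcη' : ∀ t, curl η' t = if t ∈ S then curl ω₀ t else 0 := by
    intro t
    have : curl η' t = ∑ u ∈ S, curl ω₀ u * curl (η u) t := by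
      simp only [curl, η', ← Finset.sum_add_distrib]
      exact Finset.sum_congr rfl fun u _ => by ring
    have h2 : ∀ u ∈ S, curl ω₀ u * curl (η u) t = if t = u then curl ω₀ u else 0 := by
      intro u hu
      rw [hc u (Finset.mem_filter.1 hu).2, Pi.single_apply]
      simp
    rw [this, Finset.sum_congr rfl h2, Finset.sum_ite_eq]
  obtain ⟨g, hg⟩ := exists_vertex_potential (fun e => ω₀ e - η' e) (by
    intro t
    have : curl (fun e => ω₀ e - η' e) t = curl ω₀ t - curl η' t := by
      simp only [curl]; ring
    rw [this, hcη']
    split_ifs with ht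
    · ring
    · rw [sub_zero]
      by_cases htR : t ∈ R
      · exact hω₀ t htR
      · refine curl_eq_zero_of_edges fun e he => if_neg fun heR => ht ?_
        simp only [S, Finset.mem_filter, Finset.mem_union, Finset.mem_image]
        refine ⟨?_, htR⟩
        rcases Tri.mem_edges.1 he with rfl | rfl
        exacts [.inl ⟨e, heR, rfl⟩, .inr ⟨e, heR, rfl⟩])
  refine ⟨g, fun e he => ?_⟩
  rw [hg, hη' e he]
  simp [ω₀, he]

/-! ## Cubes as vertices with a height -/

theorem dir_ne (i : Fin 3) : i ≠ i + 1 ∧ i ≠ i + 2 ∧ i + 1 ≠ i + 2 := by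
  revert i; decide

theorem dir_cases {i j : Fin 3} (h : i ≠ j) : j = i + 1 ∨ j = i + 2 := by
  revert i j; decide

theorem vec_sum (i : Fin 3) : vec i + vec (i + 1) + vec (i + 2) = 0 := by
  revert i; decide

theorem unit_sum (i : Fin 3) : unit i + unit (i + 1) + unit (i + 2) = (1, 1, 1) := by
  revert i; decide

theorem add_vec_add_vec (v : Vertex) (i : Fin 3) :
    v + vec i + vec (i + 1) = v - vec (i + 2) ∧ v + vec i + vec (i + 2) = v - vec (i + 1) := by
  have h := vec_sum i
  constructor <;> rw [eq_sub_iff_add_eq]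
  · rw [add_assoc, add_assoc, ← add_assoc (vec i), h, add_zero]
  · rw [add_assoc, add_assoc, add_comm (vec (i + 2)), ← add_assoc (vec i), h, add_zero]

theorem proj_add_unit (c : Cube) (i : Fin 3) : proj (c + unit i) = proj c + vec i := by
  obtain ⟨x, y, z⟩ := c
  fin_cases i <;> ext <;> simp [proj, unit, vec] <;> ring

theorem proj_sub_unit (c : Cube) (i : Fin 3) : proj (c - unit i) = proj c - vec i := by
  have := proj_add_unit (c - unit i) i
  rw [sub_add_cancel] at this
  rw [this, add_sub_cancel_right]

theorem height_add_unit (c : Cube) (i : Fin 3) : height (c + unit i) = height c + 1 := by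
  obtain ⟨x, y, z⟩ := c
  fin_cases i <;> simp [height, unit] <;> ring

theorem height_sub_unit (c : Cube) (i : Fin 3) : height (c - unit i) = height c - 1 := by
  have := height_add_unit (c - unit i) i
  rw [sub_add_cancel] at this
  omega

theorem cube_ext {c c' : Cube} (hp : proj c = proj c') (hh : height c = height c') : c = c' := by
  obtain ⟨x, y, z⟩ := c
  obtain ⟨x', y', z'⟩ := c'
  simp only [proj, height, Prod.mk.injEq] at *
  omega

/-- A function of the vertices whose value at each vertex is the height of a cube. -/
def IsCubeHeight (v : Vertex) (h : ℤ) : Prop := (3 : ℤ) ∣ h - (v.1 + v.2)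

theorem isCubeHeight (c : Cube) : IsCubeHeight (proj c) (height c) := by
  obtain ⟨x, y, z⟩ := c
  exact ⟨z, by simp [height, proj]; ring⟩

theorem exists_cube {v : Vertex} {h : ℤ} (hv : IsCubeHeight v h) :
    ∃ c, proj c = v ∧ height c = h := by
  obtain ⟨z, hz⟩ := hv
  refine ⟨(v.1 + z, v.2 + z, z), by simp [proj], ?_⟩
  simp only [height]
  omega

theorem IsCubeHeight.add_vec {v : Vertex} {h : ℤ} (hv : IsCubeHeight v h) (i : Fin 3) :
    IsCubeHeight (v + vec i) (h + 1) := by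
  obtain ⟨c, rfl, rfl⟩ := exists_cube hv
  rw [← proj_add_unit, ← height_add_unit c i]
  exact isCubeHeight _

theorem IsCubeHeight.sub_vec {v : Vertex} {h : ℤ} (hv : IsCubeHeight v h) (i : Fin 3) :
    IsCubeHeight (v - vec i) (h - 1) := by
  obtain ⟨c, rfl, rfl⟩ := exists_cube hv
  rw [← proj_sub_unit, ← height_sub_unit c i]
  exact isCubeHeight _

/-- Translation by `(1,1,1)` changes the height by 3. This gap is what turns strict inequalities
into drops by 2 along edges. -/
theorem IsCubeHeight.le_of_lt {v : Vertex} {h h' : ℤ} (hv : IsCubeHeight v h)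
    (hv' : IsCubeHeight v h') (hlt : h < h') : h + 3 ≤ h' := by
  obtain ⟨a, ha⟩ := hv
  obtain ⟨b, hb⟩ := hv'
  omega

/-- The arcs of the ascendant graph, up to translation by `(1,1,1)`: the last argument is the
difference of the heights. -/
inductive VArc (R : Finset Tri) (X₁ X₂ : Finset Edge) : Vertex → Vertex → ℤ → Prop
  | up (v : Vertex) (i : Fin 3) (h : (⟨v, i⟩ : Edge) ∈ edges R) : VArc R X₁ X₂ v (v + vec i) 1
  | down (v : Vertex) (i : Fin 3) (h : (⟨v, i⟩ : Edge) ∈ edges R)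
      (hX : (⟨v, i⟩ : Edge) ∈ boundary R ∪ X₁ ∪ X₂) : VArc R X₁ X₂ (v + vec i) v (-1)
  | lateral (v : Vertex) (i j k : Fin 3) (hij : i ≠ j) (hjk : j ≠ k) (hik : i ≠ k)
      (h : (⟨v, i⟩ : Edge).lozenge ⊆ R) (hX : (⟨v, i⟩ : Edge) ∈ X₂) :
      VArc R X₁ X₂ (v - vec j) (v - vec k) 0

section
variable {R : Finset Tri} {X₁ X₂ : Finset Edge}

theorem Arc.vArc {c c' : Cube} (h : Arc R X₁ X₂ c c') :
    VArc R X₁ X₂ (proj c) (proj c') (height c' - height c) := by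
  cases h with
  | up _ i h =>
    rw [proj_add_unit, height_add_unit, add_sub_cancel_left]
    exact .up _ _ h
  | down _ i h hX =>
    rw [proj_add_unit, height_add_unit, sub_add_cancel_left]
    exact .down _ _ h hX
  | lateral c i j k hij hjk hik h hX =>
    rw [proj_sub_unit, proj_sub_unit, height_sub_unit, height_sub_unit, sub_self]
    exact .lateral _ i j k hij hjk hik h hX

theorem VArc.exists_arc_to {v w : Vertex} {δ : ℤ} (h : VArc R X₁ X₂ v w δ) {c' : Cube}
    (hc' : proj c' = w) : ∃ c, proj c = v ∧ height c = height c' - δ ∧ Arc R X₁ X₂ c c' := by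
  cases h with
  | up _ i h =>
    refine ⟨c' - unit i, by rw [proj_sub_unit, hc', add_sub_cancel_right], height_sub_unit _ _, ?_⟩
    have := Arc.up (R := R) (X₁ := X₁) (X₂ := X₂) (c' - unit i) i
      (by rwa [proj_sub_unit, hc', add_sub_cancel_right])
    rwa [sub_add_cancel] at this
  | down _ i h hX =>
    subst hc'
    exact ⟨c' + unit i, proj_add_unit _ _, by rw [height_add_unit]; ring, .down _ _ h hX⟩
  | lateral u i j k hij hjk hik h hX =>
    have hu : proj (c' + unit k) = u := by rw [proj_add_unit, hc', sub_add_cancel]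
    subst hu
    refine ⟨c' + unit k - unit j, proj_sub_unit _ _,
      by rw [height_sub_unit, height_add_unit]; ring, ?_⟩
    have := Arc.lateral (R := R) (X₁ := X₁) (c' + unit k) i j k hij hjk hik h hX
    rwa [add_sub_cancel_right] at this

theorem VArc.isCubeHeight_left {v w : Vertex} {δ m : ℤ} (h : VArc R X₁ X₂ v w δ)
    (hm : IsCubeHeight w m) : IsCubeHeight v (m - δ) := by
  obtain ⟨c', rfl, rfl⟩ := exists_cube hm
  obtain ⟨c, rfl, h2, -⟩ := h.exists_arc_to rfl
  rw [← h2]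
  exact isCubeHeight c

/-! ### The edges of a triangle -/

theorem left_edges (v : Vertex) (i : Fin 3) : (⟨v, i⟩ : Edge).left.edges =
    {⟨v, i⟩, ⟨v + vec i, i + 1⟩, ⟨v - vec (i + 2), i + 2⟩} := by
  obtain ⟨a, b⟩ := v
  ext ⟨⟨p, q⟩, d⟩
  fin_cases i <;> fin_cases d <;> simp [Tri.edges, Edge.left, vec] <;> omega

theorem right_edges (v : Vertex) (i : Fin 3) : (⟨v, i⟩ : Edge).right.edges =
    {⟨v, i⟩, ⟨v + vec i, i + 2⟩, ⟨v - vec (i + 1), i + 1⟩} := by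
  obtain ⟨a, b⟩ := v
  ext ⟨⟨p, q⟩, d⟩
  fin_cases i <;> fin_cases d <;> simp [Tri.edges, Edge.right, vec] <;> omega

theorem mem_lozenge {e : Edge} {t : Tri} : t ∈ e.lozenge ↔ e ∈ t.edges := by
  simp [Edge.lozenge, Tri.mem_edges]

/-- Every triangle is bounded by a directed cycle of three edges. -/
theorem exists_cycle (t : Tri) : ∃ (v : Vertex) (i j k : Fin 3),
    i ≠ j ∧ j ≠ k ∧ i ≠ k ∧ vec i + vec j + vec k = 0 ∧
      t.edges = {⟨v, i⟩, ⟨v + vec i, j⟩, ⟨v - vec k, k⟩} := by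
  obtain ⟨v, d⟩ := t
  fin_cases d
  · exact ⟨v, 0, 1, 2, by decide, by decide, by decide, by decide, left_edges v 0⟩
  · exact ⟨v, 1, 0, 2, by decide, by decide, by decide, by decide, right_edges v 1⟩

theorem mem_edges_of_mem {t : Tri} (ht : t ∈ R) {e : Edge} (he : e ∈ t.edges) : e ∈ edges R :=
  Finset.mem_biUnion.2 ⟨t, ht, he⟩

theorem sub_vec_mem_verts {v : Vertex} {i j : Fin 3} (hij : i ≠ j)
    (h : (⟨v, i⟩ : Edge).lozenge ⊆ R) : v - vec j ∈ verts R := by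
  rw [lozenge_subset] at h
  have hj := dir_cases hij
  refine base_mem_verts (e := ⟨v - vec j, j⟩) ?_
  rcases hj with rfl | rfl
  · exact mem_edges_of_mem h.2 (by simp [right_edges])
  · exact mem_edges_of_mem h.1 (by simp [left_edges])

theorem VArc.left_mem {v w : Vertex} {δ : ℤ} (h : VArc R X₁ X₂ v w δ) : v ∈ verts R := by
  cases h with
  | up _ i h => exact base_mem_verts h
  | down _ i h hX => exact tip_mem_verts h
  | lateral u i j k hij hjk hik h hX => exact sub_vec_mem_verts hij h

theorem VArc.right_mem {v w : Vertex} {δ : ℤ} (h : VArc R X₁ X₂ v w δ) : w ∈ verts R := by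
  cases h with
  | up _ i h => exact tip_mem_verts h
  | down _ i h hX => exact base_mem_verts h
  | lateral u i j k hij hjk hik h hX => exact sub_vec_mem_verts hik h

theorem VArc.mono {v w : Vertex} {δ : ℤ} (h : VArc R ∅ ∅ v w δ) : VArc R X₁ X₂ v w δ := by
  cases h with
  | up _ i h => exact .up _ _ h
  | down _ i h hX =>
    simp only [Finset.union_empty] at hX
    exact .down _ _ h (by simp [hX])
  | lateral u i j k hij hjk hik h hX => simp at hX

/-! ### Paths over a single vertex -/

/-- The directed boundary of a triangle of `R` at the vertex lifts to three ascending arcs, one for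
each unit vector. -/
theorem reaches_add_ones {c : Cube} (hc : c ∈ cubes R) : Reaches R X₁ X₂ c (c + (1, 1, 1)) := by
  obtain ⟨i, hi⟩ := mem_verts.1 hc
  obtain ⟨j, k, hj, hk, hsum⟩ : ∃ j k, (⟨proj c + vec i, j⟩ : Edge) ∈ edges R ∧
      (⟨proj c - vec k, k⟩ : Edge) ∈ edges R ∧
      ((k = i + 2 ∧ j = i + 1) ∨ (k = i + 1 ∧ j = i + 2)) := by
    rcases mem_edges.1 hi with h | h
    · exact ⟨i + 1, i + 2, mem_edges_of_mem h (by simp [left_edges]),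
        mem_edges_of_mem h (by simp [left_edges]), by simp⟩
    · exact ⟨i + 2, i + 1, mem_edges_of_mem h (by simp [right_edges]),
        mem_edges_of_mem h (by simp [right_edges]), by simp⟩
  have h3 : unit i + unit j + unit k = (1, 1, 1) := by
    rcases hsum with ⟨rfl, rfl⟩ | ⟨rfl, rfl⟩
    exacts [unit_sum i, by rw [← unit_sum i]; abel]
  have h4 : vec i + vec j + vec k = 0 := by
    rcases hsum with ⟨rfl, rfl⟩ | ⟨rfl, rfl⟩
    exacts [vec_sum i, by rw [← vec_sum i]; abel]
  have a1 := Arc.up (R := R) (X₁ := X₁) (X₂ := X₂) c i hi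
  have a2 := Arc.up (R := R) (X₁ := X₁) (X₂ := X₂) (c + unit i) j (by rwa [proj_add_unit])
  have a3 := Arc.up (R := R) (X₁ := X₁) (X₂ := X₂) (c + unit i + unit j) k (by
    rw [proj_add_unit, proj_add_unit]
    convert hk using 2
    rw [eq_sub_iff_add_eq, add_assoc, add_assoc, ← add_assoc (vec i), h4, add_zero])
  rw [show c + (1, 1, 1) = c + unit i + unit j + unit k by rw [← h3]; abel]
  exact ((Relation.ReflTransGen.single a1).tail a2).tail a3

/-- Consequently membership in a backward closed set of cubes is determined, over each vertex, by a
height. -/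
theorem reaches_of_height_le {c c' : Cube} (hc : c ∈ cubes R) (hp : proj c = proj c')
    (hh : height c ≤ height c') : Reaches R X₁ X₂ c c' := by
  obtain ⟨n, hn⟩ : ∃ n : ℕ, height c' = height c + 3 * n := by
    obtain ⟨a, ha⟩ := isCubeHeight c
    obtain ⟨b, hb⟩ := isCubeHeight c'
    rw [← hp] at hb
    exact ⟨(b - a).toNat, by omega⟩
  induction n generalizing c' with
  | zero => rw [cube_ext hp (by simpa using hn.symm)]; exact .refl
  | succ n ih =>
    have h1 : proj (c' - (1, 1, 1)) = proj c' := by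
      obtain ⟨x, y, z⟩ := c'
      simp [proj]
    have h2 : height (c' - (1, 1, 1)) = height c' - 3 := by
      obtain ⟨x, y, z⟩ := c'
      simp [height]; ring
    have h3 : c' - (1, 1, 1) ∈ cubes R := by
      change proj _ ∈ verts R
      rw [h1, ← hp]
      exact hc
    have := (ih (c' := c' - (1, 1, 1)) (hp.trans h1.symm) (by push_cast at hn; omega)
      (by push_cast at hn; omega)).trans (reaches_add_ones h3)
    rwa [sub_add_cancel] at this

end

/-! ## Height functions -/

/-- The cubes over `R` that are not higher than the value of `H`. -/
def belowFn (R : Finset Tri) (H : Vertex → ℤ) : Set Cube :=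
  {c | c ∈ cubes R ∧ height c ≤ H (proj c)}

/-- The values of `H` are heights of cubes. -/
def Lattice (R : Finset Tri) (H : Vertex → ℤ) : Prop := ∀ v ∈ verts R, IsCubeHeight v (H v)

/-- No arc of the graph leaves the cubes above `H` for the cubes below `H`. -/
def Closed (R : Finset Tri) (X₁ X₂ : Finset Edge) (H : Vertex → ℤ) : Prop :=
  ∀ v w δ, VArc R X₁ X₂ v w δ → H w - δ ≤ H v

/-- The edges of the region along which `H` does not increase by one. -/
def tilingOf (R : Finset Tri) (H : Vertex → ℤ) : Set Edge :=
  {e | e ∈ edges R ∧ H e.tip ≠ H e.base + 1}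

section
variable {R : Finset Tri} {X₁ X₂ : Finset Edge} {H : Vertex → ℤ}

theorem Closed.mem_of_reaches (hH : Closed R X₁ X₂ H) {c c' : Cube} (h : Reaches R X₁ X₂ c c')
    (hc : c ∈ cubes R) (hc' : height c' ≤ H (proj c')) : height c ≤ H (proj c) := by
  induction h using Relation.ReflTransGen.head_induction_on with
  | refl => exact hc'
  | head h _ ih =>
    have h1 := ih h.vArc.right_mem
    have h2 := hH _ _ _ h.vArc
    omega

/-- Minimality of the grown set, used in both directions: to compare it with a hypothetical
solution, and to identify the result of the traversal. -/
theorem Closed.grown_subset (hH : Closed R X₁ X₂ H) {B : Set Cube} (hB : B ⊆ belowFn R H) :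
    grown R X₁ X₂ B ⊆ belowFn R H := by
  rintro c ⟨hc, c', hc', h⟩
  exact ⟨hc, hH.mem_of_reaches h hc (hB hc').2⟩

theorem exists_cube_between (v : Vertex) (m : ℤ) :
    (∃ c, proj c = v ∧ height c ≤ m) ∧ ∃ c, proj c = v ∧ m < height c := by
  constructor
  -- A height of the right residue class, crudely pushed below `m`; the second half pushes it above
  -- `m`.
  · obtain ⟨c, h1, h2⟩ := exists_cube (v := v) (h := (v.1 + v.2) + 3 * (-|m| - |v.1 + v.2|))
      ⟨_, add_sub_cancel_left _ _⟩
    refine ⟨c, h1, ?_⟩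
    have := neg_abs_le m
    have := le_abs_self (v.1 + v.2)
    have := abs_nonneg m
    have := abs_nonneg (v.1 + v.2)
    linarith
  · obtain ⟨c, h1, h2⟩ := exists_cube (v := v) (h := (v.1 + v.2) + 3 * (1 + |m| + |v.1 + v.2|))
      ⟨_, add_sub_cancel_left _ _⟩
    refine ⟨c, h1, ?_⟩
    have := le_abs_self m
    have := neg_abs_le (v.1 + v.2)
    have := abs_nonneg m
    have := abs_nonneg (v.1 + v.2)
    linarith

theorem Closed.isDicut (hH : Closed R X₁ X₂ H) (hne : (verts R).Nonempty) :
    IsDicut R X₁ X₂ (belowFn R H) := by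
  obtain ⟨v, hv⟩ := hne
  obtain ⟨⟨c, h1, h2⟩, c', h1', h2'⟩ := exists_cube_between v (H v)
  refine ⟨fun c hc => hc.1, ⟨c, ?_, ?_⟩, ⟨c', ?_, ?_⟩, fun c c' h hc' =>
    ⟨h.vArc.left_mem, hH.mem_of_reaches (.single h) h.vArc.left_mem hc'.2⟩⟩
  · change proj c ∈ verts R
    rwa [h1]
  · rwa [h1]
  · change proj c' ∈ verts R
    rwa [h1']
  · rintro ⟨-, h⟩
    rw [h1'] at h
    omega

theorem Closed.mono (hH : Closed R X₁ X₂ H) : Closed R ∅ ∅ H :=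
  fun _ _ _ h => hH _ _ _ h.mono

theorem Closed.edge_le (hH : Closed R X₁ X₂ H) {e : Edge} (he : e ∈ edges R) :
    H e.tip ≤ H e.base + 1 := by
  have := hH _ _ _ (.up e.base e.dir he)
  simp only [Edge.tip]
  omega

theorem Closed.edge_eq (hH : Closed R X₁ X₂ H) {e : Edge} (he : e ∈ edges R)
    (hX : e ∈ boundary R ∪ X₁ ∪ X₂) : H e.tip = H e.base + 1 := by
  have h1 := hH _ _ _ (.down e.base e.dir he hX)
  have h2 := hH.edge_le he
  simp only [Edge.tip] at *
  omega

/-- The increment is at most 1 and congruent to 1 modulo 3, so if it is not 1 it is at most -2. -/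
theorem Lattice.edge_lt (hL : Lattice R H) (hH : Closed R ∅ ∅ H) {e : Edge} (he : e ∈ tilingOf R H) :
    H e.tip + 2 ≤ H e.base := by
  have h1 := hH.edge_le he.1
  have h2 := (hL _ (base_mem_verts he.1)).add_vec e.dir
  have := (hL _ (tip_mem_verts he.1)).le_of_lt h2 (lt_of_le_of_ne h1 he.2)
  omega

theorem projection_belowFn (hL : Lattice R H) (hH : Closed R ∅ ∅ H) :
    projection R (belowFn R H) = tilingOf R H := by
  ext e
  constructor
  · rintro ⟨he, c, hc, hce, hn⟩
    refine ⟨he, fun h => hn ⟨?_, ?_⟩⟩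
    · change proj _ ∈ verts R
      rw [proj_add_unit, hce]
      exact tip_mem_verts he
    · rw [proj_add_unit, hce, height_add_unit]
      have := hc.2
      simp only [Edge.tip] at h
      rw [hce] at this
      omega
  · intro he
    have h1 := base_mem_verts he.1
    obtain ⟨c, hc, hh⟩ := exists_cube (hL _ h1)
    refine ⟨he.1, c, ⟨?_, ?_⟩, hc, fun h => ?_⟩
    · change proj c ∈ verts R
      rwa [hc]
    · rw [hc, hh]
    · have h2 := h.2
      rw [proj_add_unit, hc, height_add_unit, hh] at h2
      have := hL.edge_lt hH he
      simp only [Edge.tip] at this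
      omega

/-- Along the directed cycle of a triangle the three increments are 1 or at most -2 and add up to 0,
so exactly one of them differs from 1. An edge of `∂R` rises by 1, so every lozenge stays inside
`R`. -/
theorem isTiling_tilingOf (hL : Lattice R H) (hH : Closed R ∅ ∅ H) :
    IsTiling R (tilingOf R H) := by
  refine ⟨fun e he => ?_, fun t ht => ?_⟩
  · by_contra h
    exact he.2 (hH.edge_eq he.1 (by
      rw [Finset.union_empty, Finset.union_empty]
      exact Finset.mem_filter.2 ⟨he.1, h⟩))
  · obtain ⟨v, i, j, k, hij, hjk, hik, hs, hE⟩ := exists_cycle t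
    have m1 : (⟨v, i⟩ : Edge) ∈ t.edges := by simp [hE]
    have m2 : (⟨v + vec i, j⟩ : Edge) ∈ t.edges := by simp [hE]
    have m3 : (⟨v - vec k, k⟩ : Edge) ∈ t.edges := by simp [hE]
    have h1 := hH.edge_le (mem_edges_of_mem ht m1)
    have h2 := hH.edge_le (mem_edges_of_mem ht m2)
    have h3 := hH.edge_le (mem_edges_of_mem ht m3)
    have c1 := hL.edge_lt hH (e := ⟨v, i⟩)
    have c2 := hL.edge_lt hH (e := ⟨v + vec i, j⟩)
    have c3 := hL.edge_lt hH (e := ⟨v - vec k, k⟩)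
    have hw : v + vec i + vec j = v - vec k := by
      rw [eq_sub_iff_add_eq, add_assoc, add_assoc, ← add_assoc (vec i), hs, add_zero]
    simp only [tilingOf, Set.mem_ofPred_eq, mem_edges_of_mem ht m1, mem_edges_of_mem ht m2,
      mem_edges_of_mem ht m3, true_and, Edge.tip, hw, sub_add_cancel] at h1 h2 h3 c1 c2 c3
    simp only [mem_lozenge, ExistsUnique, tilingOf, Set.mem_ofPred_eq]
    have fin : ∀ e ∈ t.edges, H e.tip ≠ H e.base + 1 →
        (∀ e' ∈ t.edges, H e'.tip ≠ H e'.base + 1 → e' = e) →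
        ∃ x, ((x ∈ edges R ∧ H x.tip ≠ H x.base + 1) ∧ x ∈ t.edges) ∧
          ∀ y, ((y ∈ edges R ∧ H y.tip ≠ H y.base + 1) ∧ y ∈ t.edges) → y = x :=
      fun e he hne hu => ⟨e, ⟨⟨mem_edges_of_mem ht he, hne⟩, he⟩, fun y hy => hu y hy.2 hy.1.2⟩
    -- Three rises add up to 3, and two falls to at most -3; both are impossible on a cycle.
    by_cases d1 : H (v + vec i) = H v + 1
    · by_cases d2 : H (v - vec k) = H (v + vec i) + 1
      · refine fin _ m3 (by simp only [Edge.tip, sub_add_cancel]; omega) ?_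
        rw [hE]
        simp [Edge.tip, d1, d2, hw]
      · have := c2 d2
        refine fin _ m2 (by simp only [Edge.tip, hw]; omega) ?_
        rw [hE]
        have d3 : H v = H (v - vec k) + 1 := by by_contra h; have := c3 h; omega
        simp only [Finset.mem_insert, Finset.mem_singleton, forall_eq_or_imp, forall_eq, Edge.tip,
          d1, sub_add_cancel, ne_eq, not_true_eq_false, false_imp_iff, imp_true_iff, true_and]
        exact fun h => absurd d3 h
    · have := c1 d1
      have d2 : H (v - vec k) = H (v + vec i) + 1 := by by_contra h; have := c2 h; omega
      have d3 : H v = H (v - vec k) + 1 := by by_contra h; have := c3 h; omega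
      refine fin _ m1 (by simp only [Edge.tip]; omega) ?_
      rw [hE]
      simp only [Finset.mem_insert, Finset.mem_singleton, forall_eq_or_imp, forall_eq, Edge.tip,
        sub_add_cancel, hw]
      exact ⟨fun _ => trivial, fun h => absurd d2 h, fun h => absurd d3 h⟩

/-- The edges of `X₁` and `X₂` do not fall, so they are not overlapped. For saliency, the two
opposite lateral arcs force equal heights at the vertices opposite to the edge, whereas equal
orientations would put one of them strictly above the other. -/
theorem solves_tilingOf (hL : Lattice R H) (hH : Closed R X₁ X₂ H) :
    Solves R X₁ X₂ (tilingOf R H) := by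
  have hT := isTiling_tilingOf hL hH.mono
  have hno : ∀ e ∈ X₁ ∪ X₂, e ∉ tilingOf R H := by
    intro e he heT
    refine heT.2 (hH.edge_eq heT.1 ?_)
    rw [Finset.union_assoc]
    exact Finset.mem_union_right _ he
  refine ⟨hT, hno, ?_⟩
  rintro ⟨v, i⟩ heX f hf g hg hlf hrg hd
  have hl := hT.inside f hf hlf
  have hr := hT.inside g hg hrg
  have heT := hno _ (Finset.mem_union_right _ heX)
  have hloz : (⟨v, i⟩ : Edge).lozenge ⊆ R := lozenge_subset.2 ⟨hl, hr⟩
  obtain ⟨n1, n2, n12⟩ := dir_ne i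
  have heq : H (v - vec (i + 1)) = H (v - vec (i + 2)) := by
    have h1 := hH _ _ _ (.lateral v i (i + 1) (i + 2) n1 n12 n2 hloz heX)
    have h2 := hH _ _ _ (.lateral v i (i + 2) (i + 1) n2 n12.symm n1 hloz heX)
    omega
  have he1 : H (v + vec i) = H v + 1 := by
    by_contra h
    exact heT ⟨mem_edges_of_mem hl (by simp [left_edges]), h⟩
  rw [mem_lozenge, left_edges] at hlf
  rw [mem_lozenge, right_edges] at hrg
  simp only [Finset.mem_insert, Finset.mem_singleton] at hlf hrg
  obtain ⟨w1, w2⟩ := add_vec_add_vec v i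
  have lf := hL.edge_lt hH.mono hf
  have lg := hL.edge_lt hH.mono hg
  -- With equal orientations, one lozenge edge falls from the tip of the edge to one opposite
  -- vertex, and the other falls from the other opposite vertex to the base. This contradicts `heq`.
  rcases hlf with rfl | rfl | rfl
  · exact heT hf
  · rcases hrg with rfl | rfl | rfl
    · exact heT hg
    · exact n12 hd
    · simp only [Edge.tip, w1, sub_add_cancel] at lf lg
      omega
  · rcases hrg with rfl | rfl | rfl
    · exact heT hg
    · simp only [Edge.tip, w2, sub_add_cancel] at lf lg
      omega
    · exact n12 hd.symm

theorem IsTiling.mem_edges {T : Set Edge} (hT : IsTiling R T) {e : Edge} (he : e ∈ T) :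
    e ∈ edges R :=
  Calisson.mem_edges.2 (.inl (lozenge_subset.1 (hT.inside e he)).1)

/-- The height function of a tiling. -/
theorem exists_height_of_isTiling (hR : IsSimplyConnectedRegion R) {T : Set Edge}
    (hT : IsTiling R T) (u : Vertex) :
    ∃ H : Vertex → ℤ, H u = u.1 + u.2 ∧ Lattice R H ∧
      (∀ e ∈ edges R, e ∈ T → H e.tip = H e.base - 2) ∧
      ∀ e ∈ edges R, e ∉ T → H e.tip = H e.base + 1 := by
  classical
  -- The form is one third of the difference between the wanted increments and those of `v.1 + v.2`.
  -- It has curl 0: each triangle has one edge of direction `2` and one edge overlapped by its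
  -- lozenge. Working with one third makes `Lattice` automatic.
  obtain ⟨g, hg⟩ := exists_region_potential hR
    (fun e => (if e.dir = 2 then 1 else 0) - if e ∈ T then 1 else 0) (by
    intro t ht
    have hadd : curl (fun e => (if e.dir = 2 then 1 else 0) - if e ∈ T then 1 else 0) t =
        1 - curl (fun e => if e ∈ T then 1 else 0) t := by
      obtain ⟨v, d⟩ := t
      fin_cases d <;> simp [curl] <;> ring
    rw [hadd, sub_eq_zero]
    obtain ⟨e, ⟨he, het⟩, hu⟩ := hT.cover t ht
    rw [mem_lozenge] at het
    have h1 : curl (fun e => if e ∈ T then 1 else 0) t = curl (Pi.single e 1) t := by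
      refine curl_congr fun e' he' => ?_
      rw [Pi.single_apply]
      by_cases h : e' ∈ T
      · rw [if_pos h, if_pos (hu e' ⟨h, mem_lozenge.2 he'⟩)]
      · rw [if_neg h, if_neg]
        rintro rfl
        exact h he
    rw [h1, curl_single]
    rcases Tri.mem_edges.1 het with rfl | rfl
    · simp [e.left_ne_right]
    · simp [e.left_ne_right.symm])
  have hdir : ∀ e : Edge, e.tip.1 + e.tip.2 = e.base.1 + e.base.2 + 1 - 3 * if e.dir = 2 then 1 else 0 := by
    rintro ⟨v, d⟩
    fin_cases d <;> simp [Edge.tip, vec] <;> ring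
  refine ⟨fun v => v.1 + v.2 + 3 * (g v - g u), by simp, fun v _ => ⟨_, add_sub_cancel_left _ _⟩,
    fun e he heT => ?_, fun e he heT => ?_⟩
  · have h1 := hg e he
    have h2 := hdir e
    simp only [heT, if_true] at h1
    simp only [h1, h2]
    ring
  · have h1 := hg e he
    have h2 := hdir e
    simp only [heT, if_false] at h1
    simp only [h1, h2]
    ring

/-- Up and down arcs only restate the increments 1 and -2. For a lateral arc, different orientations
leave two configurations, and in each the two opposite vertices get the same height. -/
theorem closed_of_solves {T : Set Edge} (hT : Solves R X₁ X₂ T)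
    (h2 : ∀ e ∈ edges R, e ∈ T → H e.tip = H e.base - 2)
    (h1 : ∀ e ∈ edges R, e ∉ T → H e.tip = H e.base + 1) : Closed R X₁ X₂ H := by
  have hle : ∀ e ∈ edges R, H e.tip ≤ H e.base + 1 := by
    intro e he
    by_cases heT : e ∈ T
    · have := h2 e he heT; omega
    · exact (h1 e he heT).le
  intro v w δ h
  cases h with
  | up _ i h =>
    have := hle _ h
    simp only [Edge.tip] at this
    omega
  | down _ i h hX =>
    have := h1 _ h (by
      intro hmem
      rw [Finset.union_assoc, Finset.mem_union] at hX
      rcases hX with hX | hX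
      · exact (Finset.mem_filter.1 hX).2 (hT.tiling.inside _ hmem)
      · exact hT.non_overlapping _ hX hmem)
    simp only [Edge.tip] at this
    omega
  | lateral v i j k hij hjk hik h hX =>
    have hX' := hT.non_overlapping _ (Finset.mem_union_right _ hX)
    have hlr := lozenge_subset.1 h
    suffices heq : H (v - vec (i + 1)) = H (v - vec (i + 2)) by
      have : (j = i + 1 ∧ k = i + 2) ∨ (j = i + 2 ∧ k = i + 1) := by
        rcases dir_cases hij with rfl | rfl <;> rcases dir_cases hik with rfl | rfl <;>
          simp at hjk ⊢
      rcases this with ⟨rfl, rfl⟩ | ⟨rfl, rfl⟩ <;> omega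
    obtain ⟨w1, w2⟩ := add_vec_add_vec v i
    obtain ⟨-, -, n12⟩ := dir_ne i
    obtain ⟨f, ⟨hf, hft⟩, -⟩ := hT.tiling.cover _ hlr.1
    obtain ⟨g, ⟨hg, hgt⟩, -⟩ := hT.tiling.cover _ hlr.2
    have hsal := hT.saliency _ hX f hf g hg hft hgt
    have d0 := h1 _ (mem_edges_of_mem hlr.1 (by simp [left_edges])) hX'
    have d1 := h2 _ (hT.tiling.mem_edges hf) hf
    have d2 := h2 _ (hT.tiling.mem_edges hg) hg
    have uf : ∀ f' ∈ (⟨v, i⟩ : Edge).left.edges, f' ∈ T → f' = f := fun f' h h' =>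
      (hT.tiling.cover _ hlr.1).unique ⟨h', mem_lozenge.2 h⟩ ⟨hf, hft⟩
    have ug : ∀ f' ∈ (⟨v, i⟩ : Edge).right.edges, f' ∈ T → f' = g := fun f' h h' =>
      (hT.tiling.cover _ hlr.2).unique ⟨h', mem_lozenge.2 h⟩ ⟨hg, hgt⟩
    have el : (⟨v + vec i, i + 1⟩ : Edge) ∈ (⟨v, i⟩ : Edge).left.edges := by simp [left_edges]
    have er : (⟨v + vec i, i + 2⟩ : Edge) ∈ (⟨v, i⟩ : Edge).right.edges := by simp [right_edges]
    have tl := h1 _ (mem_edges_of_mem hlr.1 el)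
    have tr := h1 _ (mem_edges_of_mem hlr.2 er)
    rw [mem_lozenge, left_edges] at hft
    rw [mem_lozenge, right_edges] at hgt
    simp only [Finset.mem_insert, Finset.mem_singleton] at hft hgt
    -- Either both lozenge edges start at the tip of the given edge and fall to the opposite
    -- vertices, or both end at its base and the opposite vertices are reached from the tip by
    -- rises.
    rcases hft with rfl | rfl | rfl
    · exact absurd hf hX'
    · rcases hgt with rfl | rfl | rfl
      · exact absurd hg hX'
      · simp only [Edge.tip, w1, w2] at d1 d2
        omega
      · exact absurd rfl hsal
    · rcases hgt with rfl | rfl | rfl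
      · exact absurd hg hX'
      · exact absurd rfl hsal
      · have tl := tl fun h => n12 (congrArg Edge.dir (uf _ el h))
        have tr := tr fun h => n12 (congrArg Edge.dir (ug _ er h)).symm
        simp only [Edge.tip, w1, w2] at tl tr
        omega

theorem IsTiling.solves {T : Set Edge} (hT : IsTiling R T) : Solves R ∅ ∅ T :=
  ⟨hT, by simp, by simp⟩

end

/-! ## The data of the region in the memory -/

/-- The number of triangles of `R` adjacent to an edge. -/
def count (R : Finset Tri) (e : Edge) : ℤ :=
  (if e.left ∈ R then 1 else 0) + (if e.right ∈ R then 1 else 0)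

theorem count_pos {R : Finset Tri} {e : Edge} : 0 < count R e ↔ e ∈ edges R := by
  rw [mem_edges, count]
  split_ifs <;> simp [*]

theorem count_eq_one {R : Finset Tri} {e : Edge} : count R e = 1 ↔ e ∈ boundary R := by
  rw [mem_boundary, count]
  split_ifs <;> simp [*]

theorem count_eq_two {R : Finset Tri} {e : Edge} : count R e = 2 ↔ e.lozenge ⊆ R := by
  rw [lozenge_subset, count]
  split_ifs <;> simp [*]

theorem count_eq_zero {R : Finset Tri} {e : Edge} (h : e ∉ edges R) : count R e = 0 := by
  rw [mem_edges, not_or] at h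
  simp [count, h]

/-- The memory contains the list `vs` of vertices. -/
structure Listed (vs : List Vertex) (s : State) : Prop where
  len : s.reg .nV = vs.length
  fst : ∀ (i : ℕ) (h : i < vs.length), s.tab .vtx i 0 0 = vs[i].1
  snd : ∀ (i : ℕ) (h : i < vs.length), s.tab .vtx i 1 0 = vs[i].2

theorem Listed.congr {vs : List Vertex} {s s' : State} (h : Listed vs s)
    (hr : s'.reg .nV = s.reg .nV) (ht : s'.tab .vtx = s.tab .vtx) : Listed vs s' :=
  ⟨by rw [hr, h.len], fun i hi => by rw [ht, h.fst i hi], fun i hi => by rw [ht, h.snd i hi]⟩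

theorem mem_take_succ {α : Type*} {l : List α} {i : ℕ} (hi : i < l.length) {a : α} :
    a ∈ l.take (i + 1) ↔ a ∈ l.take i ∨ a = l[i] := by
  rw [List.take_succ_eq_append_getElem hi, List.mem_append, List.mem_singleton]

/-- A loop over all the vertices: `I P` holds when the vertices in `P` have been treated. -/
theorem exec_forVerts {cs : List Cmd} (hflat : (block cs).flat = true)
    (hj : (block cs).modReg .j = false) (hn : (block cs).modReg .nV = false)
    (hv : (block cs).modTab .vtx = false) {vs : List Vertex} (hnd : vs.Nodup)
    {s : State} (hs : Listed vs s) (I : Finset Vertex → State → Prop)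
    (hI : ∀ P s r n, r = .j ∨ r = .x ∨ r = .y → I P s → I P (s.setReg r n)) (h0 : I ∅ s)
    (hstep : ∀ P v s, v ∈ vs → v ∉ P → s.reg .x = v.1 → s.reg .y = v.2 → I P s →
      I (insert v P) ((block cs).eval s)) :
    ∃ n s', n ≤ (vs.length + 1) * ((block cs).bound + 40) ∧ Exec (forEach .nV (fetch :: cs)) s n s' ∧
      I vs.toFinset s' := by
  have hb : (block (fetch :: cs)).bound ≤ (block cs).bound + 20 := by
    have : (block (fetch :: cs)).bound = fetch.bound + (block cs).bound := rfl
    have h2 : fetch.bound = 11 := rfl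
    omega
  obtain ⟨n, s', hn', he, hI', -⟩ := exec_forEach (r := .nV) (cs := fetch :: cs)
    (by simpa [block, Cmd.flat, fetch] using hflat) (by simpa [block, Cmd.modReg, fetch] using hj)
    (by simpa [block, Cmd.modReg, fetch] using hn) (by simp) hs.len
    (fun i s => I (vs.take i).toFinset s ∧ Listed vs s)
    ⟨by simpa using hI _ _ _ _ (.inl rfl) h0, hs.congr (by simp) (by simp)⟩ (by
    rintro i hi s hji ⟨hIi, hl⟩
    have h1 := hI _ _ .x vs[i].1 (.inr (.inl rfl)) hIi
    have h2 := hI _ _ .y vs[i].2 (.inr (.inr rfl)) h1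
    have h3 : fetch.eval s = (s.setReg .x vs[i].1).setReg .y vs[i].2 := by
      simp [fetch, hji, hl.fst i hi, hl.snd i hi]
    -- The list has no repetition, so the current vertex is not among those already treated.
    have h4 := hstep (vs.take i).toFinset vs[i] _ (List.getElem_mem hi) (by
      rw [List.mem_toFinset, List.mem_take_iff_getElem]
      rintro ⟨k, hk, hk'⟩
      have := (List.Nodup.getElem_inj_iff hnd).1 hk'
      omega) (by simp) (by simp) h2
    refine ⟨?_, hl.congr ?_ ?_⟩
    · have h5 : (vs.take (i + 1)).toFinset = insert vs[i] (vs.take i).toFinset := by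
        ext v
        simp [mem_take_succ hi, or_comm]
      rw [h5, eval_block_cons, h3]
      exact hI _ _ _ _ (.inl rfl) h4
    · simp only [State.setReg_reg, eval_block_cons, h3, Cmd.eval_reg _ _ hn]
      simp
    · simp only [State.setReg_tab, eval_block_cons, h3, Cmd.eval_tab _ _ hv])
  refine ⟨n, s', hn'.trans (Nat.mul_le_mul_left _ (by omega)), he, by simpa using hI'⟩

/-- The description of the region and of the constraints that the algorithm uses. -/
structure Env (R : Finset Tri) (X₁ X₂ : Finset Edge) (vs : List Vertex) (s : State) : Prop where
  nodup : vs.Nodup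
  mem : ∀ v, v ∈ vs ↔ v ∈ verts R
  listed : Listed vs s
  cnt : ∀ (v : Vertex) (i : Fin 3), s.tab .cnt v.1 v.2 (i : ℕ) = count R ⟨v, i⟩
  con1 : ∀ (v : Vertex) (i : Fin 3), s.tab .con1 v.1 v.2 (i : ℕ) = 1 ↔ (⟨v, i⟩ : Edge) ∈ X₁
  con2 : ∀ (v : Vertex) (i : Fin 3), s.tab .con2 v.1 v.2 (i : ℕ) = 1 ↔ (⟨v, i⟩ : Edge) ∈ X₂

section
variable {R : Finset Tri} {X₁ X₂ : Finset Edge} {vs : List Vertex} {s s' : State}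

theorem Env.congr (h : Env R X₁ X₂ vs s) (h0 : s'.reg .nV = s.reg .nV)
    (h1 : s'.tab .vtx = s.tab .vtx) (h2 : s'.tab .cnt = s.tab .cnt)
    (h3 : s'.tab .con1 = s.tab .con1) (h4 : s'.tab .con2 = s.tab .con2) : Env R X₁ X₂ vs s' :=
  ⟨h.nodup, h.mem, h.listed.congr h0 h1, by rw [h2]; exact h.cnt, by rw [h3]; exact h.con1,
    by rw [h4]; exact h.con2⟩

theorem Env.exec (h : Env R X₁ X₂ vs s) {c : Cmd} {n : ℕ} (he : Exec c s n s')
    (hc : c.modReg .nV = false ∧ c.modTab .vtx = false ∧ c.modTab .cnt = false ∧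
      c.modTab .con1 = false ∧ c.modTab .con2 = false) : Env R X₁ X₂ vs s' :=
  h.congr (he.reg_eq hc.1) (he.tab_eq hc.2.1) (he.tab_eq hc.2.2.1) (he.tab_eq hc.2.2.2.1)
    (he.tab_eq hc.2.2.2.2)

theorem Env.toFinset (h : Env R X₁ X₂ vs s) : vs.toFinset = verts R := by
  ext v
  rw [List.mem_toFinset, h.mem]

theorem Env.length (h : Env R X₁ X₂ vs s) : vs.length = (verts R).card := by
  rw [← h.toFinset, List.toFinset_card_of_nodup h.nodup]

end

/-! ### Reading the input -/

theorem rows_eq {α : Type} (f : α → ℤ × ℤ × ℤ) (l : List α) {i : ℕ} (hi : i < l.length) :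
    rows (l.map f) i 0 0 = (f l[i]).1 ∧ rows (l.map f) i 1 0 = (f l[i]).2.1 ∧
      rows (l.map f) i 2 0 = (f l[i]).2.2 := by
  simp [rows, hi]

/-- The vertices found so far, in order, and the table of their indicator function. -/
structure Seen (vs : List Vertex) (s : State) : Prop where
  nodup : vs.Nodup
  listed : Listed vs s
  seen : ∀ v : Vertex, s.tab .seen v.1 v.2 0 = if v ∈ vs then 1 else 0

/-- The coordinates are evaluated again after each store; they are assumed to depend on the
registers `x` and `y` only, which the stores do not touch. -/
theorem Seen.addVertex {vs : List Vertex} {s : State} (h : Seen vs s) {p q : Expr} {v : Vertex}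
    (hp : ∀ s' : State, s'.reg .x = s.reg .x → s'.reg .y = s.reg .y → p.val s' = v.1)
    (hq : ∀ s' : State, s'.reg .x = s.reg .x → s'.reg .y = s.reg .y → q.val s' = v.2) :
    ∃ vs', Seen vs' ((addVertex p q).eval s) ∧ ∀ w, w ∈ vs' ↔ w ∈ vs ∨ w = v := by
  have hseen := h.seen v
  by_cases hv : v ∈ vs
  · refine ⟨vs, ?_, by aesop⟩
    rw [Calisson.addVertex, eval_when_neg]
    · exact h
    · simp [hp s rfl rfl, hq s rfl rfl, hseen, hv]
  · refine ⟨vs ++ [v], ?_, by simp⟩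
    rw [Calisson.addVertex, eval_when_pos]
    · have e1 := fun s' h1 h2 => hp s' h1 h2
      simp only [eval_block_cons, eval_store, eval_set, eval_block_nil, val_zero, val_one, val_reg,
        val_add, hp s rfl rfl, hq s rfl rfl]
      rw [hp _ (by simp) (by simp), hq _ (by simp) (by simp)]
      refine ⟨?_, ⟨?_, ?_, ?_⟩, ?_⟩
      · exact List.Nodup.append h.nodup (by simp) (by simpa using hv)
      · simp [h.listed.len]
      · intro i hi
        simp only [List.length_append, List.length_singleton] at hi
        by_cases hi' : i = vs.length
        · subst hi'
          simp [h.listed.len]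
        · have hi2 : i < vs.length := by omega
          simp [h.listed.len, hi', List.getElem_append_left hi2, h.listed.fst i hi2]
      · intro i hi
        simp only [List.length_append, List.length_singleton] at hi
        by_cases hi' : i = vs.length
        · subst hi'
          simp [h.listed.len]
        · have hi2 : i < vs.length := by omega
          simp [h.listed.len, hi', List.getElem_append_left hi2, h.listed.snd i hi2]
      · intro w
        by_cases hw : w = v
        · subst hw; simp
        · have : ¬ (w.1 = v.1 ∧ w.2 = v.2) := fun h => hw (Prod.ext h.1 h.2)
          simp [h.seen, hw, this]
    · simp [hp s rfl rfl, hq s rfl rfl, hseen, hv]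

theorem Seen.setReg {vs : List Vertex} {s : State} (h : Seen vs s) {r : Reg} {n : ℤ}
    (hr : r ≠ .nV) : Seen vs (s.setReg r n) :=
  ⟨h.nodup, h.listed.congr (by simp [hr.symm]) rfl, h.seen⟩

/-- The body of the loop that reads the triangles. -/
def readTriangle : List Cmd := [
  .set .x (.get .inT Reg.j 0 0), .set .y (.get .inT Reg.j 1 0), .set .d (.get .inT Reg.j 2 0),
  .store .tri Reg.x Reg.y Reg.d 1,
  addVertex Reg.x Reg.y,
  addVertex (Reg.x + 1) (Reg.y + 1),
  .ite (.eq Reg.d 0) (addVertex (Reg.x + 1) Reg.y) (addVertex Reg.x (Reg.y + 1))]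

/-- The body of the loop that computes the types of the edges. -/
def countTriangles : List Cmd := [
  .store .cnt Reg.x Reg.y 0 (.get .tri Reg.x Reg.y 0 + .get .tri Reg.x (Reg.y - 1) 1),
  .store .cnt Reg.x Reg.y 1 (.get .tri (Reg.x - 1) Reg.y 0 + .get .tri Reg.x Reg.y 1),
  .store .cnt Reg.x Reg.y 2
    (.get .tri (Reg.x - 1) (Reg.y - 1) 0 + .get .tri (Reg.x - 1) (Reg.y - 1) 1)]

theorem exec_readTriangles (lR : List Tri) {s : State} (hn : s.reg .nT = lR.length)
    (hin : s.tab .inT = rows (lR.map fun t => (t.base.1, t.base.2, (t.kind : ℕ))))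
    (htri : ∀ p q r, s.tab .tri p q r = 0) (hs : Seen [] s) :
    ∃ n s', n ≤ (lR.length + 1) * ((block readTriangle).bound + 20) ∧
      Exec (forEach .nT readTriangle) s n s' ∧
      (∀ t : Tri, s'.tab .tri t.base.1 t.base.2 (t.kind : ℕ) = if t ∈ lR then 1 else 0) ∧
      ∃ vs, Seen vs s' ∧ ∀ v, v ∈ vs ↔ v ∈ verts lR.toFinset := by
  obtain ⟨n, s', hn, he, -, h1, h2⟩ := exec_forEach (r := .nT) (cs := readTriangle) rfl rfl rfl
    (by simp) hn
    (fun i s => s.tab .inT = rows (lR.map fun t => (t.base.1, t.base.2, (t.kind : ℕ))) ∧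
      (∀ t : Tri, s.tab .tri t.base.1 t.base.2 (t.kind : ℕ) = if t ∈ lR.take i then 1 else 0) ∧
      ∃ vs, Seen vs s ∧ ∀ v, v ∈ vs ↔ ∃ t ∈ lR.take i, v ∈ t.verts)
    ⟨hin, by simp [htri], [], hs.setReg (by simp), by simp⟩ (by
    rintro i hi s hj ⟨hin, htri, vs, hvs, hmem⟩
    obtain ⟨r0, r1, r2⟩ := rows_eq (fun t : Tri => (t.base.1, t.base.2, ((t.kind : ℕ) : ℤ))) lR hi
    rw [← hin] at r0 r1 r2
    set t := lR[i] with ht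
    let s₁ := (((s.setReg .x t.base.1).setReg .y t.base.2).setReg .d (t.kind : ℕ)).setTab .tri
      t.base.1 t.base.2 (t.kind : ℕ) 1
    have hs₁ : (block readTriangle).eval s =
        (block [addVertex Reg.x Reg.y, addVertex (Reg.x + 1) (Reg.y + 1),
          .ite (.eq Reg.d 0) (addVertex (Reg.x + 1) Reg.y) (addVertex Reg.x (Reg.y + 1))]).eval
          s₁ := by
      simp [readTriangle, hj, r0, r1, r2, s₁]
    have v1 : Seen vs s₁ := ⟨hvs.nodup, hvs.listed.congr rfl (by simp [s₁]), by
      simp only [s₁, State.setTab_tab_of_ne _ _ _ _ _ (show Tab.seen ≠ Tab.tri by simp),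
        State.setReg_tab]; exact hvs.seen⟩
    obtain ⟨vs₂, v2, m2⟩ := v1.addVertex (p := Reg.x) (q := Reg.y) (v := t.base)
      (by intro s' hx _; simp [hx, s₁]) (by intro s' _ hy; simp [hy, s₁])
    have fr := fun p q (r : Reg) (hr : r ≠ .nV) (s : State) =>
      Cmd.eval_reg (addVertex p q) s (r := r) (by simp [addVertex, when, block, Cmd.modReg, hr])
    obtain ⟨vs₃, v3, m3⟩ := v2.addVertex (p := Reg.x + 1) (q := Reg.y + 1)
      (v := t.base + vec 0 + vec 1)
      (by intro s' hx _; simp [hx, s₁, fr, vec]) (by intro s' _ hy; simp [hy, s₁, fr, vec])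
    set s₃ := (addVertex (Reg.x + 1) (Reg.y + 1)).eval ((addVertex Reg.x Reg.y).eval s₁) with hs₃
    have hd : s₃.reg .d = (t.kind : ℕ) := by simp [hs₃, fr, s₁]
    have hx : s₃.reg .x = t.base.1 := by simp [hs₃, fr, s₁]
    have hy : s₃.reg .y = t.base.2 := by simp [hs₃, fr, s₁]
    obtain ⟨vs₄, v4, m4⟩ : ∃ vs₄, Seen vs₄ ((Cmd.ite (.eq Reg.d 0) (addVertex (Reg.x + 1) Reg.y)
        (addVertex Reg.x (Reg.y + 1))).eval s₃) ∧
        ∀ w, w ∈ vs₄ ↔ w ∈ vs₃ ∨ w = t.base + ![vec 0, vec 1] t.kind := by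
      have hk : t.kind = 0 ∨ t.kind = 1 := by
        generalize t.kind = k
        revert k; decide
      rcases hk with hk | hk
      · rw [eval_ite_pos (by simp [hd, hk]), hk]
        exact v3.addVertex (by intro s' h1 _; simp [h1, hx, vec]) (by intro s' _ h1; simp [h1, hy, vec])
      · rw [eval_ite_neg (by simp [hd, hk]), hk]
        exact v3.addVertex (by intro s' h1 _; simp [h1, hx, vec]) (by intro s' _ h1; simp [h1, hy, vec])
    refine ⟨?_, ?_, vs₄, ?_, ?_⟩
    · rw [State.setReg_tab, Cmd.eval_tab _ _ (by rfl), hin]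
    · intro u
      rw [State.setReg_tab, hs₁, Cmd.eval_tab _ _ (by rfl)]
      simp only [s₁, State.setTab_tab_self, State.setReg_tab, htri, mem_take_succ hi, ← ht]
      by_cases hu : u = t
      · simp [hu]
      · have : ¬ (u.base.1 = t.base.1 ∧ u.base.2 = t.base.2 ∧
            ((u.kind : ℕ) : ℤ) = ((t.kind : ℕ) : ℤ)) := by
          rintro ⟨h1, h2, h3⟩
          apply hu
          obtain ⟨⟨a, b⟩, k⟩ := u
          rcases t with ⟨⟨a', b'⟩, k'⟩
          simp only [Nat.cast_inj, Fin.val_inj] at h1 h2 h3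
          subst h1 h2 h3
          rfl
        rw [if_neg this]
        simp [hu]
    · rw [hs₁]
      exact v4.setReg (by simp)
    · intro w
      rw [m4, m3, m2, hmem]
      have : w ∈ t.verts ↔ w = t.base ∨ w = t.base + ![vec 0, vec 1] t.kind ∨
        w = t.base + vec 0 + vec 1 := by simp [Tri.verts]
      constructor
      · rintro (((⟨u, hu, hw⟩ | hw) | hw) | hw)
        · exact ⟨u, (mem_take_succ hi).2 (.inl hu), hw⟩
        all_goals exact ⟨t, (mem_take_succ hi).2 (.inr rfl), this.2 (by simp [hw])⟩
      · rintro ⟨u, hu, hw⟩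
        rcases (mem_take_succ hi).1 hu with hu | hu
        · exact .inl (.inl (.inl ⟨u, hu, hw⟩))
        · subst hu
          have := this.1 hw
          tauto)
  refine ⟨n, s', hn, he, by simpa using h1, ?_⟩
  obtain ⟨vs, hvs, hm⟩ := h2
  exact ⟨vs, hvs, fun v => by simp [hm, verts]⟩

theorem exec_readConstraints (r : Reg) (tin tout : Tab) (htt : tin ≠ tout) (hr : r ≠ .j)
    (l : List Edge) {s : State} (hn : s.reg r = l.length)
    (hin : s.tab tin = rows (l.map fun e => (e.base.1, e.base.2, (e.dir : ℕ))))
    (h0 : ∀ p q r, s.tab tout p q r = 0) :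
    ∃ n s', n ≤ (l.length + 1) * 100 ∧
      Exec (forEach r [.store tout (.get tin Reg.j 0 0) (.get tin Reg.j 1 0)
        (.get tin Reg.j 2 0) 1]) s n s' ∧
      (∀ (v : Vertex) (i : Fin 3), s'.tab tout v.1 v.2 (i : ℕ) = 1 ↔ (⟨v, i⟩ : Edge) ∈ l) := by
  obtain ⟨n, s', hn, he, -, h1⟩ := exec_forEach (r := r) (cs := [.store tout (.get tin Reg.j 0 0)
      (.get tin Reg.j 1 0) (.get tin Reg.j 2 0) 1]) rfl rfl rfl hr hn
    (fun i s => s.tab tin = rows (l.map fun e => (e.base.1, e.base.2, (e.dir : ℕ))) ∧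
      (∀ (v : Vertex) (d : Fin 3), s.tab tout v.1 v.2 (d : ℕ) =
        if (⟨v, d⟩ : Edge) ∈ l.take i then 1 else 0))
    ⟨hin, by simp [h0]⟩ (by
    rintro i hi s hj ⟨hin, hout⟩
    obtain ⟨r0, r1, r2⟩ := rows_eq (fun e : Edge => (e.base.1, e.base.2, ((e.dir : ℕ) : ℤ))) l hi
    rw [← hin] at r0 r1 r2
    have hs : (block [.store tout (.get tin Reg.j 0 0)
      (.get tin Reg.j 1 0) (.get tin Reg.j 2 0) 1]).eval s =
        s.setTab tout l[i].base.1 l[i].base.2 (l[i].dir : ℕ) 1 := by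
      simp [hj, r0, r1, r2]
    rw [hs]
    refine ⟨by simp [htt, hin], fun v d => ?_⟩
    simp only [State.setReg_tab, State.setTab_tab_self, hout, mem_take_succ hi]
    by_cases hu : (⟨v, d⟩ : Edge) = l[i]
    · simp [← hu]
    · have : ¬ (v.1 = l[i].base.1 ∧ v.2 = l[i].base.2 ∧
          ((d : ℕ) : ℤ) = ((l[i].dir : ℕ) : ℤ)) := by
        rintro ⟨h1, h2, h3⟩
        apply hu
        generalize l[i] = e at *
        obtain ⟨⟨a', b'⟩, k'⟩ := e
        obtain ⟨a, b⟩ := v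
        simp only [Nat.cast_inj, Fin.val_inj] at h1 h2 h3
        subst h1 h2 h3
        rfl
      rw [if_neg this]
      simp [hu])
  refine ⟨n, s', hn.trans (Nat.mul_le_mul_left _ ?_), he, fun v d => by simp [h1]⟩
  simp [block, Cmd.bound]

theorem exec_countTriangles {R : Finset Tri} {vs : List Vertex} (hnd : vs.Nodup)
    (hmem : ∀ v, v ∈ vs ↔ v ∈ verts R) {s : State} (hs : Listed vs s)
    (htri : ∀ t : Tri, s.tab .tri t.base.1 t.base.2 (t.kind : ℕ) = if t ∈ R then 1 else 0)
    (h0 : ∀ p q r, s.tab .cnt p q r = 0) :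
    ∃ n s', n ≤ (vs.length + 1) * ((block countTriangles).bound + 40) ∧
      Exec (forEach .nV (fetch :: countTriangles)) s n s' ∧
      ∀ (v : Vertex) (i : Fin 3), s'.tab .cnt v.1 v.2 (i : ℕ) = count R ⟨v, i⟩ := by
  obtain ⟨n, s', hn, he, -, h⟩ := exec_forVerts (cs := countTriangles) rfl rfl rfl rfl hnd hs
    (fun P s =>
      (∀ t : Tri, s.tab .tri t.base.1 t.base.2 (t.kind : ℕ) = if t ∈ R then 1 else 0) ∧
      ∀ (v : Vertex) (i : Fin 3), s.tab .cnt v.1 v.2 (i : ℕ) =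
        if v ∈ P then count R ⟨v, i⟩ else 0)
    (fun P s r n _ h => h) ⟨htri, by simp [h0]⟩ (by
    rintro P v s hv hP hx hy ⟨htri, hcnt⟩
    have t0 := fun a b => htri ⟨(a, b), 0⟩
    have t1 := fun a b => htri ⟨(a, b), 1⟩
    simp at t0 t1
    have hs : (block countTriangles).eval s = ((s.setTab .cnt v.1 v.2 0 (count R ⟨v, 0⟩)).setTab
        .cnt v.1 v.2 1 (count R ⟨v, 1⟩)).setTab .cnt v.1 v.2 2 (count R ⟨v, 2⟩) := by
      obtain ⟨a, b⟩ := v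
      simp [countTriangles, hx, hy, t0, t1, count, Edge.left, Edge.right, vec, sub_eq_add_neg]
    rw [hs]
    refine ⟨by simpa using htri, fun w i => ?_⟩
    by_cases hw : w = v
    · subst hw
      fin_cases i <;> simp
    · have : ∀ r : Prop, ¬ (w.1 = v.1 ∧ w.2 = v.2 ∧ r) :=
        fun r h => hw (Prod.ext h.1 h.2.1)
      simp [this, hcnt, hw])
  refine ⟨n, s', hn, he, fun v i => ?_⟩
  rw [h]
  split_ifs with hv
  · rfl
  -- Entries at other vertices keep their initial value 0, which is correct because an edge of `R`
  -- has its base in `R`.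
  · rw [List.mem_toFinset, hmem] at hv
    exact (count_eq_zero fun h => hv (base_mem_verts h)).symm

/-- The time for reading a triangle or for counting the triangles at an edge. -/
def readTime : ℕ := (block readTriangle).bound + (block countTriangles).bound + 200

theorem exec_readInput {R : Finset Tri} {X₁ X₂ : Finset Edge} {lR : List Tri} {l₁ l₂ : List Edge}
    (hR : Enumerates lR R) (h₁ : Enumerates l₁ X₁) (h₂ : Enumerates l₂ X₂) :
    ∃ n s vs, n ≤ (lR.length + l₁.length + l₂.length + vs.length + 5) * readTime ∧
      Exec readInput (input lR l₁ l₂) n s ∧ Env R X₁ X₂ vs s := by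
  set s₀ := input lR l₁ l₂ with hs₀
  have e₁ : Exec (.set .nV 0) s₀ _ _ := .set _ _ _
  have hk₁ : s₀.setReg .nV (Expr.val s₀ 0) = s₀ := by
    have : Function.update s₀.reg .nV 0 = s₀.reg := Function.update_eq_self .nV s₀.reg
    simp [State.setReg, this]
  rw [hk₁] at e₁
  obtain ⟨n₂, s₂, hn₂, e₂, htri, vs, hvs, hmem⟩ := exec_readTriangles lR (s := s₀) rfl rfl
    (fun _ _ _ => rfl) ⟨List.nodup_nil, ⟨rfl, by simp, by simp⟩, fun v => by rfl⟩
  obtain ⟨n₃, s₃, hn₃, e₃, hcon₁⟩ := exec_readConstraints .n1 .in1 .con1 (by simp) (by simp) l₁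
    (s := s₂) (e₂.reg_eq rfl) (e₂.tab_eq rfl) (fun p q r => by rw [e₂.tab_eq rfl]; rfl)
  obtain ⟨n₄, s₄, hn₄, e₄, hcon₂⟩ := exec_readConstraints .n2 .in2 .con2 (by simp) (by simp) l₂
    (s := s₃) ((e₃.reg_eq rfl).trans (e₂.reg_eq rfl)) ((e₃.tab_eq rfl).trans (e₂.tab_eq rfl))
    (fun p q r => by rw [e₃.tab_eq rfl, e₂.tab_eq rfl]; rfl)
  rw [hR.2] at hmem
  obtain ⟨n₅, s₅, hn₅, e₅, hcnt⟩ := exec_countTriangles (R := R) hvs.nodup hmem (s := s₄)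
    (hvs.listed.congr ((e₄.reg_eq rfl).trans (e₃.reg_eq rfl))
      ((e₄.tab_eq rfl).trans (e₃.tab_eq rfl)))
    (fun t => by rw [e₄.tab_eq rfl, e₃.tab_eq rfl, htri, ← hR.2]; simp)
    (fun p q r => by rw [e₄.tab_eq rfl, e₃.tab_eq rfl, e₂.tab_eq rfl]; rfl)
  refine ⟨_, s₅, vs, ?_, .seq e₁ (.seq e₂ (.seq e₃ (.seq e₄ (.seq e₅ (.skip _))))),
    hvs.nodup, hmem, ?_, hcnt, fun v i => ?_, fun v i => ?_⟩
  · simp only [cost_zero]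
    unfold readTime
    have a₂ := hn₂.trans (Nat.mul_le_mul_left (lR.length + 1)
      (show _ ≤ (block readTriangle).bound + (block countTriangles).bound + 200 by omega))
    have a₃ := hn₃.trans (Nat.mul_le_mul_left (l₁.length + 1)
      (show _ ≤ (block readTriangle).bound + (block countTriangles).bound + 200 by omega))
    have a₄ := hn₄.trans (Nat.mul_le_mul_left (l₂.length + 1)
      (show _ ≤ (block readTriangle).bound + (block countTriangles).bound + 200 by omega))
    have a₅ := hn₅.trans (Nat.mul_le_mul_left (vs.length + 1)
      (show _ ≤ (block readTriangle).bound + (block countTriangles).bound + 200 by omega))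
    have a₆ : 200 ≤ (block readTriangle).bound + (block countTriangles).bound + 200 := by omega
    generalize (block readTriangle).bound + (block countTriangles).bound + 200 = K at *
    nlinarith
  · refine hvs.listed.congr ?_ ?_
    · rw [e₅.reg_eq rfl, e₄.reg_eq rfl, e₃.reg_eq rfl]
    · rw [e₅.tab_eq rfl, e₄.tab_eq rfl, e₃.tab_eq rfl]
  · rw [e₅.tab_eq rfl, e₄.tab_eq rfl, hcon₁, ← h₁.2, List.mem_toFinset]
  · rw [e₅.tab_eq rfl, hcon₂, ← h₂.2, List.mem_toFinset]

/-! ## Distances to the boundary -/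

section
variable {R : Finset Tri}

theorem interior_step {v : Vertex} (hv : v ∈ verts R) (hb : v ∉ boundaryVerts R) {σ : ℤ}
    (hσ : σ = 1 ∨ σ = -1) (i : Fin 3) : v + σ • vec i ∈ verts R := by
  obtain ⟨h1, h2⟩ := interior_star hv hb i
  rcases hσ with rfl | rfl
  · simpa [Edge.tip] using tip_mem_verts h1
  · simpa [← sub_eq_add_neg] using base_mem_verts h2

/-- Until a boundary vertex is met, the walk along the line stays among vertices of `R` by
`interior_star`. It cannot go on forever, since `R` is finite and the vertices of a line are
distinct. -/
theorem exists_boundary_on_line {v : Vertex} (hv : v ∈ verts R) {σ : ℤ} (hσ : σ = 1 ∨ σ = -1)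
    (i : Fin 3) : ∃ n : ℕ, v + (σ * n) • vec i ∈ boundaryVerts R ∧
      ∀ m < n, v + (σ * m) • vec i ∈ verts R ∧ v + (σ * m) • vec i ∉ boundaryVerts R := by
  classical
  have hstep : ∀ n : ℕ, (∀ m < n, v + (σ * m) • vec i ∉ boundaryVerts R) →
      v + (σ * n) • vec i ∈ verts R := by
    intro n
    induction n with
    | zero => intro _; simpa using hv
    | succ n ih =>
      intro h
      have h1 := interior_step (ih fun m hm => h m (by omega)) (h n (by omega)) hσ i
      convert h1 using 1
      rw [add_assoc, ← add_smul]
      push_cast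
      ring_nf
  have hex : ∃ n : ℕ, v + (σ * n) • vec i ∈ boundaryVerts R := by
    by_contra hno
    push Not at hno
    have hmaps : ∀ n : ℕ, v + (σ * n) • vec i ∈ verts R := fun n => hstep n fun m _ => hno m
    have hinj : Function.Injective fun n : ℕ => (⟨_, hmaps n⟩ : {w // w ∈ verts R}) := by
      intro n n' h
      have h1 := congrArg Prod.fst (Subtype.ext_iff.1 h)
      have hi : (vec i).1 ≠ 0 ∨ (vec i).2 ≠ 0 := by
        clear * -; revert i; decide
      have h2 := congrArg Prod.snd (Subtype.ext_iff.1 h)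
      simp only [Prod.fst_add, Prod.snd_add, Prod.smul_fst, Prod.smul_snd, smul_eq_mul,
        add_right_inj] at h1 h2
      have hσ' : σ ≠ 0 := by rcases hσ with rfl | rfl <;> simp
      rcases hi with hi | hi
      · have := mul_left_cancel₀ hσ' (mul_right_cancel₀ hi h1)
        exact_mod_cast this
      · have := mul_left_cancel₀ hσ' (mul_right_cancel₀ hi h2)
        exact_mod_cast this
    exact not_injective_infinite_finite _ hinj
  refine ⟨Nat.find hex, Nat.find_spec hex, fun m hm => ⟨?_, Nat.find_min hex hm⟩⟩
  exact hstep m fun m' hm' => Nat.find_min hex (hm'.trans hm)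

/-- The horizontal ray from a vertex of the region soon reaches the boundary, since every vertical
line through an inner vertex of the region contains a boundary vertex. -/
theorem exists_near_boundary {v : Vertex} (hv : v ∈ verts R) {σ : ℤ} (hσ : σ = 1 ∨ σ = -1) :
    ∃ n : ℕ, n ≤ (boundaryVerts R).card ∧ v + (σ * n) • vec 0 ∈ boundaryVerts R ∧
      ∀ m < n, v + (σ * m) • vec 0 ∈ verts R ∧ v + (σ * m) • vec 0 ∉ boundaryVerts R := by
  obtain ⟨n, hn, hm⟩ := exists_boundary_on_line hv hσ 0
  refine ⟨n, ?_, hn, hm⟩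
  -- Moving in direction `1` keeps the first coordinate, so the boundary vertices found above
  -- different points of the ray are distinct.
  choose k hk using fun m : Fin n => exists_boundary_on_line (hm m m.2).1 (.inl rfl) (σ := 1) 1
  have hinj : Function.Injective fun m : Fin n =>
      (⟨_, (hk m).1⟩ : {w // w ∈ boundaryVerts R}) := by
    intro m m' h
    have h1 := congrArg Prod.fst (Subtype.ext_iff.1 h)
    have hσ' : σ ≠ 0 := by rcases hσ with rfl | rfl <;> simp
    simp [vec, hσ'] at h1
    exact Fin.ext h1
  have := Fintype.card_le_of_injective _ hinj
  simpa using this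

theorem boundaryVerts_nonempty (hR : R.Nonempty) : (boundaryVerts R).Nonempty := by
  obtain ⟨t, ht⟩ := hR
  have : t.base ∈ verts R := Finset.mem_biUnion.2 ⟨t, ht, by simp [Tri.verts]⟩
  obtain ⟨n, hn, -⟩ := exists_boundary_on_line this (.inl rfl) (σ := 1) 0
  exact ⟨_, hn⟩

theorem IsSimplyConnectedRegion.nonempty (hR : IsSimplyConnectedRegion R) : R.Nonempty := by
  obtain ⟨⟨t, ht⟩⟩ := hR.connected.nonempty
  exact ⟨t, ht⟩

/-- The heights of the boundary vertices form an interval. -/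
theorem boundary_heights_sub_le (hR : IsSimplyConnectedRegion R) {h : Vertex → ℤ}
    (hh : ∀ e ∈ boundary R, h e.tip = h e.base + 1) {u v : Vertex} (hu : u ∈ boundaryVerts R)
    (hv : v ∈ boundaryVerts R) : h v - h u ≤ (boundaryVerts R).card := by
  by_contra! hlt
  -- A spread larger than the number of boundary vertices would leave a gap in the set of heights.
  obtain ⟨m, hm, hmn⟩ : ∃ m ∈ Finset.Ioc (h u) (h v), m ∉ (boundaryVerts R).image h := by
    by_contra! hall
    have h1 := Finset.card_le_card (show Finset.Ioc (h u) (h v) ⊆ (boundaryVerts R).image h from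
      fun m hm => hall m hm)
    have h2 := h1.trans Finset.card_image_le
    rw [Int.card_Ioc] at h2
    omega
  have hne : ∀ w ∈ boundaryVerts R, h w ≠ m := fun w hw hwm =>
    hmn (Finset.mem_image.2 ⟨w, hw, hwm⟩)
  rw [Finset.mem_Ioc] at hm
  -- Steps of size 1 cannot jump over the missing value `m`, so the vertices below `m` would be
  -- separated from those above.
  have := boundary_connected hR (S := {w | h w < m}) (fun e he => by
    have h1 := hne _ (mem_boundaryVerts.2 ⟨e, he, .inl rfl⟩)
    have h2 := hne _ (mem_boundaryVerts.2 ⟨e, he, .inr rfl⟩)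
    have h3 := hh e he
    change h e.base < m ↔ h e.tip < m
    omega) hu hm.1 hv
  change h v < m at this
  omega

end

/-! ## Stacks -/

/-- An entry of a table indexed by the vertices. -/
abbrev State.entry (s : State) (t : Tab) (v : Vertex) : ℤ := s.tab t v.1 v.2 0

/-- The vertex is on the stack. -/
def OnStack (s : State) (v : Vertex) : Prop :=
  ∃ m : ℕ, (m : ℤ) < s.reg .sp ∧ s.tab .stk m 0 0 = v.1 ∧ s.tab .stk m 1 0 = v.2

/-- The memory after pushing a vertex. -/
def State.push (s : State) (v : Vertex) : State :=
  ((s.setTab .stk (s.reg .sp) 0 0 v.1).setTab .stk (s.reg .sp) 1 0 v.2).setReg .sp (s.reg .sp + 1)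

theorem eval_push {p q : Expr} {s : State} {v : Vertex} (hp : p.val s = v.1)
    (hq : q.val (s.setTab .stk (s.reg .sp) 0 0 v.1) = v.2) : (push p q).eval s = s.push v := by
  simp [push, State.push, hp, hq]

@[simp] theorem push_tab (s : State) (v : Vertex) {t : Tab} (ht : t ≠ .stk) :
    (s.push v).tab t = s.tab t := by
  simp [State.push, ht]

@[simp] theorem push_reg (s : State) (v : Vertex) {r : Reg} (hr : r ≠ .sp) :
    (s.push v).reg r = s.reg r := by
  simp [State.push, hr]

@[simp] theorem push_sp (s : State) (v : Vertex) : (s.push v).reg .sp = s.reg .sp + 1 := by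
  simp [State.push]

theorem onStack_push {s : State} {v w : Vertex} (h0 : 0 ≤ s.reg .sp) :
    OnStack (s.push v) w ↔ OnStack s w ∨ w = v := by
  constructor
  · rintro ⟨m, hm, h1, h2⟩
    by_cases h : (m : ℤ) = s.reg .sp
    · right
      simp [State.push, h] at h1 h2
      exact Prod.ext h1.symm h2.symm
    · left
      simp [State.push, h] at h1 h2 hm
      exact ⟨m, by omega, h1, h2⟩
  · rintro (⟨m, hm, h1, h2⟩ | rfl)
    · refine ⟨m, ?_, ?_, ?_⟩
      · simp; omega
      · simp [State.push, h1, hm.ne]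
      · simp [State.push, h2, hm.ne]
    · refine ⟨(s.reg .sp).toNat, ?_, ?_, ?_⟩ <;> simp [State.push, h0]

/-- The memory after popping a vertex. -/
def State.pop (s : State) (v : Vertex) : State :=
  ((s.setReg .sp (s.reg .sp - 1)).setReg .x v.1).setReg .y v.2

/-- A vertex may be on the stack several times, so the popped vertex may still be there; hence the
form of the last clause. -/
theorem eval_pop {s : State} (h0 : 0 < s.reg .sp) : ∃ v, pop.eval s = s.pop v ∧ OnStack s v ∧
    ∀ w, OnStack s w → w = v ∨ OnStack (s.pop v) w := by
  refine ⟨(s.tab .stk (s.reg .sp - 1) 0 0, s.tab .stk (s.reg .sp - 1) 1 0), ?_, ?_, ?_⟩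
  · simp [pop, State.pop]
  · refine ⟨(s.reg .sp - 1).toNat, by omega, ?_, ?_⟩ <;>
      rw [Int.toNat_of_nonneg (by omega)]
  · rintro w ⟨m, hm, h1, h2⟩
    by_cases h : (m : ℤ) = s.reg .sp - 1
    · left
      rw [← h, h1, h2]
    · right
      exact ⟨m, by simp [State.pop]; omega, h1, h2⟩

theorem onStack_of_pop {s : State} {v w : Vertex} (h : OnStack (s.pop v) w) : OnStack s w := by
  obtain ⟨m, hm, h1, h2⟩ := h
  exact ⟨m, by simp [State.pop] at hm; omega, h1, h2⟩

/-- Induction for a program text repeated for the three directions. -/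
theorem forDirs_induction {f : Fin 3 → Cmd} (J : ℕ → State → Prop)
    (hJ : ∀ (i : Fin 3) s, J i s → J (i + 1) ((f i).eval s)) {s : State} (hs : J 0 s) :
    J 3 ((forDirs f).eval s) :=
  hJ 2 _ (hJ 1 _ (hJ 0 _ hs))

/-! ## Lifting the boundary -/

/-- A height function along the boundary, starting at `u`. -/
def BoundaryHeight (R : Finset Tri) (u : Vertex) (H : Vertex → ℤ) : Prop :=
  H u = u.1 + u.2 ∧ ∀ e ∈ boundary R, H e.tip = H e.base + 1

/-- The boundary vertex has been visited. -/
def Visited (s : State) (v : Vertex) : Prop := s.entry .bset v = 1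

section
variable {R : Finset Tri} {X₁ X₂ : Finset Edge} {vs : List Vertex} {u : Vertex} {s s' : State}

/-- The body of the loop that searches a boundary vertex. -/
def findBoundary : List Cmd :=
  [forDirs fun i => when (.eq (.get .cnt Reg.x Reg.y (lit i)) 1) [.set .a Reg.x, .set .b Reg.y]]

theorem exec_findBoundary (hR : R.Nonempty) (hs : Env R X₁ X₂ vs s) :
    ∃ n s', n ≤ (vs.length + 1) * ((block findBoundary).bound + 40) ∧
      Exec (forEach .nV (fetch :: findBoundary)) s n s' ∧
      (s'.reg .a, s'.reg .b) ∈ boundaryVerts R := by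
  obtain ⟨n, s', hn, he, -, h⟩ := exec_forVerts (cs := findBoundary) rfl rfl rfl rfl hs.nodup
    hs.listed
    (fun P s => Env R X₁ X₂ vs s ∧ ((∃ v ∈ P, ∃ i, (⟨v, i⟩ : Edge) ∈ boundary R) →
      (s.reg .a, s.reg .b) ∈ boundaryVerts R))
    (by
      rintro P s r n hr ⟨h1, h2⟩
      have : r ≠ .nV ∧ r ≠ .a ∧ r ≠ .b := by rcases hr with rfl | rfl | rfl <;> simp
      refine ⟨h1.congr (by simp [this.1.symm]) rfl rfl rfl rfl, ?_⟩
      simpa [this.2.1.symm, this.2.2.symm] using h2)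
    ⟨hs, by simp⟩ (by
      rintro P v s hv hP hx hy ⟨henv, hab⟩
      have key := forDirs_induction (s := s)
        (f := fun i => when (.eq (.get .cnt Reg.x Reg.y (lit i)) 1) [.set .a Reg.x, .set .b Reg.y])
        (fun m s => Env R X₁ X₂ vs s ∧ s.reg .x = v.1 ∧ s.reg .y = v.2 ∧
          (((∃ v ∈ P, ∃ i, (⟨v, i⟩ : Edge) ∈ boundary R) ∨
            ∃ i : Fin 3, (i : ℕ) < m ∧ (⟨v, i⟩ : Edge) ∈ boundary R) →
          (s.reg .a, s.reg .b) ∈ boundaryVerts R)) (by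
        rintro i s ⟨henv, hx, hy, hab⟩
        have hc := henv.cnt v i
        by_cases hi : (⟨v, i⟩ : Edge) ∈ boundary R
        · rw [eval_when_pos (by simp [hx, hy, hc, count_eq_one, hi])]
          refine ⟨henv.congr (by simp) rfl rfl rfl rfl, by simp [hx], by simp [hy], fun _ => ?_⟩
          simp only [eval_block_cons, eval_set, val_reg, eval_block_nil, State.setReg_reg, hx, hy]
          simpa using mem_boundaryVerts.2 ⟨_, hi, .inl rfl⟩
        · rw [eval_when_neg (by simp [hx, hy, hc, count_eq_one, hi])]
          refine ⟨henv, hx, hy, fun h => hab ?_⟩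
          rcases h with h | ⟨i', h1, h2⟩
          · exact .inl h
          · refine .inr ⟨i', ?_, h2⟩
            have : i' ≠ i := by rintro rfl; exact hi h2
            have := Fin.val_ne_of_ne this
            omega) ⟨henv, hx, hy, by simpa using hab⟩
      refine ⟨key.1, fun ⟨w, hw, i, hi⟩ => key.2.2.2 ?_⟩
      rcases Finset.mem_insert.1 hw with rfl | hw
      exacts [.inr ⟨i, i.2, hi⟩, .inl ⟨w, hw, i, hi⟩])
  refine ⟨n, s', hn, he, h ?_⟩
  obtain ⟨w, hw⟩ := boundaryVerts_nonempty hR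
  obtain ⟨e, he, -⟩ := mem_boundaryVerts.1 hw
  refine ⟨e.base, ?_, e.dir, he⟩
  rw [hs.toFinset]
  exact base_mem_verts (boundary_subset_edges he)

/-- The invariants of the traversal of the boundary. -/
structure Traversal (R : Finset Tri) (X₁ X₂ : Finset Edge) (vs : List Vertex) (u : Vertex)
    (s : State) : Prop where
  env : Env R X₁ X₂ vs s
  sp : 0 ≤ s.reg .sp
  bset : ∀ v, s.entry .bset v = 0 ∨ Visited s v
  subset : ∀ v, Visited s v → v ∈ boundaryVerts R
  start : Visited s u ∧ s.entry .bh u = u.1 + u.2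
  lattice : ∀ v, Visited s v → IsCubeHeight v (s.entry .bh v)
  stack : ∀ v, OnStack s v → Visited s v
  ok : s.reg .ok = 0 ∨ s.reg .ok = 1
  unique : ∀ H, BoundaryHeight R u H → s.reg .ok = 1 ∧ ∀ v, Visited s v → s.entry .bh v = H v

open Classical in
/-- The number of pops that remain at most. -/
noncomputable def remaining (R : Finset Tri) (s : State) : ℕ :=
  (s.reg .sp).toNat + ((boundaryVerts R).filter fun v => ¬ Visited s v).card

/-- The changes of the memory during the treatment of one vertex. -/
structure Progress (R : Finset Tri) (s s' : State) : Prop where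
  x : s'.reg .x = s.reg .x
  y : s'.reg .y = s.reg .y
  k : s'.reg .k = s.reg .k
  visited : ∀ v, Visited s v → Visited s' v ∧ s'.entry .bh v = s.entry .bh v
  fresh : ∀ v, Visited s' v → Visited s v ∨ OnStack s' v
  stack : ∀ v, OnStack s v → OnStack s' v
  ok : s'.reg .ok = 1 → s.reg .ok = 1
  remaining : remaining R s' = remaining R s

theorem Progress.refl (R : Finset Tri) (s : State) : Progress R s s :=
  ⟨rfl, rfl, rfl, fun _ h => ⟨h, rfl⟩, fun _ h => .inl h, fun _ h => h, id, rfl⟩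

theorem Progress.trans {s₁ s₂ s₃ : State} (h : Progress R s₁ s₂) (h' : Progress R s₂ s₃) :
    Progress R s₁ s₃ :=
  ⟨h'.x.trans h.x, h'.y.trans h.y, h'.k.trans h.k,
    fun v hv => ⟨(h'.visited v (h.visited v hv).1).1,
      (h'.visited v (h.visited v hv).1).2.trans (h.visited v hv).2⟩,
    fun v hv => (h'.fresh v hv).elim (fun h1 => (h.fresh v h1).imp_right (h'.stack v)) .inr,
    fun v hv => h'.stack v (h.stack v hv), fun h1 => h.ok (h'.ok h1),
    h'.remaining.trans h.remaining⟩

/-- Hypothesis `hH` says that `m` is the only value that a consistent boundary height can take at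
`v`. So recording `m` preserves the field `unique`, and a clash with a recorded height shows that no
consistent boundary height exists. -/
theorem Traversal.visit (h : Traversal R X₁ X₂ vs u s) {p q e : Expr} {v : Vertex} {m : ℤ}
    (hp : ∀ s' : State, s'.reg .x = s.reg .x → s'.reg .y = s.reg .y → p.val s' = v.1)
    (hq : ∀ s' : State, s'.reg .x = s.reg .x → s'.reg .y = s.reg .y → q.val s' = v.2)
    (he : ∀ s' : State, s'.reg .k = s.reg .k → e.val s' = m)
    (hv : v ∈ boundaryVerts R) (hm : IsCubeHeight v m)
    (hH : ∀ H, BoundaryHeight R u H → H v = m) :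
    Traversal R X₁ X₂ vs u ((visit p q e).eval s) ∧ Progress R s ((visit p q e).eval s) ∧
      Visited ((visit p q e).eval s) v ∧
      (((visit p q e).eval s).reg .ok = 1 → ((visit p q e).eval s).entry .bh v = m) := by
  have hne : ∀ w : Vertex, w ≠ v → ¬ (w.1 = v.1 ∧ w.2 = v.2) := fun w hw h => hw (Prod.ext h.1 h.2)
  rcases h.bset v with h0 | h1
  · set t := (s.setTab .bset v.1 v.2 0 1).setTab .bh v.1 v.2 0 m with ht
    have hs' : (Calisson.visit p q e).eval s = t.push v := by
      rw [Calisson.visit, eval_ite_pos (by simpa [hp s rfl rfl, hq s rfl rfl] using h0)]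
      simp only [eval_block_cons, eval_store, eval_block_nil, val_zero, val_one, hp s rfl rfl,
        hq s rfl rfl]
      rw [hp (s.setTab .bset v.1 v.2 0 1) rfl rfl, hq (s.setTab .bset v.1 v.2 0 1) rfl rfl,
        he (s.setTab .bset v.1 v.2 0 1) rfl]
      exact eval_push (hp _ rfl rfl) (hq _ rfl rfl)
    rw [hs']
    have hnv : ¬ Visited s v := by unfold Visited; rw [h0]; simp
    have hvis : ∀ w, Visited (t.push v) w ↔ Visited s w ∨ w = v := by
      intro w
      by_cases hw : w = v
      · subst hw; simp [Visited, ht, State.entry]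
      · simp [Visited, ht, State.entry, hw, hne w hw]
    have hbh : ∀ w, (t.push v).entry .bh w = if w = v then m else s.entry .bh w := by
      intro w
      by_cases hw : w = v
      · subst hw; simp [ht, State.entry]
      · simp [ht, State.entry, hw, hne w hw]
    have hst : ∀ w, OnStack (t.push v) w ↔ OnStack s w ∨ w = v := by
      intro w
      rw [onStack_push (by simpa [ht] using h.sp)]
      simp [OnStack, ht]
    have hok : (t.push v).reg .ok = s.reg .ok := by simp [ht]
    have hold : ∀ w, Visited s w → w ≠ v := fun w hw h => hnv (h ▸ hw)
    refine ⟨⟨?_, ?_, ?_, ?_, ?_, ?_, ?_, ?_, ?_⟩, ⟨?_, ?_, ?_, ?_, ?_, ?_, ?_, ?_⟩, ?_, ?_⟩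
    · exact h.env.congr (by simp [ht]) (by simp [ht]) (by simp [ht]) (by simp [ht]) (by simp [ht])
    · simpa [ht] using (by have := h.sp; omega : 0 ≤ s.reg .sp + 1)
    · intro w
      by_cases hw : w = v
      · exact .inr ((hvis w).2 (.inr hw))
      · refine (h.bset w).imp (fun h => ?_) fun h => (hvis w).2 (.inl h)
        simpa [ht, State.entry, hne w hw] using h
    · intro w hw
      rcases (hvis w).1 hw with hw | rfl
      exacts [h.subset w hw, hv]
    · refine ⟨(hvis u).2 (.inl h.start.1), ?_⟩
      rw [hbh, if_neg (hold u h.start.1), h.start.2]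
    · intro w hw
      rw [hbh]
      rcases (hvis w).1 hw with hw | rfl
      · rw [if_neg (hold w hw)]
        exact h.lattice w hw
      · rwa [if_pos rfl]
    · intro w hw
      exact (hvis w).2 (((hst w).1 hw).imp_left (h.stack w))
    · rw [hok]
      exact h.ok
    · intro H hH'
      obtain ⟨h1, h2⟩ := h.unique H hH'
      refine ⟨hok.trans h1, fun w hw => ?_⟩
      rw [hbh]
      rcases (hvis w).1 hw with hw | rfl
      · rw [if_neg (hold w hw), h2 w hw]
      · rw [if_pos rfl, hH H hH']
    · simp [ht]
    · simp [ht]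
    · simp [ht]
    · intro w hw
      exact ⟨(hvis w).2 (.inl hw), by rw [hbh, if_neg (hold w hw)]⟩
    · intro w hw
      rcases (hvis w).1 hw with hw | rfl
      exacts [.inl hw, .inr ((hst w).2 (.inr rfl))]
    · exact fun w hw => (hst w).2 (.inl hw)
    · rw [hok]; exact id
    · classical
      -- One more vertex on the stack, one less to visit: the measure is unchanged.
      have hf : (boundaryVerts R).filter (fun w => ¬ Visited s w) =
          insert v ((boundaryVerts R).filter fun w => ¬ Visited (t.push v) w) := by
        ext w
        by_cases hw : w = v
        · subst hw; simp [hv, hnv]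
        · simp [hvis, hw]
      have hcard := congrArg Finset.card hf
      rw [Finset.card_insert_of_notMem (by simp [hvis])] at hcard
      have hsp : (t.push v).reg .sp = s.reg .sp + 1 := by simp [ht]
      have := h.sp
      unfold Calisson.remaining
      rw [hsp]
      convert_to _ + (Finset.card _) = _
      rw [show Finset.card (Finset.filter (fun w => ¬ Visited s w) (boundaryVerts R)) = _ from hcard]
      omega
    · exact (hvis v).2 (.inr rfl)
    · intro _
      rw [hbh, if_pos rfl]
  · have hp0 := hp s rfl rfl
    have hq0 := hq s rfl rfl
    have he0 := he s rfl
    have h1' : s.tab .bset v.1 v.2 0 = 1 := h1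
    rw [Calisson.visit, eval_ite_neg (by simp [hp0, hq0, h1'])]
    by_cases heq : s.entry .bh v = m
    · rw [eval_when_neg (by simpa [hp0, hq0, he0] using heq)]
      exact ⟨h, .refl R s, h1, fun _ => heq⟩
    · rw [eval_when_pos (by simpa [hp0, hq0, he0] using heq)]
      simp only [eval_block_cons, eval_set, val_zero, eval_block_nil]
      have hst : ∀ w, OnStack (s.setReg .ok 0) w ↔ OnStack s w := fun w => by simp [OnStack]
      refine ⟨⟨?_, ?_, h.bset, h.subset, h.start, h.lattice, ?_, ?_, ?_⟩,
        ⟨?_, ?_, ?_, ?_, ?_, ?_, ?_, ?_⟩, h1, ?_⟩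
      · exact h.env.congr (by simp) rfl rfl rfl rfl
      · simpa using h.sp
      · exact fun w hw => h.stack w ((hst w).1 hw)
      · simp
      · intro H hH'
        exact absurd (((h.unique H hH').2 v h1).trans (hH H hH')) heq
      · simp
      · simp
      · simp
      · exact fun w hw => ⟨hw, rfl⟩
      · exact fun w hw => .inl hw
      · exact fun w hw => (hst w).2 hw
      · simp
      · simp [Calisson.remaining, Visited, State.entry]
        rfl
      · simp

/-- The two neighbours of a vertex in direction `i` along the boundary have been visited. -/
def TreatedDir (R : Finset Tri) (s : State) (v : Vertex) (i : Fin 3) : Prop :=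
  ((⟨v, i⟩ : Edge) ∈ boundary R → Visited s (v + vec i) ∧
    (s.reg .ok = 1 → s.entry .bh (v + vec i) = s.entry .bh v + 1)) ∧
  ((⟨v - vec i, i⟩ : Edge) ∈ boundary R → Visited s (v - vec i) ∧
    (s.reg .ok = 1 → s.entry .bh (v - vec i) = s.entry .bh v - 1))

/-- Recorded heights never change, and once `ok` is cleared it is not set again. -/
theorem TreatedDir.progress {v : Vertex} {i : Fin 3} (h : TreatedDir R s v i) (hv : Visited s v)
    (hp : Progress R s s') : TreatedDir R s' v i := by
  refine ⟨fun h1 => ?_, fun h1 => ?_⟩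
  · obtain ⟨h2, h3⟩ := h.1 h1
    refine ⟨(hp.visited _ h2).1, fun hok => ?_⟩
    rw [(hp.visited _ h2).2, (hp.visited _ hv).2, h3 (hp.ok hok)]
  · obtain ⟨h2, h3⟩ := h.2 h1
    refine ⟨(hp.visited _ h2).1, fun hok => ?_⟩
    rw [(hp.visited _ h2).2, (hp.visited _ hv).2, h3 (hp.ok hok)]

/-- The program text that treats the boundary edges of one direction at a vertex. -/
def traverseDir (i : Fin 3) : Cmd := block [
  when (.eq (.get .cnt Reg.x Reg.y (lit i)) 1)
    [visit (Reg.x + dx i) (Reg.y + dy i) (Reg.k + 1)],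
  when (.eq (.get .cnt (Reg.x - dx i) (Reg.y - dy i) (lit i)) 1)
    [visit (Reg.x - dx i) (Reg.y - dy i) (Reg.k - 1)]]

theorem Traversal.traverseDir (h : Traversal R X₁ X₂ vs u s) {v : Vertex} (hv : Visited s v)
    (hx : s.reg .x = v.1) (hy : s.reg .y = v.2) (hk : s.reg .k = s.entry .bh v) (i : Fin 3) :
    Traversal R X₁ X₂ vs u ((traverseDir i).eval s) ∧
      Progress R s ((traverseDir i).eval s) ∧ TreatedDir R ((traverseDir i).eval s) v i := by
  obtain ⟨s₁, hs₁, t₁, p₁, d₁⟩ : ∃ s₁, (when (.eq (.get .cnt Reg.x Reg.y (lit i)) 1)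
      [Calisson.visit (Reg.x + dx i) (Reg.y + dy i) (Reg.k + 1)]).eval s = s₁ ∧
      Traversal R X₁ X₂ vs u s₁ ∧ Progress R s s₁ ∧
      ((⟨v, i⟩ : Edge) ∈ boundary R → Visited s₁ (v + vec i) ∧
        (s₁.reg .ok = 1 → s₁.entry .bh (v + vec i) = s.entry .bh v + 1)) := by
    refine ⟨_, rfl, ?_⟩
    by_cases hi : (⟨v, i⟩ : Edge) ∈ boundary R
    · rw [eval_when_pos (by simp [hx, hy, h.env.cnt v i, count_eq_one, hi])]
      have := h.visit (p := Reg.x + dx i) (q := Reg.y + dy i) (e := Reg.k + 1) (v := v + vec i)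
        (m := s.entry .bh v + 1) (by intro s' h _; simp [h, hx]) (by intro s' _ h; simp [h, hy])
        (by intro s' h; simp [h, hk]) (mem_boundaryVerts.2 ⟨_, hi, .inr rfl⟩)
        ((h.lattice v hv).add_vec i) (fun H hH => by
          rw [(h.unique H hH).2 v hv]
          exact hH.2 _ hi)
      exact ⟨this.1, this.2.1, fun _ => this.2.2⟩
    · rw [eval_when_neg (by simp [hx, hy, h.env.cnt v i, count_eq_one, hi])]
      exact ⟨h, .refl R s, fun h => absurd h hi⟩
  have hv₁ := p₁.visited v hv
  obtain ⟨s₂, hs₂, t₂, p₂, d₂⟩ : ∃ s₂,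
      (when (.eq (.get .cnt (Reg.x - dx i) (Reg.y - dy i) (lit i)) 1)
      [Calisson.visit (Reg.x - dx i) (Reg.y - dy i) (Reg.k - 1)]).eval s₁ = s₂ ∧
      Traversal R X₁ X₂ vs u s₂ ∧ Progress R s₁ s₂ ∧
      ((⟨v - vec i, i⟩ : Edge) ∈ boundary R → Visited s₂ (v - vec i) ∧
        (s₂.reg .ok = 1 → s₂.entry .bh (v - vec i) = s₁.entry .bh v - 1)) := by
    refine ⟨_, rfl, ?_⟩
    have hc : s₁.tab .cnt (v.1 - (vec i).1) (v.2 - (vec i).2) (i : ℕ) = count R ⟨v - vec i, i⟩ :=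
      t₁.env.cnt (v - vec i) i
    by_cases hi : (⟨v - vec i, i⟩ : Edge) ∈ boundary R
    · rw [eval_when_pos (by simp [p₁.x, p₁.y, hx, hy, hc, count_eq_one, hi])]
      have := t₁.visit (p := Reg.x - dx i) (q := Reg.y - dy i) (e := Reg.k - 1) (v := v - vec i)
        (m := s₁.entry .bh v - 1) (by intro s' h _; simp [h, p₁.x, hx])
        (by intro s' _ h; simp [h, p₁.y, hy])
        (by intro s' h; simp [h, p₁.k, hk, hv₁.2]) (mem_boundaryVerts.2 ⟨_, hi, .inl rfl⟩)
        ((t₁.lattice v hv₁.1).sub_vec i) (fun H hH => by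
          rw [(t₁.unique H hH).2 v hv₁.1]
          have := hH.2 _ hi
          simp [Edge.tip] at this
          omega)
      exact ⟨this.1, this.2.1, fun _ => this.2.2⟩
    · rw [eval_when_neg (by simp [p₁.x, p₁.y, hx, hy, hc, count_eq_one, hi])]
      exact ⟨t₁, .refl R s₁, fun h => absurd h hi⟩
  have hs : (Calisson.traverseDir i).eval s = s₂ := by
    rw [← hs₂, ← hs₁]
    rfl
  rw [hs]
  refine ⟨t₂, p₁.trans p₂, fun h1 => ?_, fun h1 => ?_⟩
  · obtain ⟨h2, h3⟩ := d₁ h1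
    refine ⟨(p₂.visited _ h2).1, fun hok => ?_⟩
    rw [(p₂.visited _ h2).2, (p₂.visited _ hv₁.1).2, hv₁.2, h3 (p₂.ok hok)]
  · obtain ⟨h2, h3⟩ := d₂ h1
    refine ⟨h2, fun hok => ?_⟩
    rw [(p₂.visited _ hv₁.1).2, h3 hok]

/-- The body of the traversal of the boundary. -/
def traverseBody : List Cmd :=
  [pop, .set .k (.get .bh Reg.x Reg.y 0), forDirs traverseDir]

/-- The traversal is complete, except for the vertices on the stack. -/
def Complete (R : Finset Tri) (s : State) : Prop :=
  ∀ v, Visited s v → OnStack s v ∨ ∀ i, TreatedDir R s v i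

/-- Only the pop changes the measure, since visits conserve it. A vertex leaves the stack exactly
when its six incident directions are treated. -/
theorem Traversal.body (h : Traversal R X₁ X₂ vs u s) (hc : Complete R s) (h0 : 0 < s.reg .sp) :
    Traversal R X₁ X₂ vs u ((block traverseBody).eval s) ∧
      Complete R ((block traverseBody).eval s) ∧
      remaining R ((block traverseBody).eval s) < remaining R s := by
  obtain ⟨v, hpop, hon, hstk⟩ := eval_pop h0
  have hv := h.stack v hon
  set s₁ := (s.pop v).setReg .k (s.entry .bh v) with hs₁
  have hs : (block traverseBody).eval s = (forDirs Calisson.traverseDir).eval s₁ := by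
    simp only [traverseBody, eval_block_cons, eval_block_nil, hpop]
    congr 1
  have hst : ∀ w, OnStack s₁ w ↔ OnStack (s.pop v) w := fun w => by simp [OnStack, hs₁]
  have t₁ : Traversal R X₁ X₂ vs u s₁ := by
    refine ⟨h.env.congr (by simp [hs₁, State.pop]) rfl rfl rfl rfl, ?_, h.bset, h.subset, h.start,
      h.lattice, fun w hw => h.stack w (onStack_of_pop ((hst w).1 hw)), ?_, ?_⟩
    · simp [hs₁, State.pop]; omega
    · simpa [hs₁, State.pop] using h.ok
    · intro H hH
      have := h.unique H hH
      exact ⟨by simpa [hs₁, State.pop] using this.1, this.2⟩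
  have hrem : remaining R s₁ < remaining R s := by
    have h1 : s₁.reg .sp = s.reg .sp - 1 := by simp [hs₁, State.pop]
    unfold remaining
    rw [h1]
    refine Nat.add_lt_add_of_lt_of_le (by omega) (le_of_eq ?_)
    rfl
  have key := forDirs_induction (s := s₁) (f := Calisson.traverseDir)
    (fun m t => Traversal R X₁ X₂ vs u t ∧ Progress R s₁ t ∧
      ∀ i : Fin 3, (i : ℕ) < m → TreatedDir R t v i) (by
    rintro i t ⟨ht, hp, hd⟩
    have hvt := hp.visited v hv
    obtain ⟨a1, a2, a3⟩ := ht.traverseDir hvt.1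
      (by rw [hp.x]; simp [hs₁, State.pop]) (by rw [hp.y]; simp [hs₁, State.pop])
      (by rw [hp.k, hvt.2]; simp [hs₁, State.pop, State.entry]) i
    refine ⟨a1, hp.trans a2, fun i' hi' => ?_⟩
    by_cases hii : i' = i
    · rwa [hii]
    · have := Fin.val_ne_of_ne hii
      exact (hd i' (by omega)).progress hvt.1 a2)
    ⟨t₁, .refl R s₁, by simp⟩
  obtain ⟨b1, b2, b3⟩ := key
  rw [hs]
  refine ⟨b1, fun w hw => ?_, by rwa [b2.remaining]⟩
  rcases b2.fresh w hw with hw | hw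
  · rcases hc w hw with hw' | hw'
    · rcases hstk w hw' with rfl | hw'
      · exact .inr fun i => b3 i i.2
      · exact .inl (b2.stack w ((hst w).2 hw'))
    · refine .inr fun i => TreatedDir.progress (s := s₁) ?_ hw b2
      have hok : s₁.reg .ok = s.reg .ok := by simp [hs₁, State.pop]
      have := hw' i
      unfold TreatedDir at this ⊢
      rw [hok]
      exact this
  · exact .inl hw

/-- What the traversal of the boundary, started at the vertex `(a, b)`, computes. -/
structure Lifted (R : Finset Tri) (s : State) : Prop where
  start : (s.reg .a, s.reg .b) ∈ boundaryVerts R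
  bset : ∀ v, s.entry .bset v = 1 ↔ v ∈ boundaryVerts R
  start_height : s.entry .bh (s.reg .a, s.reg .b) = s.reg .a + s.reg .b
  lattice : ∀ v ∈ boundaryVerts R, IsCubeHeight v (s.entry .bh v)
  ok : s.reg .ok = 0 ∨ s.reg .ok = 1
  step : s.reg .ok = 1 → ∀ e ∈ boundary R, s.entry .bh e.tip = s.entry .bh e.base + 1
  unique : ∀ H, BoundaryHeight R (s.reg .a, s.reg .b) H →
    s.reg .ok = 1 ∧ ∀ v ∈ boundaryVerts R, s.entry .bh v = H v

/-- The time for one vertex in the lift of the boundary. -/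
def liftTime : ℕ := (block findBoundary).bound + (block traverseBody).bound + 100

theorem exec_liftBoundary (hR : IsSimplyConnectedRegion R) (h : Env R X₁ X₂ vs s)
    (h0 : ∀ v, s.entry .bset v = 0) :
    ∃ n s', n ≤ (vs.length + (boundaryVerts R).card + 5) * liftTime ∧ Exec liftBoundary s n s' ∧
      Lifted R s' := by
  have e₁ : Exec (.set .ok 1) s _ (s.setReg .ok 1) := .set _ _ _
  set s₁ := s.setReg .ok 1 with hs₁
  obtain ⟨n₂, s₂, hn₂, e₂, hu⟩ := exec_findBoundary hR.nonempty
    (h.exec e₁ ⟨rfl, rfl, rfl, rfl, rfl⟩)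
  have henv₂ := (h.exec e₁ ⟨rfl, rfl, rfl, rfl, rfl⟩).exec e₂ ⟨rfl, rfl, rfl, rfl, rfl⟩
  set u : Vertex := (s₂.reg .a, s₂.reg .b) with hudef
  have e₃ : Exec (.set .sp 0) s₂ _ (s₂.setReg .sp 0) := .set _ _ _
  have e₄ : Exec (.store .bset Reg.a Reg.b 0 1) (s₂.setReg .sp 0) _
      ((s₂.setReg .sp 0).setTab .bset u.1 u.2 0 1) := .store _ _ _ _ _ _
  have e₅ : Exec (.store .bh Reg.a Reg.b 0 (Reg.a + Reg.b))
      ((s₂.setReg .sp 0).setTab .bset u.1 u.2 0 1) _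
      (((s₂.setReg .sp 0).setTab .bset u.1 u.2 0 1).setTab .bh u.1 u.2 0 (u.1 + u.2)) :=
    .store _ _ _ _ _ _
  set s₅ := ((s₂.setReg .sp 0).setTab .bset u.1 u.2 0 1).setTab .bh u.1 u.2 0 (u.1 + u.2) with hs₅
  obtain ⟨n₆, hn₆, e₆⟩ := exec_eval (push Reg.a Reg.b) rfl s₅
  rw [eval_push (v := u) rfl rfl] at e₆
  have hok₂ : s₂.reg .ok = 1 := by
    rw [e₂.reg_eq rfl]; simp [hs₁]
  have hne : ∀ w : Vertex, w ≠ u → ¬ (w.1 = u.1 ∧ w.2 = u.2) := fun w hw h => hw (Prod.ext h.1 h.2)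
  have hvis : ∀ w, (s₅.push u).entry .bset w = if w = u then 1 else 0 := by
    intro w
    by_cases hw : w = u
    · rw [hw]; simp [hs₅, State.entry]
    · have : s₂.tab .bset w.1 w.2 0 = 0 := by
        rw [e₂.tab_eq rfl]; exact h0 w
      simp [hs₅, State.entry, hw, hne w hw, this]
  have hvis' : ∀ w, Visited (s₅.push u) w ↔ w = u := by
    intro w
    unfold Visited
    rw [hvis]
    split_ifs with h <;> simp [h]
  have hbh : (s₅.push u).entry .bh u = u.1 + u.2 := by simp [hs₅, State.entry]
  have hst : ∀ w, OnStack (s₅.push u) w ↔ w = u := by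
    intro w
    rw [onStack_push (by simp [hs₅])]
    constructor
    · rintro (⟨m, hm, -⟩ | h)
      · simp [hs₅] at hm; omega
      · exact h
    · exact .inr
  have t₆ : Traversal R X₁ X₂ vs u (s₅.push u) := by
    refine ⟨henv₂.congr (by simp [hs₅]) (by simp [hs₅]) (by simp [hs₅]) (by simp [hs₅])
      (by simp [hs₅]), by simp [hs₅], fun v => ?_, fun v hv => ?_, ⟨(hvis' u).2 rfl, hbh⟩,
      fun v hv => ?_, fun v hv => ?_, ?_, fun H hH => ⟨?_, fun v hv => ?_⟩⟩
    · rw [Visited, hvis]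
      split_ifs <;> simp
    · rw [(hvis' v).1 hv]; exact hu
    · rw [(hvis' v).1 hv, hbh]
      exact ⟨0, by ring⟩
    · exact (hvis' v).2 ((hst v).1 hv)
    · right; simp [hs₅, hok₂]
    · simp [hs₅, hok₂]
    · rw [(hvis' v).1 hv, hbh, hH.1]
  obtain ⟨n₇, s₇, hn₇, e₇, ⟨t₇, c₇⟩, hp⟩ := exec_loop (p := .lt 0 Reg.sp) (c := block traverseBody)
    (fun s => Traversal R X₁ X₂ vs u s ∧ Complete R s) (remaining R) (block traverseBody).bound
    (by
      rintro s ⟨ht, hc⟩ hp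
      obtain ⟨a1, a2, a3⟩ := ht.body hc (by simpa using hp)
      obtain ⟨n, hn, he⟩ := exec_eval (block traverseBody) rfl s
      exact ⟨n, _, hn, he, ⟨a1, a2⟩, a3⟩)
    (s₅.push u) ⟨t₆, fun v hv => .inl ((hst v).2 ((hvis' v).1 hv))⟩
  have hua : (s₇.reg .a, s₇.reg .b) = u := by
    rw [e₇.reg_eq rfl, e₇.reg_eq rfl]
    simp [hs₅, hudef]
  have htr : ∀ v, Visited s₇ v → ∀ i, TreatedDir R s₇ v i := by
    intro v hv
    refine (c₇ v hv).resolve_left ?_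
    rintro ⟨m, hm, -⟩
    simp at hp
    omega
  have hedge : ∀ e : Edge, e ∈ boundary R → (Visited s₇ e.base ↔ Visited s₇ e.tip) := by
    intro e he
    constructor
    · exact fun h => ((htr _ h e.dir).1 he).1
    · intro h
      have := ((htr _ h e.dir).2 (by simpa [Edge.tip] using he)).1
      simpa [Edge.tip] using this
  -- With an empty stack the visited set is invariant along boundary edges, so connectedness of the
  -- boundary makes the traversal exhaustive.
  have hall : ∀ v ∈ boundaryVerts R, Visited s₇ v := fun v hv =>
    boundary_connected hR (S := {v | Visited s₇ v}) hedge hu t₇.start.1 hv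
  refine ⟨_, s₇, ?_, .seq e₁ (.seq e₂ (.seq e₃ (.seq e₄ (.seq e₅ (.seq e₆ (.seq e₇ (.skip _))))))),
    ?_, ?_, ?_, ?_, t₇.ok, ?_, ?_⟩
  · have hr : remaining R (s₅.push u) ≤ (boundaryVerts R).card + 1 := by
      classical
      unfold remaining
      have h1 : (s₅.push u).reg .sp = 1 := by simp [hs₅]
      rw [h1, add_comm]
      exact Nat.add_le_add_right (Finset.card_filter_le _ _) _
    have hn₆' : n₆ ≤ 20 := hn₆.trans (by decide)
    simp only [cost_zero, cost_one, cost_reg, cost_add, cost_lt] at *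
    have b₂ : n₂ ≤ (vs.length + 1) * liftTime :=
      hn₂.trans (Nat.mul_le_mul_left _ (by unfold liftTime; omega))
    have b₇ : n₇ ≤ ((boundaryVerts R).card + 2) * liftTime :=
      hn₇.trans (Nat.mul_le_mul (by omega) (by unfold liftTime; omega))
    have : 100 ≤ liftTime := by unfold liftTime; omega
    nlinarith
  · rw [hua]; exact hu
  · exact fun v => ⟨t₇.subset v, hall v⟩
  · rw [hua, t₇.start.2, ← hua]
  · exact fun v hv => t₇.lattice v (hall v hv)
  · exact fun hok e he => ((htr _ (hall _ (mem_boundaryVerts.2 ⟨e, he, .inl rfl⟩)) e.dir).1 he).2 hok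
  · intro H hH
    rw [hua] at hH
    exact ⟨(t₇.unique H hH).1, fun v hv => (t₇.unique H hH).2 v (hall v hv)⟩

end

/-! ## Search level by level -/

/-- The numbers obtained from those of the sources by adding one along each arc. -/
inductive Dist (src : Vertex → ℤ → Prop) (nbr : Vertex → Fin 3 → Vertex)
    (adj : Vertex → Fin 3 → Prop) : Vertex → ℤ → Prop
  | src (v : Vertex) (m : ℤ) (h : src v m) : Dist src nbr adj v m
  | step (v : Vertex) (m : ℤ) (i : Fin 3) (h : Dist src nbr adj v m) (ha : adj v i) :
      Dist src nbr adj (nbr v i) (m + 1)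

/-- The data that distinguish the computations of the two cuts. -/
structure Search where
  st : Tab
  vt : Tab
  σ : ℤ
  nbr : Vertex → Fin 3 → Vertex
  edge : Vertex → Fin 3 → Edge
  C : Fin 3 → Expr
  P : Fin 3 → Expr
  Q : Fin 3 → Expr
  T : Fin 3 → Test
  E : Expr

namespace Search

/-- Update a neighbour. -/
def relax (S : Search) (i : Fin 3) : Cmd :=
  when (.lt 0 (S.C i)) [
    when (.or (.eq (.get S.st (S.P i) (S.Q i) 0) 0) (S.T i)) [
      .store S.st (S.P i) (S.Q i) 0 1,
      .store S.vt (S.P i) (S.Q i) 0 S.E]]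

/-- Settle a vertex of the current level. -/
def body (S : Search) : List Cmd := [
  when (.and (.eq (.get S.st Reg.x Reg.y 0) 1) (.eq (.get S.vt Reg.x Reg.y 0) Reg.k)) [
    .set .settled (Reg.settled + 1),
    forDirs S.relax]]

/-- The search, starting at the level contained in a register. -/
def cmd (S : Search) (r : Reg) : Cmd := block [
  .set .k r, .set .settled 0,
  loop (.lt Reg.settled Reg.nV) [forEach .nV (fetch :: S.body), .set .k S.E]]

/-- The expressions have the intended values. -/
structure Valid (S : Search) (R : Finset Tri) : Prop where
  tab : S.st ≠ S.vt ∧ ∀ t : Tab, t = .vtx ∨ t = .cnt ∨ t = .con1 ∨ t = .con2 → t ≠ S.st ∧ t ≠ S.vt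
  sign : S.σ * S.σ = 1
  nbr : ∀ v i, S.edge v i ∈ edges R → S.nbr v i ∈ verts R
  C : ∀ (s : State) (v : Vertex) i, s.reg .x = v.1 → s.reg .y = v.2 →
    (S.C i).val s = s.tab .cnt (S.edge v i).base.1 (S.edge v i).base.2 ((S.edge v i).dir : ℕ)
  P : ∀ (s : State) (v : Vertex) i, s.reg .x = v.1 → s.reg .y = v.2 →
    (S.P i).val s = (S.nbr v i).1
  Q : ∀ (s : State) (v : Vertex) i, s.reg .x = v.1 → s.reg .y = v.2 →
    (S.Q i).val s = (S.nbr v i).2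
  T : ∀ (s : State) (v : Vertex) i, s.reg .x = v.1 → s.reg .y = v.2 →
    ((S.T i).holds s ↔ S.σ * s.reg .k + 1 < S.σ * s.entry S.vt (S.nbr v i))
  E : ∀ s : State, S.E.val s = s.reg .k + S.σ

/-- The vertex has a value. -/
def Has (S : Search) (s : State) (v : Vertex) : Prop := s.entry S.st v = 1

/-- The value of a vertex, with the sign for which it is to be minimized. -/
def val (S : Search) (s : State) (v : Vertex) : ℤ := S.σ * s.entry S.vt v

/-- The vertex is settled: it has a value below the current level, or at the current level and it
belongs to `P`. -/
def Done (S : Search) (κ : ℤ) (P : Finset Vertex) (s : State) (v : Vertex) : Prop :=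
  S.Has s v ∧ (S.val s v < κ ∨ S.val s v = κ ∧ v ∈ P)

section
variable {S : Search} {R : Finset Tri} {X₁ X₂ : Finset Edge} {vs : List Vertex}
  {src : Vertex → ℤ → Prop} {s s' : State} {κ : ℤ} {P : Finset Vertex}

/-- The invariants of the values. -/
structure Sound (S : Search) (R : Finset Tri) (src : Vertex → ℤ → Prop) (s : State) : Prop where
  has : ∀ v, s.entry S.st v = 0 ∨ S.Has s v
  mem : ∀ v, S.Has s v → v ∈ verts R
  dist : ∀ v, S.Has s v → Dist src S.nbr (fun v i => S.edge v i ∈ edges R) v (S.val s v)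
  src : ∀ v m, src v m → S.Has s v ∧ S.val s v ≤ m

theorem Sound.setReg (h : S.Sound R src s) (r : Reg) (n : ℤ) : S.Sound R src (s.setReg r n) :=
  ⟨h.has, h.mem, h.dist, h.src⟩

/-- The values of the vertices improve, but not those up to the level `κ`. -/
structure Improves (S : Search) (κ : ℤ) (s s' : State) : Prop where
  x : s'.reg .x = s.reg .x
  y : s'.reg .y = s.reg .y
  k : s'.reg .k = s.reg .k
  settled : s'.reg .settled = s.reg .settled
  le : ∀ v, S.Has s v → S.Has s' v ∧ S.val s' v ≤ S.val s v
  level : ∀ v, S.Has s' v → S.val s' v ≤ κ → S.Has s v ∧ S.val s v ≤ κ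
  eq : ∀ v, S.Has s v → S.val s v ≤ κ → S.val s' v = S.val s v

theorem Improves.refl (S : Search) (κ : ℤ) (s : State) : S.Improves κ s s :=
  ⟨rfl, rfl, rfl, rfl, fun _ h => ⟨h, le_rfl⟩, fun _ h h' => ⟨h, h'⟩, fun _ _ _ => rfl⟩

theorem Improves.trans {s₁ s₂ s₃ : State} (h : S.Improves κ s₁ s₂) (h' : S.Improves κ s₂ s₃) :
    S.Improves κ s₁ s₃ := by
  refine ⟨h'.x.trans h.x, h'.y.trans h.y, h'.k.trans h.k, h'.settled.trans h.settled,
    fun v hv => ?_, fun v hv hl => ?_, fun v hv hl => ?_⟩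
  · obtain ⟨h1, h2⟩ := h.le v hv
    obtain ⟨h3, h4⟩ := h'.le v h1
    exact ⟨h3, h4.trans h2⟩
  · obtain ⟨h1, h2⟩ := h'.level v hv hl
    exact h.level v h1 h2
  · have := h.eq v hv hl
    rw [h'.eq v (h.le v hv).1 (by omega), this]

/-- Values up to the level `κ` are frozen and no new ones appear there, so the settled set does not
change while a vertex is treated. -/
theorem Improves.done (h : S.Improves κ s s') (v : Vertex) :
    S.Done κ P s' v ↔ S.Done κ P s v := by
  constructor
  · rintro ⟨h1, h2⟩
    obtain ⟨h3, h4⟩ := h.level v h1 (by omega)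
    rw [h.eq v h3 h4] at h2
    exact ⟨h3, h2⟩
  · rintro ⟨h1, h2⟩
    refine ⟨(h.le v h1).1, ?_⟩
    rw [h.eq v h1 (by omega)]
    exact h2

/-- The signed value written is `κ + 1`, because `S.σ * S.σ = 1`, and it replaces only a missing or
larger value. Thus nothing at or below the level `κ` is disturbed. -/
theorem relax_spec (hS : S.Valid R) (henv : Env R X₁ X₂ vs s) (h : S.Sound R src s) {v : Vertex}
    (hx : s.reg .x = v.1) (hy : s.reg .y = v.2) (hv : S.Has s v) (hκ : S.val s v = κ)
    (hk : S.σ * s.reg .k = κ) (i : Fin 3) :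
    Env R X₁ X₂ vs ((S.relax i).eval s) ∧ S.Sound R src ((S.relax i).eval s) ∧
      S.Improves κ s ((S.relax i).eval s) ∧ (S.edge v i ∈ edges R →
        S.Has ((S.relax i).eval s) (S.nbr v i) ∧ S.val ((S.relax i).eval s) (S.nbr v i) ≤ κ + 1) := by
  have hC : (S.C i).val s = count R (S.edge v i) := by
    rw [hS.C s v i hx hy, henv.cnt (S.edge v i).base]
  by_cases he : S.edge v i ∈ edges R
  · rw [relax, eval_when_pos (by simp [hC, count_pos, he])]
    set w := S.nbr v i with hw
    have hP := hS.P s v i hx hy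
    have hQ := hS.Q s v i hx hy
    have hT := hS.T s v i hx hy
    rw [hk] at hT
    simp only [eval_block_cons, eval_block_nil]
    by_cases hup : s.entry S.st w = 0 ∨ κ + 1 < S.val s w
    · rw [eval_when_pos (by
        rw [holds_or, hT, holds_eq, val_get, hP, hQ]
        exact hup)]
      set t := (s.setTab S.st w.1 w.2 0 1).setTab S.vt w.1 w.2 0 (s.reg .k + S.σ) with ht
      have hs' : (block [.store S.st (S.P i) (S.Q i) 0 1,
          .store S.vt (S.P i) (S.Q i) 0 S.E]).eval s = t := by
        simp only [eval_block_cons, eval_block_nil, eval_store, hP, hQ, val_zero, val_one, hS.E]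
        rw [hS.P (s.setTab S.st w.1 w.2 0 1) v i hx hy, hS.Q (s.setTab S.st w.1 w.2 0 1) v i hx hy]
        rfl
      rw [hs']
      have hne : ∀ u : Vertex, u ≠ w → ¬ (u.1 = w.1 ∧ u.2 = w.2) :=
        fun u hu h => hu (Prod.ext h.1 h.2)
      have hst : ∀ u, t.entry S.st u = if u = w then 1 else s.entry S.st u := by
        intro u
        by_cases hu : u = w
        · subst hu; simp [ht, State.entry, hS.tab.1]
        · simp [ht, State.entry, hS.tab.1, hu, hne u hu]
      have hhas : ∀ u, S.Has t u ↔ S.Has s u ∨ u = w := by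
        intro u
        unfold Has
        rw [hst]
        split_ifs with h <;> simp [h]
      have hval : ∀ u, S.val t u = if u = w then κ + 1 else S.val s u := by
        intro u
        by_cases hu : u = w
        · subst hu
          have : t.entry S.vt w = s.reg .k + S.σ := by simp [ht, State.entry]
          rw [val, this, if_pos rfl, mul_add, hk, hS.sign]
        · simp [val, ht, State.entry, hS.tab.1.symm, hu, hne u hu]
      have hnot : S.Has s w → κ + 1 < S.val s w := by
        intro h
        rcases hup with h0 | h1
        · rw [Has, h0] at h; simp at h
        · exact h1
      refine ⟨?_, ⟨fun u => ?_, fun u hu => ?_, fun u hu => ?_, fun u m hm => ?_⟩,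
        ⟨rfl, rfl, rfl, rfl, fun u hu => ?_, fun u hu hl => ?_, fun u hu hl => ?_⟩,
        fun _ => ⟨(hhas w).2 (.inr rfl), by rw [hval, if_pos rfl]⟩⟩
      · have := hS.tab.2
        refine henv.congr rfl ?_ ?_ ?_ ?_ <;>
          simp [ht, (this .vtx (by simp)).1, (this .vtx (by simp)).2, (this .cnt (by simp)).1,
            (this .cnt (by simp)).2, (this .con1 (by simp)).1, (this .con1 (by simp)).2,
            (this .con2 (by simp)).1, (this .con2 (by simp)).2]
      · by_cases hu : u = w
        · exact .inr ((hhas u).2 (.inr hu))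
        · refine (h.has u).imp (fun h => ?_) fun h => (hhas u).2 (.inl h)
          rw [hst, if_neg hu, h]
      · rcases (hhas u).1 hu with hu | rfl
        · exact h.mem u hu
        · exact hS.nbr v i he
      · rw [hval]
        split_ifs with huw
        · subst huw
          have := h.dist v hv
          rw [hκ] at this
          exact .step v κ i this he
        · exact h.dist u (((hhas u).1 hu).resolve_right huw)
      · obtain ⟨h1, h2⟩ := h.src u m hm
        refine ⟨(hhas u).2 (.inl h1), ?_⟩
        rw [hval]
        split_ifs with huw
        · subst huw
          have := hnot h1
          omega
        · exact h2
      · refine ⟨(hhas u).2 (.inl hu), ?_⟩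
        rw [hval]
        split_ifs with huw
        · subst huw
          exact (hnot hu).le
        · exact le_rfl
      · rw [hval] at hl
        split_ifs at hl with huw
        · omega
        · exact ⟨((hhas u).1 hu).resolve_right huw, hl⟩
      · rw [hval]
        split_ifs with huw
        · subst huw
          have := hnot hu
          omega
        · rfl
    · rw [eval_when_neg (by
        rw [holds_or, hT, holds_eq, val_get, hP, hQ]
        exact hup)]
      rw [not_or, not_lt] at hup
      exact ⟨henv, h, .refl S κ s, fun _ => ⟨(h.has w).resolve_left hup.1, hup.2⟩⟩
  · rw [relax, eval_when_neg (by simp [hC, count_pos, he])]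
    exact ⟨henv, h, .refl S κ s, fun h => absurd h he⟩

open Classical in
/-- The invariants of the search at the level `κ`, when the vertices in `P` have been treated. -/
structure Inv (S : Search) (R : Finset Tri) (X₁ X₂ : Finset Edge) (vs : List Vertex)
    (src : Vertex → ℤ → Prop) (κ : ℤ) (P : Finset Vertex) (s : State) : Prop where
  env : Env R X₁ X₂ vs s
  sound : S.Sound R src s
  level : S.σ * s.reg .k = κ
  closed : ∀ v, S.Done κ P s v → ∀ i, S.edge v i ∈ edges R →
    S.Has s (S.nbr v i) ∧ S.val s (S.nbr v i) ≤ S.val s v + 1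
  settled : s.reg .settled = (((verts R).filter (S.Done κ P s)).card : ℤ)

/-- Among the settled vertices only `v` can be new, and it is so exactly when its value equals the
current level. In that case the counter increases by one and the three neighbours are relaxed. -/
theorem Inv.body (hS : S.Valid R) (h : S.Inv R X₁ X₂ vs src κ P s) {v : Vertex} (hvR : v ∈ verts R)
    (hvP : v ∉ P) (hx : s.reg .x = v.1) (hy : s.reg .y = v.2) :
    S.Inv R X₁ X₂ vs src κ (insert v P) ((block S.body).eval s) := by
  classical
  have hσ : S.σ ≠ 0 := by
    have := hS.sign
    rintro h0
    rw [h0] at this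
    simp at this
  have hkey : (S.Has s v ∧ S.val s v = κ) ↔
      (Test.and (.eq (.get S.st Reg.x Reg.y 0) 1) (.eq (.get S.vt Reg.x Reg.y 0) Reg.k)).holds s := by
    simp only [holds_and, holds_eq, val_get, val_reg, val_zero, val_one, hx, hy]
    refine and_congr Iff.rfl ?_
    rw [val, ← h.level]
    exact mul_right_inj' hσ
  by_cases hv : S.Has s v ∧ S.val s v = κ
  · have heval : (block S.body).eval s =
        (forDirs S.relax).eval (s.setReg .settled (s.reg .settled + 1)) := by
      simp only [Search.body, eval_block_cons, eval_block_nil]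
      rw [eval_when_pos (hkey.1 hv)]
      rfl
    set s₁ := s.setReg .settled (s.reg .settled + 1) with hs₁
    obtain ⟨hv, hκ⟩ := hv
    have key := forDirs_induction (s := s₁) (f := S.relax) (fun m t => Env R X₁ X₂ vs t ∧
      S.Sound R src t ∧ S.Improves κ s₁ t ∧ ∀ i : Fin 3, (i : ℕ) < m → S.edge v i ∈ edges R →
        S.Has t (S.nbr v i) ∧ S.val t (S.nbr v i) ≤ κ + 1) (by
      rintro i t ⟨h1, h2, h3, h4⟩
      have hκt : S.val t v = κ := (h3.eq v hv hκ.le).trans hκ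
      obtain ⟨a1, a2, a3, a4⟩ := relax_spec hS h1 h2 (by rw [h3.x]; simpa [hs₁] using hx)
        (by rw [h3.y]; simpa [hs₁] using hy) (h3.le v hv).1 hκt
        (by rw [h3.k]; simpa [hs₁] using h.level) i
      refine ⟨a1, a2, h3.trans a3, fun i' hi' he => ?_⟩
      by_cases hii : i' = i
      · rw [hii] at he ⊢
        exact a4 he
      · have := Fin.val_ne_of_ne hii
        obtain ⟨b1, b2⟩ := h4 i' (by omega) he
        obtain ⟨b3, b4⟩ := a3.le _ b1
        exact ⟨b3, b4.trans b2⟩)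
      ⟨h.env.congr (by simp [hs₁]) rfl rfl rfl rfl, h.sound.setReg _ _, .refl S κ s₁, by simp⟩
    obtain ⟨h1, h2, h3, h4⟩ := key
    rw [heval]
    have hdone : ∀ w, S.Done κ (insert v P) s w ↔ S.Done κ P s w ∨ w = v := by
      intro w
      unfold Done
      rw [Finset.mem_insert]
      constructor
      · rintro ⟨a, b | ⟨b, rfl | c⟩⟩
        exacts [.inl ⟨a, .inl b⟩, .inr rfl, .inl ⟨a, .inr ⟨b, c⟩⟩]
      · rintro (⟨a, b | ⟨b, c⟩⟩ | rfl)
        exacts [⟨a, .inl b⟩, ⟨a, .inr ⟨b, .inr c⟩⟩, ⟨hv, .inr ⟨hκ, .inl rfl⟩⟩]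
    refine ⟨h1, h2, by rw [h3.k]; simpa [hs₁] using h.level, fun w hw i hi => ?_, ?_⟩
    · have hws : S.Done κ (insert v P) s w := (h3.done w).1 hw
      have hwv : S.val ((forDirs S.relax).eval s₁) w = S.val s w :=
        h3.eq w hws.1 (by have := hws.2; change S.val s w ≤ κ; omega)
      rw [hwv]
      rcases (hdone w).1 hws with hwd | rfl
      · obtain ⟨b1, b2⟩ := h.closed w hwd i hi
        obtain ⟨b3, b4⟩ := h3.le _ b1
        exact ⟨b3, b4.trans b2⟩
      · rw [hκ]
        exact h4 i i.2 hi
    · rw [h3.settled]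
      have : (verts R).filter (S.Done κ (insert v P) ((forDirs S.relax).eval s₁)) =
          insert v ((verts R).filter (S.Done κ P s)) := by
        ext w
        have := (h3.done (P := insert v P) w).trans (hdone w)
        simp only [Finset.mem_filter, Finset.mem_insert, this]
        constructor
        · rintro ⟨a, b | b⟩
          exacts [.inr ⟨a, b⟩, .inl b]
        · rintro (rfl | ⟨a, b⟩)
          exacts [⟨hvR, .inr rfl⟩, ⟨a, .inl b⟩]
      rw [this, Finset.card_insert_of_notMem]
      · simp [hs₁, h.settled]
      · simp only [Finset.mem_filter, not_and]
        rintro - ⟨-, b | b⟩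
        · omega
        · exact hvP b.2
  · have heval : (block S.body).eval s = s := by
      simp only [Search.body, eval_block_cons, eval_block_nil]
      rw [eval_when_neg (mt hkey.2 hv)]
    rw [heval]
    have hdone : ∀ w, S.Done κ (insert v P) s w ↔ S.Done κ P s w := by
      intro w
      unfold Done
      rw [Finset.mem_insert]
      constructor
      · rintro ⟨a, b | ⟨b, rfl | c⟩⟩
        exacts [⟨a, .inl b⟩, absurd ⟨a, b⟩ hv, ⟨a, .inr ⟨b, c⟩⟩]
      · rintro ⟨a, b | ⟨b, c⟩⟩
        exacts [⟨a, .inl b⟩, ⟨a, .inr ⟨b, .inr c⟩⟩]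
    refine ⟨h.env, h.sound, h.level, fun w hw => h.closed w ((hdone w).1 hw), ?_⟩
    rw [h.settled]
    congr 2
    ext w
    simp [hdone]

theorem Inv.setReg (h : S.Inv R X₁ X₂ vs src κ P s) {r : Reg} {n : ℤ}
    (hr : r = .j ∨ r = .x ∨ r = .y) : S.Inv R X₁ X₂ vs src κ P (s.setReg r n) := by
  have hne : r ≠ .nV ∧ r ≠ .k ∧ r ≠ .settled := by rcases hr with rfl | rfl | rfl <;> simp
  exact ⟨h.env.congr (by simp [hne.1.symm]) rfl rfl rfl rfl, h.sound.setReg _ _,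
    by simpa [hne.2.1.symm] using h.level, h.closed, by
      rw [State.setReg_reg, if_neg hne.2.2.symm]
      exact h.settled⟩

/-- After a full scan every vertex of value at most `κ` is settled, which is the same as being
settled for the next level before its scan. -/
theorem Inv.next (hS : S.Valid R) (h : S.Inv R X₁ X₂ vs src κ (verts R) s) :
    S.Inv R X₁ X₂ vs src (κ + 1) ∅ (s.setReg .k (s.reg .k + S.σ)) := by
  classical
  have hdone : ∀ v, S.Done (κ + 1) ∅ (s.setReg .k (s.reg .k + S.σ)) v ↔
      S.Done κ (verts R) s v := by
    intro v
    constructor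
    · rintro ⟨a, b | ⟨b, c⟩⟩
      · refine ⟨a, ?_⟩
        have hmem := h.sound.mem v a
        change S.val s v < κ + 1 at b
        by_cases hb : S.val s v < κ
        exacts [.inl hb, .inr ⟨by omega, hmem⟩]
      · simp at c
    · rintro ⟨a, b⟩
      refine ⟨a, .inl ?_⟩
      change S.val s v < κ + 1
      omega
  refine ⟨h.env.congr (by simp) rfl rfl rfl rfl, h.sound.setReg _ _, ?_,
    fun w hw => h.closed w ((hdone w).1 hw), ?_⟩
  · simp [mul_add, h.level, hS.sign]
  · have := h.settled
    simp only [State.setReg_reg, reduceCtorEq, if_false, this]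
    congr 2
    ext w
    simp [hdone]

/-- Induction along the path: each earlier vertex has a value below `κ`, so it is settled and has
relaxed its successor. -/
theorem Inv.has_of_dist (h : S.Inv R X₁ X₂ vs src κ ∅ s) {v : Vertex} {m : ℤ}
    (hd : Dist src S.nbr (fun v i => S.edge v i ∈ edges R) v m) (hm : m < κ) :
    S.Has s v ∧ S.val s v ≤ m := by
  induction hd with
  | src v m hs => exact h.sound.src v m hs
  | step v m i _ ha ih =>
    obtain ⟨h1, h2⟩ := ih (by omega)
    obtain ⟨h3, h4⟩ := h.closed v ⟨h1, .inl (by omega)⟩ i ha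
    exact ⟨h3, by omega⟩

/-- The time for one vertex at one level. -/
def time (S : Search) : ℕ := (block S.body).bound + S.E.cost + 100

/-- No value lies below the starting level and every vertex has a distance at most `M`, so the
number of levels is governed by `M` minus the starting level, each costing one scan of the vertices.
At the end all vertices are settled, hence the values are closed under relaxation and minimal. -/
theorem exec (hS : S.Valid R) (henv : Env R X₁ X₂ vs s) (h : S.Sound R src s) {r : Reg}
    (hr : ∀ v, S.Has s v → S.σ * s.reg r ≤ S.val s v) {M : ℤ}
    (hM : ∀ v ∈ verts R, ∃ m ≤ M, Dist src S.nbr (fun v i => S.edge v i ∈ edges R) v m) :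
    ∃ n s', n ≤ ((M + 1 - S.σ * s.reg r).toNat + 2) * ((vs.length + 2) * S.time) ∧
      Exec (S.cmd r) s n s' ∧ ∀ v ∈ verts R,
        Dist src S.nbr (fun v i => S.edge v i ∈ edges R) v (S.val s' v) ∧
        ∀ m, Dist src S.nbr (fun v i => S.edge v i ∈ edges R) v m → S.val s' v ≤ m := by
  classical
  set κ₀ := S.σ * s.reg r with hκ₀
  set s₁ := (s.setReg .k (s.reg r)).setReg .settled 0 with hs₁
  have i₁ : S.Inv R X₁ X₂ vs src κ₀ ∅ s₁ := by
    have hno : ∀ v, ¬ S.Done κ₀ ∅ s₁ v := by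
      rintro v ⟨a, b | ⟨-, b⟩⟩
      · have := hr v a
        change S.val s v < κ₀ at b
        omega
      · simp at b
    refine ⟨henv.congr (by simp [hs₁]) rfl rfl rfl rfl, (h.setReg _ _).setReg _ _, by simp [hs₁, hκ₀],
      fun v hv => absurd hv (hno v), ?_⟩
    rw [Finset.filter_eq_empty_iff.2 fun v _ => hno v]
    simp [hs₁]
  obtain ⟨n, s', hn, he, ⟨κ, hi⟩, hp⟩ := exec_loop (p := .lt Reg.settled Reg.nV)
    (c := block [forEach .nV (fetch :: S.body), .set .k S.E])
    (fun s => ∃ κ, S.Inv R X₁ X₂ vs src κ ∅ s) (fun s => (M + 1 - S.σ * s.reg .k).toNat)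
    ((vs.length + 1) * ((block S.body).bound + 40) + S.E.cost + 2) (by
      rintro s ⟨κ, hi⟩ hp
      -- Beyond the level `M` all vertices are settled, so the test of the loop fails.
      have hκM : κ ≤ M := by
        by_contra! hlt
        have : (verts R).filter (S.Done κ ∅ s) = verts R := by
          refine Finset.filter_true_of_mem fun v hv => ?_
          obtain ⟨m, hm, hd⟩ := hM v hv
          obtain ⟨h1, h2⟩ := hi.has_of_dist hd (by omega)
          exact ⟨h1, .inl (by omega)⟩
        have h2 := hi.settled
        rw [this] at h2
        simp [h2, hi.env.listed.len, hi.env.length] at hp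
      obtain ⟨n, s', hn, he, hI⟩ := exec_forVerts (cs := S.body) rfl rfl rfl
        (by simp [Search.body, relax, Cmd.modTab, block, when, forDirs,
          (hS.tab.2 .vtx (by simp)).1, (hS.tab.2 .vtx (by simp)).2])
        hi.env.nodup hi.env.listed (S.Inv R X₁ X₂ vs src κ)
        (fun P s r n hr h => h.setReg hr) hi
        (fun P v s hv hvP hx hy h => h.body hS ((h.env.mem v).1 hv) hvP hx hy)
      rw [hi.env.toFinset] at hI
      refine ⟨_, _, ?_, .seq he (.seq (.set _ _ _) (.skip _)), ⟨κ + 1, ?_⟩, ?_⟩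
      · omega
      · rw [hS.E]
        exact hI.next hS
      · have h1 := hI.level
        have h2 := hi.level
        rw [hS.E]
        simp only [State.setReg_reg, if_true, mul_add, h1, h2, hS.sign]
        omega) s₁ ⟨κ₀, i₁⟩
  refine ⟨_, s', ?_, .seq (.set .k r s) (.seq (.set .settled 0 _) (.seq he (.skip _))), ?_⟩
  · have hk : s₁.reg .k = s.reg r := by simp [hs₁]
    simp only [hk, ← hκ₀, cost_lt, cost_reg, cost_zero] at hn ⊢
    have : 1 + 1 + 1 + 1 + ((vs.length + 1) * ((block S.body).bound + 40) + S.E.cost + 2) ≤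
        (vs.length + 1) * S.time := by
      unfold time
      nlinarith
    have h2 := hn.trans (Nat.mul_le_mul_left _ this)
    have h3 : 100 ≤ S.time := by unfold time; omega
    generalize (M + 1 - κ₀).toNat = a at *
    nlinarith
  · have hall : ∀ v ∈ verts R, S.Done κ ∅ s' v := by
      -- The loop stops only when the counter has reached the number of vertices; a subset of full
      -- cardinality is everything.
      have hc : (verts R).card ≤ ((verts R).filter (S.Done κ ∅ s')).card := by
        have h2 := hi.settled
        simp only [holds_lt, val_reg, hi.env.listed.len, hi.env.length] at hp
        omega
      have := Finset.eq_of_subset_of_card_le (Finset.filter_subset _ _) hc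
      intro v hv
      rw [← this] at hv
      exact (Finset.mem_filter.1 hv).2
    intro v hv
    refine ⟨hi.sound.dist v (hall v hv).1, fun m hm => ?_⟩
    have : ∀ v m, Dist src S.nbr (fun v i => S.edge v i ∈ edges R) v m →
        S.Has s' v ∧ S.val s' v ≤ m := by
      intro v m hd
      induction hd with
      | src v m hs => exact hi.sound.src v m hs
      | step v m i _ ha ih =>
        obtain ⟨h3, h4⟩ := hi.closed v (hall v (hi.sound.mem v ih.1)) i ha
        exact ⟨h3, by omega⟩
    exact (this v m hm).2

end

end Search

/-! ## The first step -/

/-- The search that computes the lower cut. -/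
def lowerSearch : Search where
  st := .lset
  vt := .low
  σ := -1
  nbr v i := v - vec i
  edge v i := ⟨v - vec i, i⟩
  C i := .get .cnt (Reg.x - dx i) (Reg.y - dy i) (lit i)
  P i := Reg.x - dx i
  Q i := Reg.y - dy i
  T i := .lt (.get .low (Reg.x - dx i) (Reg.y - dy i) 0) (Reg.k - 1)
  E := Reg.k - 1

/-- The search that computes the upper cut. -/
def upperSearch : Search where
  st := .uset
  vt := .upp
  σ := 1
  nbr v i := v + vec i
  edge v i := ⟨v, i⟩
  C i := .get .cnt Reg.x Reg.y (lit i)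
  P i := Reg.x + dx i
  Q i := Reg.y + dy i
  T i := .lt (Reg.k + 1) (.get .upp (Reg.x + dx i) (Reg.y + dy i) 0)
  E := Reg.k + 1

theorem lowerSearch_valid (R : Finset Tri) : lowerSearch.Valid R where
  tab := by simp [lowerSearch]
  sign := rfl
  nbr v i h := base_mem_verts h
  C s v i hx hy := by simp [lowerSearch, hx, hy]
  P s v i hx hy := by simp [lowerSearch, hx]
  Q s v i hx hy := by simp [lowerSearch, hy]
  T s v i hx hy := by
    simp only [lowerSearch, holds_lt, val_get, val_sub, val_reg, val_one, val_zero, val_dx, val_dy,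
      hx, hy, State.entry, Prod.fst_sub, Prod.snd_sub]
    omega
  E s := rfl

theorem upperSearch_valid (R : Finset Tri) : upperSearch.Valid R where
  tab := by simp [upperSearch]
  sign := rfl
  nbr v i h := tip_mem_verts h
  C s v i hx hy := by simp [upperSearch, hx, hy]
  P s v i hx hy := by simp [upperSearch, hx]
  Q s v i hx hy := by simp [upperSearch, hy]
  T s v i hx hy := by simp [upperSearch, hx, hy, State.entry]
  E s := rfl

/-- The program text unfolds to an instance of the generic search. The sign `-1` turns the
maximization of heights into a minimization. -/
theorem lowerCut_eq : lowerCut = lowerSearch.cmd .hi := rfl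

theorem upperCut_eq : upperCut = upperSearch.cmd .lo := rfl

section
variable {R : Finset Tri} {X₁ X₂ : Finset Edge} {vs : List Vertex} {s s' : State}
  {h : Vertex → ℤ}

/-! ### Distances from the lifted boundary -/

/-- Descending distances from the boundary. -/
abbrev LowDist (R : Finset Tri) (h : Vertex → ℤ) : Vertex → ℤ → Prop :=
  Dist (fun v m => v ∈ boundaryVerts R ∧ m = -h v) lowerSearch.nbr
    (fun v i => lowerSearch.edge v i ∈ edges R)

/-- Ascending distances from the boundary. -/
abbrev UppDist (R : Finset Tri) (h : Vertex → ℤ) : Vertex → ℤ → Prop :=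
  Dist (fun v m => v ∈ boundaryVerts R ∧ m = h v) upperSearch.nbr
    (fun v i => upperSearch.edge v i ∈ edges R)

/-- The lift of the boundary given by the heights of its vertices. -/
def liftOf (R : Finset Tri) (h : Vertex → ℤ) : Set Cube :=
  {c | proj c ∈ boundaryVerts R ∧ height c = h (proj c)}

theorem isBoundaryLift_liftOf (hl : ∀ v ∈ boundaryVerts R, IsCubeHeight v (h v))
    (hs : ∀ e ∈ boundary R, h e.tip = h e.base + 1) : IsBoundaryLift R (liftOf R h) := by
  refine ⟨⟨fun c hc => hc.1, fun c hc c' hc' hp => cube_ext hp ?_, fun v hv => ?_⟩,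
    fun c hc i hi => ⟨?_, ?_⟩⟩
  · rw [hc.2, hc'.2, hp]
  · obtain ⟨c, rfl, hh⟩ := exists_cube (hl v hv)
    exact ⟨c, ⟨hv, hh⟩, rfl⟩
  · rw [proj_add_unit]
    exact mem_boundaryVerts.2 ⟨_, hi, .inr rfl⟩
  · rw [proj_add_unit, height_add_unit, hc.2]
    exact (hs _ hi).symm

theorem LowDist.isCubeHeight (hl : ∀ v ∈ boundaryVerts R, IsCubeHeight v (h v)) {v : Vertex} {m : ℤ}
    (hd : LowDist R h v m) : IsCubeHeight v (-m) := by
  induction hd with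
  | src v m hs => rw [hs.2, neg_neg]; exact hl v hs.1
  | step v m i _ ha ih => rw [neg_add]; exact ih.sub_vec i

/-- A function that rises by at most 1 along edges falls by at most 1 at each backward step. This
makes the lower cut a lower bound for all such functions above the boundary heights. -/
theorem LowDist.le {H : Vertex → ℤ} (hb : ∀ v ∈ boundaryVerts R, h v ≤ H v)
    (hH : ∀ e ∈ edges R, H e.tip ≤ H e.base + 1) {v : Vertex} {m : ℤ} (hd : LowDist R h v m) :
    -m ≤ H v := by
  induction hd with
  | src v m hs => rw [hs.2, neg_neg]; exact hb v hs.1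
  | step v m i _ ha ih =>
    have := hH _ ha
    simp only [lowerSearch, Edge.tip, sub_add_cancel] at this ⊢
    omega

theorem UppDist.le {H : Vertex → ℤ} (hb : ∀ v ∈ boundaryVerts R, H v ≤ h v)
    (hH : ∀ e ∈ edges R, H e.tip ≤ H e.base + 1) {v : Vertex} {m : ℤ} (hd : UppDist R h v m) :
    H v ≤ m := by
  induction hd with
  | src v m hs => rw [hs.2]; exact hb v hs.1
  | step v m i _ ha ih =>
    have := hH _ ha
    simp only [upperSearch, Edge.tip] at this ⊢
    omega

/-- The path that realizes the distance lifts to ascending arcs; at the boundary the remaining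
height is gained over a single vertex. -/
theorem LowDist.reaches (hl : ∀ v ∈ boundaryVerts R, IsCubeHeight v (h v)) {v : Vertex} {m : ℤ}
    (hd : LowDist R h v m) {c : Cube} (hc : proj c = v) (hm : height c ≤ -m) :
    ∃ c' ∈ liftOf R h, Reaches R ∅ ∅ c c' := by
  induction hd generalizing c with
  | src v m hs =>
    obtain ⟨c', h1, h2⟩ := exists_cube (hl v hs.1)
    refine ⟨c', ⟨h1.symm ▸ hs.1, by rw [h2, h1]⟩, reaches_of_height_le ?_ (hc.trans h1.symm) ?_⟩
    · change proj c ∈ verts R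
      exact hc.symm ▸ boundaryVerts_subset hs.1
    · rw [h2]
      have := hs.2
      omega
  | step v m i _ ha ih =>
    simp only [lowerSearch] at ha hc
    have h1 : proj (c + unit i) = v := by rw [proj_add_unit, hc, sub_add_cancel]
    obtain ⟨c', h2, h3⟩ := ih h1 (by rw [height_add_unit]; omega)
    exact ⟨c', h2, .head (.up c i (by rwa [hc])) h3⟩

theorem UppDist.reaches (hl : ∀ v ∈ boundaryVerts R, IsCubeHeight v (h v)) {v : Vertex} {m : ℤ}
    (hd : UppDist R h v m) {c : Cube} (hc : proj c = v) (hm : m < height c) :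
    ∃ c' ∈ liftOf R h, Reaches R ∅ ∅ (c' + (1, 1, 1)) c := by
  induction hd generalizing c with
  | src v m hs =>
    obtain ⟨c', h1, h2⟩ := exists_cube (hl v hs.1)
    have h3 : proj (c' + (1, 1, 1)) = v := by
      rw [← h1]
      obtain ⟨x, y, z⟩ := c'
      simp [proj]
    have h4 : height (c' + (1, 1, 1)) = h v + 3 := by
      rw [← h2]
      obtain ⟨x, y, z⟩ := c'
      simp [height]; ring
    refine ⟨c', ⟨h1.symm ▸ hs.1, by rw [h2, h1]⟩, reaches_of_height_le ?_ (h3.trans hc.symm) ?_⟩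
    · change proj _ ∈ verts R
      exact h3.symm ▸ boundaryVerts_subset hs.1
    · rw [h4]
      -- The next cube above height `h v` has height `h v + 3`, which is why the upper cut starts
      -- from the lift translated by `(1, 1, 1)`.
      refine (hl v hs.1).le_of_lt (hc ▸ Calisson.isCubeHeight c) ?_
      have := hs.2
      omega
  | step v m i _ ha ih =>
    simp only [upperSearch] at ha hc
    have h1 : proj (c - unit i) = v := by rw [proj_sub_unit, hc, add_sub_cancel_right]
    obtain ⟨c', h2, h3⟩ := ih h1 (by rw [height_sub_unit]; omega)
    refine ⟨c', h2, h3.tail ?_⟩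
    have := Arc.up (R := R) (X₁ := ∅) (X₂ := ∅) (c - unit i) i (by rwa [h1])
    rwa [sub_add_cancel] at this

/-- The horizontal ray of `exists_near_boundary`, followed backwards from its boundary end, is a
path of at most as many steps as there are boundary vertices. -/
theorem exists_lowDist {lo : ℤ} (hlo : ∀ v ∈ boundaryVerts R, lo ≤ h v) {v : Vertex}
    (hv : v ∈ verts R) : ∃ m ≤ -lo + (boundaryVerts R).card, LowDist R h v m := by
  obtain ⟨n, hn, hb, hm⟩ := exists_near_boundary hv (.inl rfl) (σ := 1)
  have key : ∀ k ≤ n, LowDist R h (v + (1 * ((n - k : ℕ) : ℤ)) • vec 0)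
      (-h (v + (1 * (n : ℤ)) • vec 0) + k) := by
    intro k
    induction k with
    | zero => intro _; exact .src _ _ ⟨by simpa using hb, by simp⟩
    | succ k ih =>
      intro hk
      have h1 := ih (by omega)
      obtain ⟨h2, h3⟩ := hm (n - (k + 1)) (by omega)
      have he := (interior_star h2 h3 0).1
      have heq : v + (1 * ((n - (k + 1) : ℕ) : ℤ)) • vec 0 =
          v + (1 * ((n - k : ℕ) : ℤ)) • vec 0 - vec 0 := by
        have : ((n - k : ℕ) : ℤ) = ((n - (k + 1) : ℕ) : ℤ) + 1 := by omega
        rw [this, one_mul, one_mul, add_smul, one_smul]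
        abel
      rw [heq] at he ⊢
      have := Dist.step _ _ (0 : Fin 3) h1 he
      push_cast
      rwa [add_assoc] at this
  have h1 := key n le_rfl
  have h2 := hlo _ hb
  refine ⟨_, ?_, by simpa using h1⟩
  simp at h2 ⊢
  omega

theorem exists_uppDist {hi : ℤ} (hhi : ∀ v ∈ boundaryVerts R, h v ≤ hi) {v : Vertex}
    (hv : v ∈ verts R) : ∃ m ≤ hi + (boundaryVerts R).card, UppDist R h v m := by
  obtain ⟨n, hn, hb, hm⟩ := exists_near_boundary hv (.inr rfl) (σ := -1)
  have key : ∀ k ≤ n, UppDist R h (v + (-1 * ((n - k : ℕ) : ℤ)) • vec 0)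
      (h (v + (-1 * (n : ℤ)) • vec 0) + k) := by
    intro k
    induction k with
    | zero => intro _; exact .src _ _ ⟨by simpa using hb, by simp⟩
    | succ k ih =>
      intro hk
      have h1 := ih (by omega)
      obtain ⟨h2, h3⟩ := hm (n - (k + 1)) (by omega)
      have he := (interior_star h2 h3 0).2
      have heq : v + (-1 * ((n - (k + 1) : ℕ) : ℤ)) • vec 0 =
          v + (-1 * ((n - k : ℕ) : ℤ)) • vec 0 + vec 0 := by
        have : ((n - k : ℕ) : ℤ) = ((n - (k + 1) : ℕ) : ℤ) + 1 := by omega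
        rw [this, neg_one_mul, neg_one_mul, neg_smul, neg_smul, add_smul, one_smul]
        abel
      rw [heq] at he ⊢
      rw [add_sub_cancel_right] at he
      have := Dist.step _ _ (0 : Fin 3) h1 he
      push_cast
      rwa [add_assoc] at this
  have h1 := key n le_rfl
  have h2 := hhi _ hb
  refine ⟨_, ?_, by simpa using h1⟩
  simp at h2 ⊢
  omega

/-! ### The initial tables -/

/-- The body of the loop that starts the tables of the cuts. -/
def initBody : List Cmd := [
  when (.eq (.get .bset Reg.x Reg.y 0) 1) [
    .set .k (.get .bh Reg.x Reg.y 0),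
    .store .lset Reg.x Reg.y 0 1, .store .low Reg.x Reg.y 0 Reg.k,
    .store .uset Reg.x Reg.y 0 1, .store .upp Reg.x Reg.y 0 Reg.k,
    when (.lt Reg.k Reg.lo) [.set .lo Reg.k],
    when (.lt Reg.hi Reg.k) [.set .hi Reg.k]]]

/-- The start of the searches, when the vertices in `P` have been treated. -/
structure Started (R : Finset Tri) (h : Vertex → ℤ) (P : Finset Vertex) (s : State) : Prop where
  bset : ∀ v, s.entry .bset v = 1 ↔ v ∈ boundaryVerts R
  bh : ∀ v, s.entry .bh v = h v
  lset : ∀ v, s.entry .lset v = if v ∈ P ∧ v ∈ boundaryVerts R then 1 else 0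
  low : ∀ v ∈ P, v ∈ boundaryVerts R → s.entry .low v = h v
  uset : ∀ v, s.entry .uset v = if v ∈ P ∧ v ∈ boundaryVerts R then 1 else 0
  upp : ∀ v ∈ P, v ∈ boundaryVerts R → s.entry .upp v = h v
  lo : (∃ v ∈ boundaryVerts R, h v = s.reg .lo) ∧ ∀ v ∈ P, v ∈ boundaryVerts R → s.reg .lo ≤ h v
  hi : (∃ v ∈ boundaryVerts R, h v = s.reg .hi) ∧ ∀ v ∈ P, v ∈ boundaryVerts R → h v ≤ s.reg .hi

theorem Started.body {P : Finset Vertex} (hI : Started R h P s) {v : Vertex} (hx : s.reg .x = v.1)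
    (hy : s.reg .y = v.2) : Started R h (insert v P) ((block initBody).eval s) := by
  have hbs : s.tab .bset v.1 v.2 0 = 1 ↔ v ∈ boundaryVerts R := hI.bset v
  by_cases hv : v ∈ boundaryVerts R
  · have hbh : s.tab .bh v.1 v.2 0 = h v := hI.bh v
    set t := (((((s.setReg .k (h v)).setTab .lset v.1 v.2 0 1).setTab .low v.1 v.2 0 (h v)).setTab
      .uset v.1 v.2 0 1).setTab .upp v.1 v.2 0 (h v)) with ht
    set t' := (block [when (.lt Reg.k Reg.lo) [.set .lo Reg.k],
      when (.lt Reg.hi Reg.k) [.set .hi Reg.k]]).eval t with ht'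
    have heval : (block initBody).eval s = t' := by
      simp only [initBody, eval_block_cons, eval_block_nil]
      rw [eval_when_pos (by simpa [hx, hy] using hbs.2 hv)]
      simp only [ht', ht, eval_block_cons, eval_block_nil, eval_set, eval_store, val_get, val_reg,
        val_zero, val_one, hx, hy, hbh, State.setReg_reg, State.setTab_reg, reduceCtorEq, if_false,
        if_true]
    have htab : t'.tab = t.tab := by
      funext u
      exact Cmd.eval_tab _ _ (by rfl)
    have hlo : t'.reg .lo = min (h v) (s.reg .lo) := by
      simp only [ht', eval_block_cons, eval_block_nil]
      rw [Cmd.eval_reg _ _ (by rfl)]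
      by_cases hc : h v < s.reg .lo
      · rw [eval_when_pos (by simpa [ht] using hc)]
        simp [ht, hc.le]
      · rw [eval_when_neg (by simpa [ht] using hc)]
        simp [ht, not_lt.1 hc]
    have hhi : t'.reg .hi = max (h v) (s.reg .hi) := by
      simp only [ht', eval_block_cons, eval_block_nil]
      generalize ht'' : (when (.lt Reg.k Reg.lo) [.set .lo Reg.k]).eval t = t''
      have h1 : t''.reg .hi = s.reg .hi := by
        rw [← ht'', Cmd.eval_reg _ _ (by rfl)]
        simp [ht]
      have h2 : t''.reg .k = h v := by
        rw [← ht'', Cmd.eval_reg _ _ (by rfl)]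
        simp [ht]
      by_cases hc : s.reg .hi < h v
      · rw [eval_when_pos (by simpa [h1, h2] using hc)]
        simp [h2, hc.le]
      · rw [eval_when_neg (by simpa [h1, h2] using hc)]
        simp [h1, not_lt.1 hc]
    have hne : ∀ u : Vertex, u ≠ v → ¬ (u.1 = v.1 ∧ u.2 = v.2) :=
      fun u hu h => hu (Prod.ext h.1 h.2)
    rw [heval]
    refine ⟨fun u => ?_, fun u => ?_, fun u => ?_, fun u hu hub => ?_, fun u => ?_,
      fun u hu hub => ?_, ⟨?_, fun u hu hub => ?_⟩, ⟨?_, fun u hu hub => ?_⟩⟩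
    · simpa [State.entry, htab, ht] using hI.bset u
    · simpa [State.entry, htab, ht] using hI.bh u
    · have := hI.lset u
      by_cases huv : u = v
      · subst huv; simp [State.entry, htab, ht, hv]
      · simpa [State.entry, htab, ht, huv, hne u huv] using this
    · by_cases huv : u = v
      · subst huv; simp [State.entry, htab, ht]
      · simpa [State.entry, htab, ht, huv, hne u huv] using
          hI.low u (Finset.mem_of_mem_insert_of_ne hu huv) hub
    · have := hI.uset u
      by_cases huv : u = v
      · subst huv; simp [State.entry, htab, ht, hv]
      · simpa [State.entry, htab, ht, huv, hne u huv] using this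
    · by_cases huv : u = v
      · subst huv; simp [State.entry, htab, ht]
      · simpa [State.entry, htab, ht, huv, hne u huv] using
          hI.upp u (Finset.mem_of_mem_insert_of_ne hu huv) hub
    · rw [hlo]
      rcases min_choice (h v) (s.reg .lo) with hc | hc <;> rw [hc]
      exacts [⟨v, hv, rfl⟩, hI.lo.1]
    · rw [hlo]
      rcases Finset.mem_insert.1 hu with rfl | hu
      exacts [min_le_left _ _, (min_le_right _ _).trans (hI.lo.2 u hu hub)]
    · rw [hhi]
      rcases max_choice (h v) (s.reg .hi) with hc | hc <;> rw [hc]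
      exacts [⟨v, hv, rfl⟩, hI.hi.1]
    · rw [hhi]
      rcases Finset.mem_insert.1 hu with rfl | hu
      exacts [le_max_left _ _, (hI.hi.2 u hu hub).trans (le_max_right _ _)]
  · have heval : (block initBody).eval s = s := by
      simp only [initBody, eval_block_cons, eval_block_nil]
      rw [eval_when_neg (by simpa [hx, hy, hbs] using hv)]
    rw [heval]
    have hand : ∀ u, u ∈ insert v P ∧ u ∈ boundaryVerts R ↔ u ∈ P ∧ u ∈ boundaryVerts R := by
      intro u
      rw [Finset.mem_insert]
      constructor
      · rintro ⟨rfl | h1, h2⟩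
        exacts [absurd h2 hv, ⟨h1, h2⟩]
      · exact fun h => ⟨.inr h.1, h.2⟩
    have hP : ∀ u ∈ insert v P, u ∈ boundaryVerts R → u ∈ P := fun u h1 h2 => ((hand u).1 ⟨h1, h2⟩).1
    exact ⟨hI.bset, hI.bh, fun u => by rw [hI.lset u]; simp only [hand],
      fun u hu hub => hI.low u (hP u hu hub) hub, fun u => by rw [hI.uset u]; simp only [hand],
      fun u hu hub => hI.upp u (hP u hu hub) hub,
      ⟨hI.lo.1, fun u hu hub => hI.lo.2 u (hP u hu hub) hub⟩,
      ⟨hI.hi.1, fun u hu hub => hI.hi.2 u (hP u hu hub) hub⟩⟩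

theorem Started.setReg {P : Finset Vertex} (hI : Started R h P s) {r : Reg} {n : ℤ}
    (hr : r = .j ∨ r = .x ∨ r = .y) : Started R h P (s.setReg r n) := by
  have h1 : Reg.lo ≠ r ∧ Reg.hi ≠ r := by rcases hr with rfl | rfl | rfl <;> simp
  exact ⟨hI.bset, hI.bh, hI.lset, hI.low, hI.uset, hI.upp, by simpa [h1.1] using hI.lo,
    by simpa [h1.2] using hI.hi⟩

theorem exec_initCuts (henv : Env R X₁ X₂ vs s) (hL : Lifted R s)
    (hl : ∀ v, s.entry .lset v = 0) (hu : ∀ v, s.entry .uset v = 0) :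
    ∃ n s', n ≤ (vs.length + 2) * ((block initBody).bound + 40) ∧ Exec initCuts s n s' ∧
      Started R (s.entry .bh) (verts R) s' := by
  have e₁ : Exec (.set .lo (Reg.a + Reg.b)) s _ (s.setReg .lo (s.reg .a + s.reg .b)) := .set _ _ _
  have e₂ : Exec (.set .hi (Reg.a + Reg.b)) (s.setReg .lo (s.reg .a + s.reg .b)) _
    ((s.setReg .lo (s.reg .a + s.reg .b)).setReg .hi (s.reg .a + s.reg .b)) := .set _ _ _
  set s₂ := (s.setReg .lo (s.reg .a + s.reg .b)).setReg .hi (s.reg .a + s.reg .b) with hs₂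
  obtain ⟨n, s', hn, he, hI⟩ := exec_forVerts (cs := initBody) rfl rfl rfl rfl henv.nodup
    (s := s₂) (henv.listed.congr (by simp [hs₂]) rfl) (Started R (s.entry .bh))
    (fun P s r n hr h => h.setReg hr)
    ⟨hL.bset, fun _ => rfl, fun v => (show s.entry .lset v = _ by simp [hl v]), by simp,
      fun v => (show s.entry .uset v = _ by simp [hu v]), by simp,
      -- The registers start with the height of the first boundary vertex, so the extremes are
      -- attained even before any vertex is scanned.
      ⟨⟨_, hL.start, by simpa [hs₂] using hL.start_height⟩, by simp⟩,
      ⟨⟨_, hL.start, by simpa [hs₂] using hL.start_height⟩, by simp⟩⟩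
    (fun P v s _ _ hx hy h => h.body hx hy)
  rw [henv.toFinset] at hI
  refine ⟨_, s', ?_, .seq e₁ (.seq e₂ (.seq he (.skip _))), hI⟩
  simp only [cost_add, cost_reg]
  nlinarith

/-! ### Shortcuts -/

/-- The body of the loop that searches shortcuts. -/
def shortcutBody : List Cmd := [
  when (.and (.eq (.get .bset Reg.x Reg.y 0) 1)
    (.not (.and (.eq (.get .low Reg.x Reg.y 0) (.get .bh Reg.x Reg.y 0))
      (.eq (.get .upp Reg.x Reg.y 0) (.get .bh Reg.x Reg.y 0))))) [.set .ok 0]]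

/-- No shortcut at a vertex. -/
def NoShortcut (s : State) (v : Vertex) : Prop :=
  s.entry .bset v = 1 → s.entry .low v = s.entry .bh v ∧ s.entry .upp v = s.entry .bh v

theorem exec_checkShortcuts (henv : Env R X₁ X₂ vs s) (hok : s.reg .ok = 1) :
    ∃ n s', n ≤ (vs.length + 1) * ((block shortcutBody).bound + 40) ∧
      Exec checkShortcuts s n s' ∧ (s'.reg .ok = 0 ∨ s'.reg .ok = 1) ∧
      (s'.reg .ok = 1 ↔ ∀ v ∈ verts R, NoShortcut s' v) := by
  obtain ⟨n, s', hn, he, h1, h2⟩ := exec_forVerts (cs := shortcutBody) rfl rfl rfl rfl henv.nodup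
    henv.listed
    (fun P s => (s.reg .ok = 0 ∨ s.reg .ok = 1) ∧ (s.reg .ok = 1 ↔ ∀ v ∈ P, NoShortcut s v))
    (fun P s r n hr hI => by
      have : Reg.ok ≠ r := by rcases hr with rfl | rfl | rfl <;> simp
      simp only [State.setReg_reg, if_neg this]
      exact hI)
    ⟨.inr hok, by simp [hok]⟩
    (fun P v s hv hvP hx hy hI => by
      have hkey : (Test.and (.eq (.get .bset Reg.x Reg.y 0) 1)
          (.not (.and (.eq (.get .low Reg.x Reg.y 0) (.get .bh Reg.x Reg.y 0))
          (.eq (.get .upp Reg.x Reg.y 0) (.get .bh Reg.x Reg.y 0))))).holds s ↔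
          ¬ NoShortcut s v := by
        simp [NoShortcut, State.entry, hx, hy]
      simp only [shortcutBody, eval_block_cons, eval_block_nil]
      by_cases hc : NoShortcut s v
      · rw [eval_when_neg (by rw [hkey, not_not]; exact hc)]
        refine ⟨hI.1, ?_⟩
        rw [hI.2, Finset.forall_mem_insert]
        exact ⟨fun h => ⟨hc, h⟩, fun h => h.2⟩
      · rw [eval_when_pos (hkey.2 hc)]
        simp only [eval_block_cons, eval_block_nil, eval_set, val_zero, State.setReg_reg, if_true]
        refine ⟨.inl trivial, ?_⟩
        simp only [zero_ne_one, false_iff]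
        exact fun h => hc (h v (Finset.mem_insert_self _ _)))
  rw [henv.toFinset] at h2
  exact ⟨n, s', hn, he, h1, h2⟩

/-! ### The result of the first step -/

/-- The memory contains the lower and the upper cut. -/
structure Cuts (R : Finset Tri) (s : State) : Prop where
  step : ∀ e ∈ boundary R, s.entry .bh e.tip = s.entry .bh e.base + 1
  lattice : ∀ v ∈ boundaryVerts R, IsCubeHeight v (s.entry .bh v)
  unique : ∃ u, ∀ H, BoundaryHeight R u H → ∀ v ∈ boundaryVerts R, s.entry .bh v = H v
  boundary : ∀ v ∈ boundaryVerts R,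
    s.entry .low v = s.entry .bh v ∧ s.entry .upp v = s.entry .bh v
  low : ∀ v ∈ verts R, LowDist R (s.entry .bh) v (-s.entry .low v) ∧
    ∀ m, LowDist R (s.entry .bh) v m → -s.entry .low v ≤ m
  upp : ∀ v ∈ verts R, UppDist R (s.entry .bh) v (s.entry .upp v) ∧
    ∀ m, UppDist R (s.entry .bh) v m → s.entry .upp v ≤ m
  bound : ∀ v ∈ verts R, s.entry .upp v - s.entry .low v ≤ 3 * (boundaryVerts R).card

theorem Cuts.congr (hC : Cuts R s) (h1 : s'.tab .bh = s.tab .bh) (h2 : s'.tab .low = s.tab .low)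
    (h3 : s'.tab .upp = s.tab .upp) : Cuts R s' := by
  have e1 : s'.entry .bh = s.entry .bh := by funext v; simp only [State.entry, h1]
  have e2 : s'.entry .low = s.entry .low := by funext v; simp only [State.entry, h2]
  have e3 : s'.entry .upp = s.entry .upp := by funext v; simp only [State.entry, h3]
  exact ⟨by rw [e1]; exact hC.step, by rw [e1]; exact hC.lattice, by rw [e1]; exact hC.unique,
    by rw [e1, e2, e3]; exact hC.boundary, by rw [e1, e2]; exact hC.low,
    by rw [e1, e3]; exact hC.upp, by rw [e2, e3]; exact hC.bound⟩

/-- Triangle inequality for the minimal distance, applied to one more backward step. -/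
theorem Cuts.low_edge (hC : Cuts R s) {e : Edge} (he : e ∈ edges R) :
    s.entry .low e.tip ≤ s.entry .low e.base + 1 := by
  have h1 := Dist.step _ _ e.dir (hC.low _ (tip_mem_verts he)).1
    (show lowerSearch.edge e.tip e.dir ∈ edges R by simpa [lowerSearch, Edge.tip] using he)
  have h2 : lowerSearch.nbr e.tip e.dir = e.base := by simp [lowerSearch, Edge.tip]
  rw [h2] at h1
  have := (hC.low _ (base_mem_verts he)).2 _ h1
  omega

theorem Cuts.upp_edge (hC : Cuts R s) {e : Edge} (he : e ∈ edges R) :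
    s.entry .upp e.tip ≤ s.entry .upp e.base + 1 :=
  (hC.upp _ (tip_mem_verts he)).2 _ (Dist.step _ _ e.dir (hC.upp _ (base_mem_verts he)).1 he)

theorem Cuts.low_le (hC : Cuts R s) {H : Vertex → ℤ}
    (hb : ∀ v ∈ boundaryVerts R, s.entry .bh v = H v)
    (hH : ∀ e ∈ edges R, H e.tip ≤ H e.base + 1) {v : Vertex} (hv : v ∈ verts R) :
    s.entry .low v ≤ H v := by
  have := LowDist.le (fun v hv => (hb v hv).le) hH (hC.low v hv).1
  omega

theorem Cuts.le_upp (hC : Cuts R s) {H : Vertex → ℤ}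
    (hb : ∀ v ∈ boundaryVerts R, s.entry .bh v = H v)
    (hH : ∀ e ∈ edges R, H e.tip ≤ H e.base + 1) {v : Vertex} (hv : v ∈ verts R) :
    H v ≤ s.entry .upp v :=
  UppDist.le (fun v hv => (hb v hv).ge) hH (hC.upp v hv).1

/-- The upper cut itself rises by at most 1 along edges and has the boundary heights, so minimality
of the lower cut applies to it. -/
theorem Cuts.low_le_upp (hC : Cuts R s) {v : Vertex} (hv : v ∈ verts R) :
    s.entry .low v ≤ s.entry .upp v :=
  hC.low_le (fun v hv => (hC.boundary v hv).2.symm) (fun _ he => hC.upp_edge he) hv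

theorem closed_of_boundary {H : Vertex → ℤ} (hb : ∀ e ∈ boundary R, H e.tip = H e.base + 1)
    (hH : ∀ e ∈ edges R, H e.tip ≤ H e.base + 1) : Closed R ∅ ∅ H := by
  intro v w δ hvw
  cases hvw with
  | up _ i he => have := hH _ he; simp only [Edge.tip] at this; omega
  | down _ i he hX =>
    simp only [Finset.union_empty] at hX
    have := hb _ hX
    simp only [Edge.tip] at this
    omega
  | lateral u i j k hij hjk hik he hX => simp at hX

theorem Cuts.low_closed (hC : Cuts R s) : Closed R ∅ ∅ (s.entry .low) :=
  closed_of_boundary (fun e he => by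
    rw [(hC.boundary _ (mem_boundaryVerts.2 ⟨e, he, .inl rfl⟩)).1,
      (hC.boundary _ (mem_boundaryVerts.2 ⟨e, he, .inr rfl⟩)).1]
    exact hC.step e he) fun _ he => hC.low_edge he

theorem Cuts.upp_closed (hC : Cuts R s) : Closed R ∅ ∅ (s.entry .upp) :=
  closed_of_boundary (fun e he => by
    rw [(hC.boundary _ (mem_boundaryVerts.2 ⟨e, he, .inl rfl⟩)).2,
      (hC.boundary _ (mem_boundaryVerts.2 ⟨e, he, .inr rfl⟩)).2]
    exact hC.step e he) fun _ he => hC.upp_edge he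

theorem Cuts.low_lattice (hC : Cuts R s) : Lattice R (s.entry .low) := fun v hv => by
  simpa using LowDist.isCubeHeight hC.lattice (hC.low v hv).1

/-- A cube below the table reaches the lift along a path realizing the distance. Conversely the lift
lies below the table, because there is no shortcut, and closedness propagates this backwards. -/
theorem Cuts.lowerCutBottom_eq (hC : Cuts R s) :
    belowFn R (s.entry .low) = lowerCutBottom R (liftOf R (s.entry .bh)) := by
  ext c
  constructor
  · rintro ⟨h1, h2⟩
    exact ⟨h1, LowDist.reaches hC.lattice (hC.low _ h1).1 rfl (by simpa using h2)⟩
  · rintro ⟨h1, c', h2, h3⟩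
    refine ⟨h1, hC.low_closed.mem_of_reaches h3 h1 ?_⟩
    rw [h2.2, (hC.boundary _ h2.1).1]

theorem Cuts.upperCutTop_eq (hC : Cuts R s) :
    cubes R \ belowFn R (s.entry .upp) = upperCutTop R (liftOf R (s.entry .bh)) := by
  ext c
  constructor
  · rintro ⟨h1, h2⟩
    have h3 : s.entry .upp (proj c) < height c := by
      by_contra! h
      exact h2 ⟨h1, h⟩
    exact ⟨h1, UppDist.reaches hC.lattice (hC.upp _ h1).1 rfl h3⟩
  · rintro ⟨h1, c', h2, h3⟩
    refine ⟨h1, fun h4 => ?_⟩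
    have h5 : proj (c' + (1, 1, 1)) = proj c' := by
      obtain ⟨x, y, z⟩ := c'
      simp [proj]
    have h6 : height (c' + (1, 1, 1)) = height c' + 3 := by
      obtain ⟨x, y, z⟩ := c'
      simp [height]; ring
    have h7 := hC.upp_closed.mem_of_reaches h3 (by
      change proj _ ∈ verts R
      rw [h5]
      exact boundaryVerts_subset h2.1) h4.2
    rw [h5, h6, h2.2, (hC.boundary _ h2.1).2] at h7
    omega

/-- The time for one vertex and one level in the first step. -/
def firstTime : ℕ := liftTime + (block initBody).bound + (block shortcutBody).bound +
  lowerSearch.time + upperSearch.time + 100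

theorem exec_firstStep (hR : IsSimplyConnectedRegion R) (henv : Env R X₁ X₂ vs s)
    (hb : ∀ v, s.entry .bset v = 0) (hl : ∀ v, s.entry .lset v = 0)
    (hu : ∀ v, s.entry .uset v = 0) :
    ∃ n s', n ≤ 7 * (((boundaryVerts R).card + 5) * ((vs.length + 5) * firstTime)) ∧
      Exec firstStep s n s' ∧ (s'.reg .ok = 0 ∨ s'.reg .ok = 1) ∧ (s'.reg .ok = 1 → Cuts R s') ∧
      ((∃ T, IsTiling R T) → s'.reg .ok = 1) := by
  obtain ⟨n₁, s₁, hn₁, e₁, hL⟩ := exec_liftBoundary hR henv hb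
  have henv₁ := henv.exec e₁ ⟨rfl, rfl, rfl, rfl, rfl⟩
  -- The height function of a tiling, normalized at the start of the traversal, is a consistent
  -- boundary height.
  have hT₁ : (∃ T, IsTiling R T) → ∃ H : Vertex → ℤ, s₁.reg .ok = 1 ∧
      (∀ v ∈ boundaryVerts R, s₁.entry .bh v = H v) ∧
      ∀ e ∈ edges R, H e.tip ≤ H e.base + 1 := by
    rintro ⟨T, hT⟩
    obtain ⟨H, h1, -, h3, h4⟩ := exists_height_of_isTiling hR hT (s₁.reg .a, s₁.reg .b)
    have hc := closed_of_solves hT.solves h3 h4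
    obtain ⟨h5, h6⟩ := hL.unique H ⟨h1, fun e he =>
      hc.edge_eq (boundary_subset_edges he) (by simpa using he)⟩
    exact ⟨H, h5, h6, fun e he => hc.edge_le he⟩
  have hlift : liftTime + 100 ≤ firstTime := by unfold firstTime; omega
  have b₁ : n₁ + 100 ≤ 2 * (((boundaryVerts R).card + 5) * ((vs.length + 5) * firstTime)) := by
    have h1 : (vs.length + (boundaryVerts R).card + 5) * liftTime ≤
        (vs.length + (boundaryVerts R).card + 5) * firstTime :=
      Nat.mul_le_mul_left _ (by omega)
    generalize (boundaryVerts R).card = B at *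
    generalize vs.length = N at *
    generalize firstTime = F at *
    have : 0 ≤ B * N * F := Nat.zero_le _
    nlinarith
  by_cases hok : s₁.reg .ok = 1
  · obtain ⟨n₂, s₂, hn₂, e₂, hS⟩ := exec_initCuts henv₁ hL
      (fun v => by rw [State.entry, e₁.tab_eq rfl]; exact hl v)
      (fun v => by rw [State.entry, e₁.tab_eq rfl]; exact hu v)
    have henv₂ := henv₁.exec e₂ ⟨rfl, rfl, rfl, rfl, rfl⟩
    set h := s₁.entry .bh with hh
    have hstep := hL.step hok
    have hlo : ∀ v ∈ boundaryVerts R, s₂.reg .lo ≤ h v :=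
      fun v hv => hS.lo.2 v (boundaryVerts_subset hv) hv
    have hhi : ∀ v ∈ boundaryVerts R, h v ≤ s₂.reg .hi :=
      fun v hv => hS.hi.2 v (boundaryVerts_subset hv) hv
    have hdiff : s₂.reg .hi - s₂.reg .lo ≤ (boundaryVerts R).card := by
      obtain ⟨⟨u, hu, hul⟩, -⟩ := hS.lo
      obtain ⟨⟨v, hv, hvh⟩, -⟩ := hS.hi
      rw [← hul, ← hvh]
      exact boundary_heights_sub_le hR hstep hu hv
    have hhas : ∀ v, (v ∈ verts R ∧ v ∈ boundaryVerts R) ↔ v ∈ boundaryVerts R :=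
      fun v => ⟨fun h => h.2, fun h => ⟨boundaryVerts_subset h, h⟩⟩
    have hl₂ := hS.lset
    have hu₂ := hS.uset
    simp only [hhas] at hl₂ hu₂
    have lh : ∀ v, lowerSearch.Has s₂ v ↔ v ∈ boundaryVerts R := by
      intro v
      change s₂.entry .lset v = 1 ↔ _
      rw [hl₂]
      split_ifs with hc <;> simp [hc]
    have lv : ∀ v ∈ boundaryVerts R, lowerSearch.val s₂ v = -h v := by
      intro v hv
      rw [← hS.low v (boundaryVerts_subset hv) hv]
      simp [Search.val, lowerSearch]
    obtain ⟨n₃, s₃, hn₃, e₃, hlow⟩ := Search.exec (lowerSearch_valid R) henv₂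
      (src := fun v m => v ∈ boundaryVerts R ∧ m = -h v) (r := .hi)
      ⟨fun v => by
        rw [lh]
        change s₂.entry .lset v = 0 ∨ _
        rw [hl₂]
        split_ifs with hc <;> simp [hc],
        fun v hv => boundaryVerts_subset ((lh v).1 hv),
        fun v hv => .src _ _ ⟨(lh v).1 hv, lv v ((lh v).1 hv)⟩,
        fun v m hm => ⟨(lh v).2 hm.1, by rw [lv v hm.1, hm.2]⟩⟩
      (fun v hv => by
        rw [lv v ((lh v).1 hv)]
        have := hhi v ((lh v).1 hv)
        change (-1) * s₂.reg .hi ≤ _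
        omega) (fun v hv => exists_lowDist hlo hv)
    rw [← lowerCut_eq] at e₃
    have henv₃ := henv₂.exec e₃ ⟨rfl, rfl, rfl, rfl, rfl⟩
    have uh : ∀ v, upperSearch.Has s₃ v ↔ v ∈ boundaryVerts R := by
      intro v
      change s₃.tab .uset v.1 v.2 0 = 1 ↔ _
      rw [e₃.tab_eq rfl]
      change s₂.entry .uset v = 1 ↔ _
      rw [hu₂]
      split_ifs with hc <;> simp [hc]
    have uv : ∀ v ∈ boundaryVerts R, upperSearch.val s₃ v = h v := by
      intro v hv
      rw [← hS.upp v (boundaryVerts_subset hv) hv]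
      simp [Search.val, upperSearch, State.entry, e₃.tab_eq (t := .upp) rfl]
    have hlo₃ : s₃.reg .lo = s₂.reg .lo := e₃.reg_eq rfl
    obtain ⟨n₄, s₄, hn₄, e₄, hupp⟩ := Search.exec (upperSearch_valid R) henv₃
      (src := fun v m => v ∈ boundaryVerts R ∧ m = h v) (r := .lo)
      ⟨fun v => by
        rw [uh]
        change s₃.tab .uset v.1 v.2 0 = 0 ∨ _
        rw [e₃.tab_eq rfl]
        change s₂.entry .uset v = 0 ∨ _
        rw [hu₂]
        split_ifs with hc <;> simp [hc],
        fun v hv => boundaryVerts_subset ((uh v).1 hv),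
        fun v hv => .src _ _ ⟨(uh v).1 hv, uv v ((uh v).1 hv)⟩,
        fun v m hm => ⟨(uh v).2 hm.1, by rw [uv v hm.1, hm.2]⟩⟩
      (fun v hv => by
        rw [uv v ((uh v).1 hv)]
        have := hlo v ((uh v).1 hv)
        change 1 * s₃.reg .lo ≤ _
        omega) (fun v hv => exists_uppDist hhi hv)
    rw [← upperCut_eq] at e₄
    have henv₄ := henv₃.exec e₄ ⟨rfl, rfl, rfl, rfl, rfl⟩
    obtain ⟨n₅, s₅, hn₅, e₅, hok₅, hns⟩ := exec_checkShortcuts henv₄ (by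
      rw [e₄.reg_eq rfl, e₃.reg_eq rfl, e₂.reg_eq rfl, hok])
    have hbh : ∀ v, s₅.entry .bh v = h v := fun v => by
      rw [hh, State.entry, State.entry, e₅.tab_eq rfl, e₄.tab_eq rfl, e₃.tab_eq rfl, e₂.tab_eq rfl]
    have hbh' : s₅.entry .bh = h := funext hbh
    have hbs : ∀ v, s₅.entry .bset v = 1 ↔ v ∈ boundaryVerts R := fun v => by
      rw [← hL.bset, State.entry, State.entry, e₅.tab_eq rfl, e₄.tab_eq rfl, e₃.tab_eq rfl,
        e₂.tab_eq rfl]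
    have hlow₅ : ∀ v ∈ verts R, LowDist R h v (-s₅.entry .low v) ∧
        ∀ m, LowDist R h v m → -s₅.entry .low v ≤ m := by
      intro v hv
      have : -s₅.entry .low v = lowerSearch.val s₃ v := by
        simp [Search.val, lowerSearch, State.entry, e₅.tab_eq (t := .low) rfl,
          e₄.tab_eq (t := .low) rfl]
      rw [this]
      exact hlow v hv
    have hupp₅ : ∀ v ∈ verts R, UppDist R h v (s₅.entry .upp v) ∧
        ∀ m, UppDist R h v m → s₅.entry .upp v ≤ m := by
      intro v hv
      have : s₅.entry .upp v = upperSearch.val s₄ v := by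
        simp [Search.val, upperSearch, State.entry, e₅.tab_eq (t := .upp) rfl]
      rw [this]
      exact hupp v hv
    refine ⟨_, s₅, ?_, .seq e₁ (.seq (.ite_true (p := .eq Reg.ok 1) hok
      (.seq e₂ (.seq e₃ (.seq e₄ (.seq e₅ (.skip _)))))) (.skip _)), hok₅, fun h5 => ?_, fun hT => ?_⟩
    · set U := ((boundaryVerts R).card + 5) * ((vs.length + 5) * firstTime) with hU
      -- The levels range from `hi` down to `lo` minus the number of boundary vertices, and `hi -
      -- lo` is at most that number too.
      have c₃ : ((-s₂.reg .lo + (boundaryVerts R).card + 1 - lowerSearch.σ * s₂.reg .hi).toNat + 2)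
          ≤ 2 * ((boundaryVerts R).card + 5) := by
        have : lowerSearch.σ = -1 := rfl
        rw [this]
        omega
      have c₄ : ((s₂.reg .hi + (boundaryVerts R).card + 1 - upperSearch.σ * s₃.reg .lo).toNat + 2)
          ≤ 2 * ((boundaryVerts R).card + 5) := by
        have : upperSearch.σ = 1 := rfl
        rw [this]
        omega
      have b₃ : n₃ ≤ 2 * ((boundaryVerts R).card + 5) * ((vs.length + 5) * firstTime) :=
        hn₃.trans (Nat.mul_le_mul c₃ (Nat.mul_le_mul (by omega) (by unfold firstTime; omega)))
      have b₄ : n₄ ≤ 2 * ((boundaryVerts R).card + 5) * ((vs.length + 5) * firstTime) :=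
        hn₄.trans (Nat.mul_le_mul c₄ (Nat.mul_le_mul (by omega) (by unfold firstTime; omega)))
      rw [mul_assoc, ← hU] at b₃ b₄
      have b₂ : n₂ ≤ (vs.length + 5) * firstTime :=
        hn₂.trans (Nat.mul_le_mul (by omega) (by unfold firstTime liftTime; omega))
      have b₅ : n₅ ≤ (vs.length + 5) * firstTime :=
        hn₅.trans (Nat.mul_le_mul (by omega) (by unfold firstTime liftTime; omega))
      have hU' : 2 * ((vs.length + 5) * firstTime) ≤ U := Nat.mul_le_mul_right _ (by omega)
      have hcost : (Test.eq (Expr.reg .ok) 1).cost = 3 := rfl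
      omega
    · have hns := hns.1 h5
      refine ⟨by rw [hbh']; exact hstep, by rw [hbh']; exact hL.lattice,
        ⟨_, fun H hH => by rw [hbh']; exact (hL.unique H hH).2⟩,
        fun v hv => hns v (boundaryVerts_subset hv) ((hbs v).2 hv), by rw [hbh']; exact hlow₅,
        by rw [hbh']; exact hupp₅, fun v hv => ?_⟩
      -- The factor 3 in the field `bound`: once for `hi - lo`, once for each distance to the
      -- boundary.
      obtain ⟨m, hm, hd⟩ := exists_lowDist hlo hv
      obtain ⟨m', hm', hd'⟩ := exists_uppDist hhi hv
      have a1 := (hlow₅ v hv).2 m hd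
      have a2 := (hupp₅ v hv).2 m' hd'
      omega
    · obtain ⟨H, -, h2, h3⟩ := hT₁ hT
      refine hns.2 fun v hv hvb => ?_
      have hvb := (hbs v).1 hvb
      rw [hbh]
      -- A search can only improve the value at a boundary vertex, and the height function `H` of a
      -- tiling bounds the improvement by `H v`, which is the boundary height itself.
      have a1 := (hlow₅ v hv).2 _ (.src v _ ⟨hvb, rfl⟩)
      have a2 := (hupp₅ v hv).2 _ (.src v _ ⟨hvb, rfl⟩)
      have a3 := LowDist.le (fun v hv => (h2 v hv).le) h3 (hlow₅ v hv).1
      have a4 := UppDist.le (fun v hv => (h2 v hv).ge) h3 (hupp₅ v hv).1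
      rw [← h2 v hvb] at a3 a4
      constructor <;> omega
  · refine ⟨_, s₁, ?_, .seq e₁ (.seq (.ite_false (p := .eq Reg.ok 1) hok (.skip _)) (.skip _)),
      hL.ok, fun h => absurd h hok, fun hT => ?_⟩
    · have hcost : (Test.eq (Expr.reg .ok) 1).cost = 3 := rfl
      omega
    · obtain ⟨H, h1, -⟩ := hT₁ hT
      exact h1

end

/-! ## The second step -/

section
variable {R : Finset Tri} {X₁ X₂ : Finset Edge} {vs : List Vertex} {s s' : State}

/-- The invariants of the growth of the bottom part. -/
structure Growing (R : Finset Tri) (X₁ X₂ : Finset Edge) (vs : List Vertex) (s : State) :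
    Prop where
  env : Env R X₁ X₂ vs s
  cuts : Cuts R s
  sp : 0 ≤ s.reg .sp
  lattice : Lattice R (s.entry .hgt)
  low_le : ∀ v ∈ verts R, s.entry .low v ≤ s.entry .hgt v
  le_upp : ∀ v ∈ verts R, s.entry .hgt v ≤ s.entry .upp v
  subset : belowFn R (s.entry .hgt) ⊆ grown R X₁ X₂ (belowFn R (s.entry .low))
  stack : ∀ v, OnStack s v → v ∈ verts R
  fail : s.reg .fail = 0 ∨ s.reg .fail = 1 ∧
    ¬ grown R X₁ X₂ (belowFn R (s.entry .low)) ⊆ belowFn R (s.entry .upp)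

/-- The number of pops that remain at most. -/
def growthLeft (R : Finset Tri) (s : State) : ℕ :=
  (s.reg .sp).toNat + ∑ v ∈ verts R, (s.entry .upp v - s.entry .hgt v).toNat

/-- The changes of the memory during the treatment of one cube. -/
structure Grows (R : Finset Tri) (s s' : State) : Prop where
  x : s'.reg .x = s.reg .x
  y : s'.reg .y = s.reg .y
  k : s'.reg .k = s.reg .k
  le : ∀ v, s.entry .hgt v ≤ s'.entry .hgt v
  fresh : ∀ v, s'.entry .hgt v = s.entry .hgt v ∨ OnStack s' v
  stack : ∀ v, OnStack s v → OnStack s' v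
  fail : s'.reg .fail = 0 → s.reg .fail = 0
  left : growthLeft R s' ≤ growthLeft R s

theorem Grows.refl (R : Finset Tri) (s : State) : Grows R s s :=
  ⟨rfl, rfl, rfl, fun _ => le_rfl, fun _ => .inl rfl, fun _ h => h, id, le_rfl⟩

theorem Grows.trans {s₁ s₂ s₃ : State} (h : Grows R s₁ s₂) (h' : Grows R s₂ s₃) :
    Grows R s₁ s₃ :=
  ⟨h'.x.trans h.x, h'.y.trans h.y, h'.k.trans h.k, fun v => (h.le v).trans (h'.le v),
    fun v => (h'.fresh v).elim
      (fun h1 => (h.fresh v).imp (fun h2 => h1.trans h2) (h'.stack v)) .inr,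
    fun v hv => h'.stack v (h.stack v hv), fun h1 => h.fail (h'.fail h1), h'.left.trans h.left⟩

theorem Growing.exists_mem_grown (h : Growing R X₁ X₂ vs s) {u v : Vertex} {δ m : ℤ}
    (hu : VArc R X₁ X₂ u v δ) (hm : IsCubeHeight v m) (hle : m ≤ s.entry .hgt v) :
    ∃ c ∈ grown R X₁ X₂ (belowFn R (s.entry .low)), proj c = u ∧ height c = m - δ := by
  obtain ⟨c', rfl, rfl⟩ := exists_cube hm
  obtain ⟨c, rfl, h2, h3⟩ := hu.exists_arc_to rfl
  obtain ⟨-, c'', h4, h5⟩ := h.subset ⟨hu.right_mem, hle⟩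
  exact ⟨c, ⟨hu.left_mem, c'', h4, .head h3 h5⟩, rfl, h2⟩

/-- The proposed cube has an arc into the bottom part, so it belongs to the grown set. If it lies
above the upper cut, it witnesses failure. Otherwise entering it adds one stack cell but reduces the
gap to the upper cut by at least one, so the measure does not increase. -/
theorem Growing.addCube (h : Growing R X₁ X₂ vs s) {p q e : Expr} {u v : Vertex} {δ m : ℤ}
    (hp : ∀ s' : State, s'.reg .x = s.reg .x → s'.reg .y = s.reg .y → p.val s' = u.1)
    (hq : ∀ s' : State, s'.reg .x = s.reg .x → s'.reg .y = s.reg .y → q.val s' = u.2)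
    (he : e.val s = m - δ) (hu : VArc R X₁ X₂ u v δ) (hm : IsCubeHeight v m)
    (hle : m ≤ s.entry .hgt v) :
    Growing R X₁ X₂ vs ((addCube p q e).eval s) ∧ Grows R s ((addCube p q e).eval s) ∧
      (((addCube p q e).eval s).reg .fail = 0 →
        m - δ ≤ ((addCube p q e).eval s).entry .hgt u) := by
  have hne : ∀ w : Vertex, w ≠ u → ¬ (w.1 = u.1 ∧ w.2 = u.2) := fun w hw h => hw (Prod.ext h.1 h.2)
  obtain ⟨c, hcg, hcu, hch⟩ := h.exists_mem_grown hu hm hle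
  have hum := hu.left_mem
  by_cases h1 : s.entry .hgt u < m - δ
  · by_cases h2 : s.entry .upp u < m - δ
    · have hs' : (Calisson.addCube p q e).eval s = s.setReg .fail 1 := by
        rw [Calisson.addCube, eval_when_pos (by simpa [hp s rfl rfl, hq s rfl rfl, he] using h1)]
        simp only [eval_block_cons, eval_block_nil]
        rw [eval_ite_pos (by simpa [hp s rfl rfl, hq s rfl rfl, he] using h2)]
        simp
      rw [hs']
      have hst : ∀ w, OnStack (s.setReg .fail 1) w ↔ OnStack s w := fun w => by simp [OnStack]
      refine ⟨⟨h.env.congr (by simp) rfl rfl rfl rfl, h.cuts.congr rfl rfl rfl,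
        by simpa using h.sp, h.lattice, h.low_le, h.le_upp, h.subset,
        fun w hw => h.stack w ((hst w).1 hw), .inr ⟨by simp, fun hsub => ?_⟩⟩,
        ⟨by simp, by simp, by simp, fun _ => le_rfl, fun _ => .inl rfl,
          fun w hw => (hst w).2 hw, by simp, by simp [growthLeft, State.entry]⟩, by simp⟩
      have h3 := (hsub hcg).2
      rw [hcu, hch] at h3
      change m - δ ≤ s.entry .upp u at h3
      omega
    · set t := s.setTab .hgt u.1 u.2 0 (m - δ) with ht
      have hs' : (Calisson.addCube p q e).eval s = t.push u := by
        rw [Calisson.addCube, eval_when_pos (by simpa [hp s rfl rfl, hq s rfl rfl, he] using h1)]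
        simp only [eval_block_cons, eval_block_nil]
        rw [eval_ite_neg (by simpa [hp s rfl rfl, hq s rfl rfl, he] using h2)]
        simp only [eval_block_cons, eval_block_nil, eval_store, hp s rfl rfl, hq s rfl rfl, he,
          val_zero]
        exact eval_push (hp _ rfl rfl) (hq _ rfl rfl)
      rw [hs']
      have hhgt : ∀ w, (t.push u).entry .hgt w = if w = u then m - δ else s.entry .hgt w := by
        intro w
        by_cases hw : w = u
        · subst hw; simp [ht, State.entry]
        · simp [ht, State.entry, hw, hne w hw]
      have hlow : (t.push u).entry .low = s.entry .low := by
        funext w; simp [ht, State.entry]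
      have hupp : (t.push u).entry .upp = s.entry .upp := by
        funext w; simp [ht, State.entry]
      have hst : ∀ w, OnStack (t.push u) w ↔ OnStack s w ∨ w = u := by
        intro w
        rw [onStack_push (by simpa [ht] using h.sp)]
        simp [OnStack, ht]
      have hsp : (t.push u).reg .sp = s.reg .sp + 1 := by simp [ht]
      have hfail : (t.push u).reg .fail = s.reg .fail := by simp [ht]
      have hmono : ∀ w, s.entry .hgt w ≤ (t.push u).entry .hgt w := by
        intro w
        rw [hhgt]
        split_ifs with hw
        · rw [hw]; exact h1.le
        · exact le_rfl
      refine ⟨⟨h.env.congr (by simp [ht]) (by simp [ht]) (by simp [ht]) (by simp [ht])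
        (by simp [ht]), h.cuts.congr (by simp [ht]) (by simp [ht]) (by simp [ht]), ?_, fun w hw => ?_,
        fun w hw => ?_, fun w hw => ?_, ?_, fun w hw => ?_, ?_⟩,
        ⟨by simp [ht], by simp [ht], by simp [ht], hmono, fun w => ?_,
          fun w hw => (hst w).2 (.inl hw), by rw [hfail]; exact id, ?_⟩, fun _ => ?_⟩
      · have := h.sp; omega
      · rw [hhgt]
        split_ifs with hwu
        · rw [hwu]; exact hu.isCubeHeight_left hm
        · exact h.lattice w hw
      · rw [hlow]
        exact (h.low_le w hw).trans (hmono w)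
      · rw [hhgt, hupp]
        split_ifs with hwu
        · rw [hwu]; exact not_lt.1 h2
        · exact h.le_upp w hw
      · rw [hlow]
        rintro c' ⟨hc', hle'⟩
        rw [hhgt] at hle'
        split_ifs at hle' with hwu
        · obtain ⟨-, c'', h3, h4⟩ := hcg
          -- The missing cubes under the new one are entered with it; they reach it along the
          -- column.
          exact ⟨hc', c'', h3, (reaches_of_height_le hc' (hwu.trans hcu.symm)
            (by rwa [hch])).trans h4⟩
        · exact h.subset ⟨hc', hle'⟩
      · rcases (hst w).1 hw with hw | rfl
        exacts [h.stack w hw, hum]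
      · rw [hlow, hupp, hfail]
        exact h.fail
      · by_cases hw : w = u
        · exact .inr ((hst w).2 (.inr hw))
        · exact .inl (by rw [hhgt, if_neg hw])
      · have hlt : ∑ w ∈ verts R, ((t.push u).entry .upp w - (t.push u).entry .hgt w).toNat <
            ∑ w ∈ verts R, (s.entry .upp w - s.entry .hgt w).toNat := by
          rw [hupp]
          refine Finset.sum_lt_sum (fun w _ => ?_) ⟨u, hum, ?_⟩
          · have := hmono w
            omega
          · rw [hhgt, if_pos rfl]
            omega
        have := h.sp
        unfold growthLeft
        rw [hsp]
        omega
      · rw [hhgt, if_pos rfl]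
  · have hs' : (Calisson.addCube p q e).eval s = s := by
      rw [Calisson.addCube, eval_when_neg (by simpa [hp s rfl rfl, hq s rfl rfl, he] using h1)]
    rw [hs']
    exact ⟨h, .refl R s, fun _ => not_lt.1 h1⟩

/-- The cube of height `m` over `v`, which belongs to the bottom part, is being treated. -/
structure Treating (s : State) (v : Vertex) (m : ℤ) : Prop where
  x : s.reg .x = v.1
  y : s.reg .y = v.2
  k : s.reg .k = m
  lattice : IsCubeHeight v m
  le : m ≤ s.entry .hgt v

theorem Treating.grows {v : Vertex} {m : ℤ} (h : Treating s v m) (hg : Grows R s s') :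
    Treating s' v m :=
  ⟨hg.x.trans h.x, hg.y.trans h.y, hg.k.trans h.k, h.lattice, h.le.trans (hg.le v)⟩

/-- The cube of height `h` over `u` belongs to the bottom part, unless the algorithm has failed. -/
def Entered (s : State) (u : Vertex) (h : ℤ) : Prop := s.reg .fail = 0 → h ≤ s.entry .hgt u

theorem Entered.grows {u : Vertex} {m : ℤ} (h : Entered s u m) (hg : Grows R s s') :
    Entered s' u m := fun h1 => (h (hg.fail h1)).trans (hg.le u)

theorem Growing.when_addCube (h : Growing R X₁ X₂ vs s) {v : Vertex} {m : ℤ}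
    (ht : Treating s v m) {t : Test} {p q e : Expr} {u : Vertex} {δ : ℤ} {P : Prop}
    (htP : t.holds s ↔ P) (hP : P → VArc R X₁ X₂ u v δ)
    (hp : ∀ s' : State, s'.reg .x = v.1 → s'.reg .y = v.2 → p.val s' = u.1)
    (hq : ∀ s' : State, s'.reg .x = v.1 → s'.reg .y = v.2 → q.val s' = u.2)
    (he : e.val s = m - δ) :
    ∃ s', (when t [Calisson.addCube p q e]).eval s = s' ∧ Growing R X₁ X₂ vs s' ∧ Grows R s s' ∧
      Treating s' v m ∧ (P → Entered s' u (m - δ)) := by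
  refine ⟨_, rfl, ?_⟩
  by_cases hh : P
  · rw [eval_when_pos (htP.2 hh)]
    obtain ⟨h1, h2, h3⟩ := h.addCube (p := p) (q := q)
      (fun s' h1 h2 => hp s' (h1.trans ht.x) (h2.trans ht.y))
      (fun s' h1 h2 => hq s' (h1.trans ht.x) (h2.trans ht.y)) he (hP hh) ht.lattice ht.le
    exact ⟨h1, h2, ht.grows h2, fun _ => h3⟩
  · rw [eval_when_neg (fun hc => hh (htP.1 hc))]
    exact ⟨h, .refl R s, ht, fun h => absurd h hh⟩

/-- The arcs of the ascendant graph that enter the cubes over `v` from direction `i`. -/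
structure TreatedInto (R : Finset Tri) (X₁ X₂ : Finset Edge) (s : State) (v : Vertex) (m : ℤ)
    (i : Fin 3) : Prop where
  up : (⟨v - vec i, i⟩ : Edge) ∈ edges R → Entered s (v - vec i) (m - 1)
  down : (⟨v, i⟩ : Edge) ∈ edges R ∧ (⟨v, i⟩ : Edge) ∈ boundary R ∪ X₁ ∪ X₂ →
    Entered s (v + vec i) (m - -1)
  lateral₁ : (⟨v + vec (i + 1), i⟩ : Edge).lozenge ⊆ R ∧ (⟨v + vec (i + 1), i⟩ : Edge) ∈ X₂ →
    Entered s (v + vec (i + 1) - vec (i + 2)) (m - 0)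
  lateral₂ : (⟨v + vec (i + 2), i⟩ : Edge).lozenge ⊆ R ∧ (⟨v + vec (i + 2), i⟩ : Edge) ∈ X₂ →
    Entered s (v + vec (i + 2) - vec (i + 1)) (m - 0)

theorem TreatedInto.grows {v : Vertex} {m : ℤ} {i : Fin 3} (h : TreatedInto R X₁ X₂ s v m i)
    (hg : Grows R s s') : TreatedInto R X₁ X₂ s' v m i :=
  ⟨fun h1 => (h.up h1).grows hg, fun h1 => (h.down h1).grows hg,
    fun h1 => (h.lateral₁ h1).grows hg, fun h1 => (h.lateral₂ h1).grows hg⟩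

/-- For a lateral arc ending at `v`, the vertex `v` is one of the two vertices opposite to the edge;
the two choices give the two lateral fields. -/
theorem entered_of_treatedInto {v : Vertex} {m : ℤ} (h : ∀ i, TreatedInto R X₁ X₂ s v m i)
    {u : Vertex} {δ : ℤ} (hu : VArc R X₁ X₂ u v δ) : Entered s u (m - δ) := by
  cases hu with
  | up _ i he => simpa using (h i).up (by simpa using he)
  | down _ i he hX => exact (h i).down ⟨he, hX⟩
  | lateral w i j k hij hjk hik hw hX =>
    rcases dir_cases hij with rfl | rfl <;> rcases dir_cases hik with rfl | rfl
    · exact absurd rfl hjk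
    · simpa using (h i).lateral₂ (by simpa using ⟨hw, hX⟩)
    · simpa using (h i).lateral₁ (by simpa using ⟨hw, hX⟩)
    · exact absurd rfl hjk

/-- The program text that treats the arcs of one direction. -/
def growDir (i : Fin 3) : Cmd := block [
  when (.lt 0 (.get .cnt (Reg.x - dx i) (Reg.y - dy i) (lit i)))
    [addCube (Reg.x - dx i) (Reg.y - dy i) (Reg.k - 1)],
  when (.or (.eq (.get .cnt Reg.x Reg.y (lit i)) 1)
      (.and (.eq (.get .cnt Reg.x Reg.y (lit i)) 2)
        (.or (.eq (.get .con1 Reg.x Reg.y (lit i)) 1) (.eq (.get .con2 Reg.x Reg.y (lit i)) 1))))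
    [addCube (Reg.x + dx i) (Reg.y + dy i) (Reg.k + 1)],
  when (.and (.eq (.get .cnt (Reg.x + dx (i + 1)) (Reg.y + dy (i + 1)) (lit i)) 2)
      (.eq (.get .con2 (Reg.x + dx (i + 1)) (Reg.y + dy (i + 1)) (lit i)) 1))
    [addCube (Reg.x + dx (i + 1) - dx (i + 2)) (Reg.y + dy (i + 1) - dy (i + 2)) Reg.k],
  when (.and (.eq (.get .cnt (Reg.x + dx (i + 2)) (Reg.y + dy (i + 2)) (lit i)) 2)
      (.eq (.get .con2 (Reg.x + dx (i + 2)) (Reg.y + dy (i + 2)) (lit i)) 1))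
    [addCube (Reg.x + dx (i + 2) - dx (i + 1)) (Reg.y + dy (i + 2) - dy (i + 1)) Reg.k]]

theorem Growing.growDir (h : Growing R X₁ X₂ vs s) {v : Vertex} {m : ℤ} (ht : Treating s v m)
    (i : Fin 3) :
    Growing R X₁ X₂ vs ((growDir i).eval s) ∧ Grows R s ((growDir i).eval s) ∧
      TreatedInto R X₁ X₂ ((growDir i).eval s) v m i := by
  have hlat : ∀ s' : State, Env R X₁ X₂ vs s' → Treating s' v m → ∀ j : Fin 3,
      ((Test.and (.eq (.get .cnt (Reg.x + dx j) (Reg.y + dy j) (lit i)) 2)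
        (.eq (.get .con2 (Reg.x + dx j) (Reg.y + dy j) (lit i)) 1)).holds s' ↔
      (⟨v + vec j, i⟩ : Edge).lozenge ⊆ R ∧ (⟨v + vec j, i⟩ : Edge) ∈ X₂) := by
    intro s' he ht j
    have h1 := he.cnt (v + vec j) i
    have h2 := he.con2 (v + vec j) i
    rw [← count_eq_two, ← h1, ← h2]
    simp [ht.x, ht.y]
  obtain ⟨s₁, hs₁, g₁, p₁, t₁, d₁⟩ := h.when_addCube ht
    (t := .lt 0 (.get .cnt (Reg.x - dx i) (Reg.y - dy i) (lit i)))
    (p := Reg.x - dx i) (q := Reg.y - dy i) (e := Reg.k - 1) (u := v - vec i) (δ := 1)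
    (P := (⟨v - vec i, i⟩ : Edge) ∈ edges R)
    (by
      have := h.env.cnt (v - vec i) i
      rw [← count_pos, ← this]
      simp [ht.x, ht.y])
    (fun h => by simpa using VArc.up (v - vec i) i h)
    (by intro s' h _; simp [h]) (by intro s' _ h; simp [h]) (by simp [ht.k])
  obtain ⟨s₂, hs₂, g₂, p₂, t₂, d₂⟩ := g₁.when_addCube t₁
    (t := .or (.eq (.get .cnt Reg.x Reg.y (lit i)) 1)
      (.and (.eq (.get .cnt Reg.x Reg.y (lit i)) 2)
        (.or (.eq (.get .con1 Reg.x Reg.y (lit i)) 1) (.eq (.get .con2 Reg.x Reg.y (lit i)) 1))))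
    (p := Reg.x + dx i) (q := Reg.y + dy i) (e := Reg.k + 1) (u := v + vec i) (δ := -1)
    (P := (⟨v, i⟩ : Edge) ∈ edges R ∧ (⟨v, i⟩ : Edge) ∈ boundary R ∪ X₁ ∪ X₂)
    (by
      simp only [holds_or, holds_and, holds_eq, val_get, val_reg, val_dir, val_one, val_two, t₁.x,
        t₁.y, g₁.env.cnt v i, g₁.env.con1 v i, g₁.env.con2 v i, count_eq_one, count_eq_two,
        Finset.mem_union]
      have hb : (⟨v, i⟩ : Edge) ∈ boundary R ↔
          (⟨v, i⟩ : Edge) ∈ edges R ∧ ¬ (⟨v, i⟩ : Edge).lozenge ⊆ R := Finset.mem_filter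
      have hl : (⟨v, i⟩ : Edge).lozenge ⊆ R → (⟨v, i⟩ : Edge) ∈ edges R := fun hl =>
        mem_edges.2 (.inl (lozenge_subset.1 hl).1)
      rw [hb]
      tauto)
    (fun h => VArc.down v i h.1 h.2)
    (by intro s' h _; simp [h]) (by intro s' _ h; simp [h]) (by simp [t₁.k])
  obtain ⟨s₃, hs₃, g₃, p₃, t₃, d₃⟩ := g₂.when_addCube t₂ (hlat s₂ g₂.env t₂ (i + 1))
    (p := Reg.x + dx (i + 1) - dx (i + 2)) (q := Reg.y + dy (i + 1) - dy (i + 2)) (e := Reg.k)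
    (u := v + vec (i + 1) - vec (i + 2)) (δ := 0)
    (fun h => by
      simpa using VArc.lateral (v + vec (i + 1)) i (i + 2) (i + 1) (dir_ne i).2.1 (dir_ne i).2.2.symm
        (dir_ne i).1 h.1 h.2)
    (by intro s' h _; simp [h]) (by intro s' _ h; simp [h]) (by simp [t₂.k])
  obtain ⟨s₄, hs₄, g₄, p₄, t₄, d₄⟩ := g₃.when_addCube t₃ (hlat s₃ g₃.env t₃ (i + 2))
    (p := Reg.x + dx (i + 2) - dx (i + 1)) (q := Reg.y + dy (i + 2) - dy (i + 1)) (e := Reg.k)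
    (u := v + vec (i + 2) - vec (i + 1)) (δ := 0)
    (fun h => by
      simpa using VArc.lateral (v + vec (i + 2)) i (i + 1) (i + 2) (dir_ne i).1 (dir_ne i).2.2
        (dir_ne i).2.1 h.1 h.2)
    (by intro s' h _; simp [h]) (by intro s' _ h; simp [h]) (by simp [t₃.k])
  have hs : (Calisson.growDir i).eval s = s₄ := by
    rw [← hs₄, ← hs₃, ← hs₂, ← hs₁]
    rfl
  rw [hs]
  exact ⟨g₄, p₁.trans (p₂.trans (p₃.trans p₄)),
    fun h => (d₁ h).grows (p₂.trans (p₃.trans p₄)), fun h => (d₂ h).grows (p₃.trans p₄),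
    fun h => (d₃ h).grows p₄, d₄⟩

/-- The body of the backward traversal. -/
def growBody : List Cmd := [pop, .set .k (.get .hgt Reg.x Reg.y 0), forDirs growDir]

/-- The arcs that enter the bottom part end in cubes over the vertices on the stack. -/
def Settled (R : Finset Tri) (X₁ X₂ : Finset Edge) (s : State) : Prop :=
  ∀ v ∈ verts R, OnStack s v ∨
    ∀ u δ, VArc R X₁ X₂ u v δ → Entered s u (s.entry .hgt v - δ)

/-- Treating the highest cube over a vertex suffices, because arcs are invariant under translation
by `(1,1,1)`: arcs into lower cubes of the column start at correspondingly lower cubes. -/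
theorem Growing.body (h : Growing R X₁ X₂ vs s) (hc : Settled R X₁ X₂ s) (h0 : 0 < s.reg .sp) :
    Growing R X₁ X₂ vs ((block growBody).eval s) ∧ Settled R X₁ X₂ ((block growBody).eval s) ∧
      growthLeft R ((block growBody).eval s) < growthLeft R s := by
  obtain ⟨v, hpop, hon, hstk⟩ := eval_pop h0
  have hv := h.stack v hon
  set s₁ := (s.pop v).setReg .k (s.entry .hgt v) with hs₁
  have hs : (block growBody).eval s = (forDirs Calisson.growDir).eval s₁ := by
    simp only [growBody, eval_block_cons, eval_block_nil, hpop]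
    congr 1
  have hst : ∀ w, OnStack s₁ w ↔ OnStack (s.pop v) w := fun w => by simp [OnStack, hs₁]
  have hfail : s₁.reg .fail = s.reg .fail := by simp [hs₁, State.pop]
  have t₁ : Growing R X₁ X₂ vs s₁ := by
    refine ⟨h.env.congr (by simp [hs₁, State.pop]) rfl rfl rfl rfl, h.cuts.congr rfl rfl rfl, ?_,
      h.lattice, h.low_le, h.le_upp, h.subset, fun w hw => h.stack w (onStack_of_pop ((hst w).1 hw)),
      ?_⟩
    · simp [hs₁, State.pop]; omega
    · rw [hfail]; exact h.fail
  have hrem : growthLeft R s₁ < growthLeft R s := by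
    have h1 : s₁.reg .sp = s.reg .sp - 1 := by simp [hs₁, State.pop]
    unfold growthLeft
    rw [h1]
    exact Nat.add_lt_add_of_lt_of_le (by omega) (le_of_eq rfl)
  have htr : Treating s₁ v (s.entry .hgt v) :=
    ⟨by simp [hs₁, State.pop], by simp [hs₁, State.pop], by simp [hs₁], h.lattice v hv, le_rfl⟩
  obtain ⟨b1, b2, b3⟩ := forDirs_induction (s := s₁) (f := Calisson.growDir)
    (fun m t => Growing R X₁ X₂ vs t ∧ Grows R s₁ t ∧
      ∀ i : Fin 3, (i : ℕ) < m → TreatedInto R X₁ X₂ t v (s.entry .hgt v) i) (by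
    rintro i t ⟨ht, hp, hd⟩
    obtain ⟨a1, a2, a3⟩ := ht.growDir (htr.grows hp) i
    refine ⟨a1, hp.trans a2, fun i' hi' => ?_⟩
    by_cases hii : i' = i
    · rwa [hii]
    · have := Fin.val_ne_of_ne hii
      exact (hd i' (by omega)).grows a2)
    ⟨t₁, .refl R s₁, by simp⟩
  rw [hs]
  refine ⟨b1, fun w hw => ?_, lt_of_le_of_lt b2.left hrem⟩
  -- A vertex whose height has changed, possibly `v` itself, has been pushed again.
  rcases b2.fresh w with hw' | hw'
  · have hww : ((forDirs Calisson.growDir).eval s₁).entry .hgt w = s.entry .hgt w := hw'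
    rw [hww]
    have hold : (∀ u δ, VArc R X₁ X₂ u w δ → Entered s u (s.entry .hgt w - δ)) →
        ∀ u δ, VArc R X₁ X₂ u w δ →
          Entered ((forDirs Calisson.growDir).eval s₁) u (s.entry .hgt w - δ) :=
      fun h u δ hu => Entered.grows (s := s₁) (fun h1 => h u δ hu (hfail ▸ h1)) b2
    rcases hc w hw with h1 | h1
    · rcases hstk w h1 with rfl | h1
      · exact .inr fun u δ hu => entered_of_treatedInto (fun i => b3 i i.2) hu
      · exact .inl (b2.stack w ((hst w).2 h1))
    · exact .inr (hold h1)
  · exact .inl hw'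

/-- The body of the loop that copies the lower cut. -/
def copyBody : List Cmd := [.store .hgt Reg.x Reg.y 0 (.get .low Reg.x Reg.y 0), push Reg.x Reg.y]

theorem exec_copy (henv : Env R X₁ X₂ vs s) (hsp : s.reg .sp = 0) :
    ∃ n s', n ≤ (vs.length + 1) * ((block copyBody).bound + 40) ∧
      Exec (forEach .nV (fetch :: copyBody)) s n s' ∧ s'.reg .sp = (verts R).card ∧
      (∀ v ∈ verts R, s'.entry .hgt v = s'.entry .low v) ∧ ∀ v, OnStack s' v ↔ v ∈ verts R := by
  obtain ⟨n, s', hn, he, h1, h2, h3⟩ := exec_forVerts (cs := copyBody) rfl rfl rfl rfl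
    henv.nodup henv.listed
    (fun P s => s.reg .sp = P.card ∧ (∀ v ∈ P, s.entry .hgt v = s.entry .low v) ∧
      ∀ v, OnStack s v ↔ v ∈ P)
    (by
      rintro P s r n hr ⟨h1, h2, h3⟩
      have : Reg.sp ≠ r := by rcases hr with rfl | rfl | rfl <;> simp
      refine ⟨by simpa [this] using h1, h2, fun v => ?_⟩
      rw [← h3]
      simp [OnStack, this])
    ⟨by simpa using hsp, by simp, fun v => by
      simp only [Finset.notMem_empty, iff_false]
      rintro ⟨m, hm, -⟩
      omega⟩
    (by
      rintro P v s hv hP hx hy ⟨h1, h2, h3⟩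
      set t := s.setTab .hgt v.1 v.2 0 (s.entry .low v) with ht
      have hs : (block copyBody).eval s = t.push v := by
        simp only [copyBody, eval_block_cons, eval_block_nil, eval_store, val_get, val_reg,
          val_zero, hx, hy]
        exact eval_push (by simp [hx]) (by simp [hy])
      rw [hs]
      have hlow : ∀ w, (t.push v).entry .low w = s.entry .low w := fun w => by
        simp [ht, State.entry]
      refine ⟨?_, fun w hw => ?_, fun w => ?_⟩
      · rw [Finset.card_insert_of_notMem hP]
        simp [ht, h1]
      · rw [hlow]
        by_cases hwv : w = v
        · subst hwv; simp [ht, State.entry]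
        · have hne : ¬ (w.1 = v.1 ∧ w.2 = v.2) := fun h => hwv (Prod.ext h.1 h.2)
          rw [← h2 w ((Finset.mem_insert.1 hw).resolve_left hwv)]
          simp [ht, State.entry, hne]
      · rw [onStack_push (by simp [ht, h1]), Finset.mem_insert, or_comm, ← h3]
        simp [OnStack, ht])
  rw [henv.toFinset] at h1 h2 h3
  exact ⟨n, s', hn, he, h1, h2, h3⟩

/-- The time for one vertex and one level in the second step. -/
def secondTime : ℕ := (block copyBody).bound + (block growBody).bound + 100

theorem exec_secondStep (henv : Env R X₁ X₂ vs s) (hC : Cuts R s) :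
    ∃ n s', n ≤ 4 * (((boundaryVerts R).card + 5) * ((vs.length + 5) * secondTime)) ∧
      Exec secondStep s n s' ∧ Growing R X₁ X₂ vs s' ∧
      (s'.reg .fail = 0 → Closed R X₁ X₂ (s'.entry .hgt)) := by
  have e₁ : Exec (.set .fail 0) s _ (s.setReg .fail 0) := .set _ _ _
  have e₂ : Exec (.set .sp 0) (s.setReg .fail 0) _ ((s.setReg .fail 0).setReg .sp 0) := .set _ _ _
  have henv₂ := (henv.exec e₁ ⟨rfl, rfl, rfl, rfl, rfl⟩).exec e₂ ⟨rfl, rfl, rfl, rfl, rfl⟩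
  obtain ⟨n₃, s₃, hn₃, e₃, hsp₃, hh₃, hst₃⟩ := exec_copy henv₂ (by simp)
  have henv₃ := henv₂.exec e₃ ⟨rfl, rfl, rfl, rfl, rfl⟩
  have hC₃ : Cuts R s₃ := hC.congr (e₃.tab_eq rfl) (e₃.tab_eq rfl) (e₃.tab_eq rfl)
  have g₃ : Growing R X₁ X₂ vs s₃ := by
    refine ⟨henv₃, hC₃, by rw [hsp₃]; positivity, fun v hv => ?_, fun v hv => (hh₃ v hv).ge,
      fun v hv => ?_, ?_, fun v hv => (hst₃ v).1 hv, .inl ?_⟩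
    · rw [hh₃ v hv]; exact hC₃.low_lattice v hv
    · rw [hh₃ v hv]; exact hC₃.low_le_upp hv
    · rintro c ⟨h1, h2⟩
      rw [hh₃ _ h1] at h2
      exact ⟨h1, c, ⟨h1, h2⟩, .refl⟩
    · rw [e₃.reg_eq rfl]; simp
  obtain ⟨n₄, s₄, hn₄, e₄, ⟨g₄, c₄⟩, hp⟩ := exec_loop
    (p := .and (.lt 0 Reg.sp) (.eq Reg.fail 0)) (c := block growBody)
    (fun s => Growing R X₁ X₂ vs s ∧ Settled R X₁ X₂ s) (growthLeft R) (block growBody).bound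
    (by
      rintro s ⟨hg, hc⟩ hp
      obtain ⟨a1, a2, a3⟩ := hg.body hc (by simpa using hp.1)
      obtain ⟨n, hn, he⟩ := exec_eval (block growBody) rfl s
      exact ⟨n, _, hn, he, ⟨a1, a2⟩, a3⟩)
    s₃ ⟨g₃, fun v hv => .inl ((hst₃ v).2 hv)⟩
  refine ⟨_, s₄, ?_, .seq e₁ (.seq e₂ (.seq e₃ (.seq e₄ (.skip _)))), g₄, fun hf v w δ hvw => ?_⟩
  -- Each vertex counts once for its initial place on the stack and at most `3 * (boundaryVerts
  -- R).card` times for the gap between the two cuts.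
  · have hr : growthLeft R s₃ ≤ vs.length * (3 * (boundaryVerts R).card + 1) := by
      unfold growthLeft
      rw [hsp₃, mul_add, mul_one, add_comm, henv.length]
      refine Nat.add_le_add ?_ (by simp)
      rw [← smul_eq_mul]
      refine Finset.sum_le_card_nsmul _ _ _ fun v hv => ?_
      have := hC₃.bound v hv
      rw [hh₃ v hv]
      omega
    have hpc : (Test.and (.lt 0 (Expr.reg .sp)) (.eq (Expr.reg .fail) 0)).cost = 7 := rfl
    rw [hpc] at hn₄
    have b₃ : n₃ ≤ (vs.length + 1) * secondTime :=
      hn₃.trans (Nat.mul_le_mul_left _ (by unfold secondTime; omega))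
    have b₄ : n₄ ≤ (vs.length * (3 * (boundaryVerts R).card + 1) + 1) * secondTime :=
      hn₄.trans (Nat.mul_le_mul (by omega) (by unfold secondTime; omega))
    have h100 : 100 ≤ secondTime := by unfold secondTime; omega
    simp only [cost_zero]
    generalize (boundaryVerts R).card = B at *
    generalize vs.length = N at *
    generalize secondTime = F at *
    have : 0 ≤ B * N * F := Nat.zero_le _
    have : 0 ≤ B * F := Nat.zero_le _
    have : 0 ≤ N * F := Nat.zero_le _
    nlinarith
  -- Without failure the loop can only have stopped on an empty stack, so all arcs into the bottom
  -- part have been followed.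
  · refine (c₄ w hvw.right_mem).resolve_left ?_ v δ hvw hf
    rintro ⟨m, hm, -⟩
    simp [hf] at hp
    omega

end

/-! ## The output -/

section
variable {R : Finset Tri} {X₁ X₂ : Finset Edge} {vs : List Vertex} {s : State}

/-- The body of the loop that writes the tiling. -/
def writeBody : List Cmd := [forDirs fun i =>
  when (.and (.lt 0 (.get .cnt Reg.x Reg.y (lit i)))
    (.not (.eq (.get .hgt (Reg.x + dx i) (Reg.y + dy i) 0) (.get .hgt Reg.x Reg.y 0 + 1))))
    [.store .tile Reg.x Reg.y (lit i) 1]]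

/-- The time for one vertex when the tiling is written. -/
def writeTime : ℕ := (block writeBody).bound + 40

theorem exec_writeTiling (henv : Env R X₁ X₂ vs s) (h0 : ∀ p q r, s.tab .tile p q r = 0) :
    ∃ n s', n ≤ (vs.length + 1) * writeTime ∧ Exec writeTiling s n s' ∧
      output s' = tilingOf R (s.entry .hgt) := by
  set H := s.entry .hgt with hH
  obtain ⟨n, s', hn, he, -, -, h1⟩ := exec_forVerts (cs := writeBody) rfl rfl rfl rfl
    henv.nodup henv.listed
    (fun P s => Env R X₁ X₂ vs s ∧ s.entry .hgt = H ∧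
      ∀ (v : Vertex) (i : Fin 3), s.tab .tile v.1 v.2 (i : ℕ) = 1 ↔
        v ∈ P ∧ (⟨v, i⟩ : Edge) ∈ tilingOf R H)
    (by
      rintro P s r n hr ⟨h1, h2, h3⟩
      have : Reg.nV ≠ r := by rcases hr with rfl | rfl | rfl <;> simp
      exact ⟨h1.congr (by simp [this]) rfl rfl rfl rfl, h2, h3⟩)
    ⟨henv, rfl, by simp [h0]⟩ (by
      rintro P v s - hP hx hy ⟨h1, h2, h3⟩
      obtain ⟨a1, a2, -, -, a3⟩ := forDirs_induction (s := s)
        (f := fun i => when (.and (.lt 0 (.get .cnt Reg.x Reg.y (lit i)))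
          (.not (.eq (.get .hgt (Reg.x + dx i) (Reg.y + dy i) 0) (.get .hgt Reg.x Reg.y 0 + 1))))
          [.store .tile Reg.x Reg.y (lit i) 1])
        (fun m s => Env R X₁ X₂ vs s ∧ s.entry .hgt = H ∧ s.reg .x = v.1 ∧ s.reg .y = v.2 ∧
          ∀ (w : Vertex) (i : Fin 3), s.tab .tile w.1 w.2 (i : ℕ) = 1 ↔
            (w ∈ P ∨ w = v ∧ (i : ℕ) < m) ∧ (⟨w, i⟩ : Edge) ∈ tilingOf R H)
        (by
          rintro i s ⟨h1, h2, hx, hy, h3⟩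
          have hh : ∀ w : Vertex, s.tab .hgt w.1 w.2 0 = H w := fun w => congrFun h2 w
          have hkey : (Test.and (.lt 0 (.get .cnt Reg.x Reg.y (lit i)))
              (.not (.eq (.get .hgt (Reg.x + dx i) (Reg.y + dy i) 0)
                (.get .hgt Reg.x Reg.y 0 + 1)))).holds s ↔ (⟨v, i⟩ : Edge) ∈ tilingOf R H := by
            have h5 := hh (v + vec i)
            rw [Prod.fst_add, Prod.snd_add] at h5
            simp [tilingOf, Edge.tip, hx, hy, h1.cnt v i, count_pos, hh v, h5]
          have hlt : ∀ j : Fin 3, (j : ℕ) < i + 1 ↔ (j : ℕ) < i ∨ j = i := fun j => by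
            rw [Fin.ext_iff]; omega
          by_cases hi : (⟨v, i⟩ : Edge) ∈ tilingOf R H
          · rw [eval_when_pos (hkey.2 hi)]
            refine ⟨h1.congr rfl (by simp) (by simp) (by simp) (by simp), ?_, hx, hy, fun w j => ?_⟩
            · rw [← h2]
              funext w
              simp [State.entry]
            · simp only [eval_block_cons, eval_block_nil, eval_store, val_reg, val_dir, val_one, hx,
                hy, State.setTab_tab_self]
              have hwj : (w.1 = v.1 ∧ w.2 = v.2 ∧ ((j : ℕ) : ℤ) = (i : ℕ)) ↔ w = v ∧ j = i := by
                rw [Prod.ext_iff, Fin.ext_iff, Nat.cast_inj, and_assoc]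
              rw [hlt]
              by_cases hc : w = v ∧ j = i
              · rw [if_pos (hwj.2 hc)]
                obtain ⟨rfl, rfl⟩ := hc
                simp [hi]
              · rw [if_neg (fun h => hc (hwj.1 h)), h3]
                tauto
          · rw [eval_when_neg (fun h => hi (hkey.1 h))]
            refine ⟨h1, h2, hx, hy, fun w j => ?_⟩
            rw [h3, hlt]
            constructor
            · tauto
            · rintro ⟨h | ⟨rfl, h | rfl⟩, h'⟩
              exacts [⟨.inl h, h'⟩, ⟨.inr ⟨rfl, h⟩, h'⟩, absurd h' hi])
        ⟨h1, h2, hx, hy, by simpa using h3⟩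
      refine ⟨a1, a2, fun w i => ?_⟩
      simp only [writeBody, eval_block_cons, eval_block_nil]
      rw [a3, Finset.mem_insert]
      have := i.2
      tauto)
  refine ⟨n, s', hn, he, ?_⟩
  ext e
  change s'.tab .tile e.base.1 e.base.2 (e.dir : ℕ) = 1 ↔ _
  rw [h1, henv.toFinset]
  exact ⟨fun h => h.2, fun h => ⟨base_mem_verts h.1, h⟩⟩

end

/-! ## The advancing surface algorithm -/

section
variable {R : Finset Tri} {X₁ X₂ : Finset Edge} {s : State}

theorem card_verts_le (R : Finset Tri) : (verts R).card ≤ 3 * R.card := by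
  rw [mul_comm]
  exact Finset.card_biUnion_le_card_mul _ _ _ fun t _ => Finset.card_le_three

theorem card_edges_le (R : Finset Tri) : (edges R).card ≤ 3 * R.card := by
  rw [mul_comm]
  exact Finset.card_biUnion_le_card_mul _ _ _ fun t _ => Finset.card_le_three

theorem card_boundaryVerts_le (R : Finset Tri) :
    (boundaryVerts R).card ≤ 2 * (boundary R).card := by
  rw [mul_comm]
  exact Finset.card_biUnion_le_card_mul _ _ _ fun e _ => Finset.card_le_two

theorem Enumerates.length {α : Type} [DecidableEq α] {l : List α} {S : Finset α}
    (h : Enumerates l S) : l.length = S.card := by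
  rw [← h.2, List.toFinset_card_of_nodup h.1]

/-- A constraint is one of the at most `3 * R.card` edges of `R` or is counted in the extra term of
the running time. -/
theorem card_constraints_le (R : Finset Tri) {S X : Finset Edge} (h : S ⊆ X) :
    S.card ≤ 3 * R.card + (X \ edges R).card := by
  refine (Finset.card_le_card (h.trans fun e he => ?_)).trans
    ((Finset.card_union_le (edges R) (X \ edges R)).trans
      (Nat.add_le_add_right (card_edges_le R) _))
  by_cases h : e ∈ edges R <;> simp [h, he]

/-- A solution lies between the lower and the upper cut. -/
theorem Cuts.grown_subset_of_solves (hR : IsSimplyConnectedRegion R) (hC : Cuts R s)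
    {T : Set Edge} (hT : Solves R X₁ X₂ T) :
    grown R X₁ X₂ (belowFn R (s.entry .low)) ⊆ belowFn R (s.entry .upp) := by
  obtain ⟨u, hu⟩ := hC.unique
  obtain ⟨H, h1, -, h3, h4⟩ := exists_height_of_isTiling hR hT.tiling u
  have hc := closed_of_solves hT h3 h4
  have hb := hu H ⟨h1, fun e he => hc.edge_eq (boundary_subset_edges he) (by
    simp [he])⟩
  -- The cubes below the height function `H` of the solution form the intermediate set of the two
  -- inclusions.
  refine (hc.grown_subset fun c hc' => ⟨hc'.1, hc'.2.trans ?_⟩).trans fun c hc' =>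
    ⟨hc'.1, hc'.2.trans ?_⟩
  · exact hC.le_upp hb (fun _ he => hc.edge_le he) hc'.1
  · exact hC.low_le hb (fun _ he => hc.edge_le he) hc'.1

/-- What the algorithm computes. -/
def Correct (R : Finset Tri) (X₁ X₂ : Finset Edge) (s : State) : Prop :=
  ((∃ T, Solves R X₁ X₂ T) → s.reg .status = 2) ∧
  (s.reg .status = 2 → Solves R X₁ X₂ (output s)) ∧
  (s.reg .status = 0 ↔ ¬ ∃ T, IsTiling R T) ∧
  (s.reg .status = 0 ∨
    ∃ L : Set Cube, IsBoundaryLift R L ∧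
      IsDicut R ∅ ∅ (below R s .low) ∧ below R s .low = lowerCutBottom R L ∧
      IsDicut R ∅ ∅ (below R s .upp) ∧ cubes R \ below R s .upp = upperCutTop R L ∧
      (s.reg .status = 1 ∧ ¬ grown R X₁ X₂ (below R s .low) ⊆ below R s .upp ∨
        s.reg .status = 2 ∧ grown R X₁ X₂ (below R s .low) ⊆ below R s .upp ∧
          below R s .hgt = grown R X₁ X₂ (below R s .low) ∧
          IsDicut R X₁ X₂ (below R s .hgt) ∧
          output s = projection R (below R s .hgt)))

theorem correct_of_no_tiling (h0 : s.reg .status = 0) (hT : ¬ ∃ T, IsTiling R T) :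
    Correct R X₁ X₂ s :=
  ⟨fun ⟨T, h⟩ => absurd ⟨T, h.tiling⟩ hT, fun h => by simp [h0] at h, iff_of_true h0 hT, .inl h0⟩

/-- The lower cut is already closed for the unconstrained graph. Hence acceptance by the first step
proves that `R` has a tiling. -/
theorem Cuts.exists_isTiling (hC : Cuts R s) : ∃ T, IsTiling R T :=
  ⟨_, isTiling_tilingOf hC.low_lattice hC.low_closed⟩

theorem verts_nonempty (hR : R.Nonempty) : (verts R).Nonempty :=
  (boundaryVerts_nonempty hR).mono fun _ h => boundaryVerts_subset h

theorem correct_of_fail (hR : IsSimplyConnectedRegion R) (hC : Cuts R s)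
    (h1 : s.reg .status = 1)
    (hf : ¬ grown R X₁ X₂ (belowFn R (s.entry .low)) ⊆ belowFn R (s.entry .upp)) :
    Correct R X₁ X₂ s :=
  have hne := verts_nonempty hR.nonempty
  ⟨fun ⟨_, h⟩ => absurd (hC.grown_subset_of_solves hR h) hf, fun h => by simp [h1] at h,
    iff_of_false (by simp [h1]) (not_not.2 hC.exists_isTiling),
    .inr ⟨_, isBoundaryLift_liftOf hC.lattice hC.step, hC.low_closed.isDicut hne,
      hC.lowerCutBottom_eq, hC.upp_closed.isDicut hne, hC.upperCutTop_eq, .inl ⟨h1, hf⟩⟩⟩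

/-- Only cubes of the grown set were entered, and a closed function above the lower cut contains
them all. -/
theorem Growing.belowFn_eq {vs : List Vertex} (hg : Growing R X₁ X₂ vs s)
    (hc : Closed R X₁ X₂ (s.entry .hgt)) :
    belowFn R (s.entry .hgt) = grown R X₁ X₂ (belowFn R (s.entry .low)) :=
  hg.subset.antisymm (hc.grown_subset fun _ h => ⟨h.1, h.2.trans (hg.low_le _ h.1)⟩)

theorem correct_of_closed (hR : IsSimplyConnectedRegion R) {vs : List Vertex} {s' : State}
    (hg : Growing R X₁ X₂ vs s) (hc : Closed R X₁ X₂ (s.entry .hgt))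
    (h2 : s'.reg .status = 2) (hlow : s'.tab .low = s.tab .low) (hupp : s'.tab .upp = s.tab .upp)
    (hhgt : s'.tab .hgt = s.tab .hgt) (hout : output s' = tilingOf R (s.entry .hgt)) :
    Correct R X₁ X₂ s' := by
  have hne := verts_nonempty hR.nonempty
  have hC := hg.cuts
  have e1 : below R s' .low = belowFn R (s.entry .low) := by
    unfold below; rw [hlow]; rfl
  have e2 : below R s' .upp = belowFn R (s.entry .upp) := by
    unfold below; rw [hupp]; rfl
  have e3 : below R s' .hgt = belowFn R (s.entry .hgt) := by
    unfold below; rw [hhgt]; rfl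
  refine ⟨fun _ => h2, fun _ => ?_, iff_of_false (by simp [h2]) (not_not.2 hC.exists_isTiling),
    .inr ⟨_, isBoundaryLift_liftOf hC.lattice hC.step, ?_⟩⟩
  · rw [hout]
    exact solves_tilingOf hg.lattice hc
  · rw [e1, e2, e3]
    refine ⟨hC.low_closed.isDicut hne, hC.lowerCutBottom_eq, hC.upp_closed.isDicut hne,
      hC.upperCutTop_eq, .inr ⟨h2, ?_, hg.belowFn_eq hc, hc.isDicut hne, ?_⟩⟩
    · rw [← hg.belowFn_eq hc]
      exact fun c h => ⟨h.1, h.2.trans (hg.le_upp _ h.1)⟩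
    · rw [hout, projection_belowFn hg.lattice hc.mono]

attribute [local irreducible] readTime firstTime secondTime writeTime

/-- The time of the algorithm for one boundary edge and one triangle. -/
def totalTime : ℕ :=
  20 * readTime + 400 * firstTime + 300 * secondTime + 10 * writeTime + 100

theorem exec_advancingSurface (hR : IsSimplyConnectedRegion R) {lR : List Tri}
    {l₁ l₂ : List Edge} (hlR : Enumerates lR R) (hl₁ : Enumerates l₁ X₁)
    (hl₂ : Enumerates l₂ X₂) :
    ∃ n s, Exec advancingSurface (input lR l₁ l₂) n s ∧
      n ≤ totalTime * ((boundary R).card * R.card + ((X₁ ∪ X₂) \ edges R).card) ∧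
      Correct R X₁ X₂ s := by
  obtain ⟨n₁, s₁, vs, hn₁, e₁, henv₁⟩ := exec_readInput hlR hl₁ hl₂
  obtain ⟨n₂, s₂, hn₂, e₂, hok, hC, hT⟩ := exec_firstStep hR henv₁
    (fun v => by rw [State.entry, e₁.tab_eq rfl]; rfl)
    (fun v => by rw [State.entry, e₁.tab_eq rfl]; rfl)
    (fun v => by rw [State.entry, e₁.tab_eq rfl]; rfl)
  have henv₂ := henv₁.exec e₂ ⟨rfl, rfl, rfl, rfl, rfl⟩
  have hb : 1 ≤ (boundary R).card := by
    obtain ⟨v, hv⟩ := boundaryVerts_nonempty hR.nonempty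
    obtain ⟨e, he, -⟩ := mem_boundaryVerts.1 hv
    exact Finset.card_pos.2 ⟨e, he⟩
  have hr : 1 ≤ R.card := Finset.card_pos.2 hR.nonempty
  have hN : vs.length ≤ 3 * R.card := by
    rw [henv₁.length]
    exact card_verts_le R
  have hB := card_boundaryVerts_le R
  set D := (boundary R).card * R.card with hD
  set M := ((X₁ ∪ X₂) \ edges R).card with hM
  have hRD : R.card ≤ D := Nat.le_mul_of_pos_left _ hb
  have hD₁ : 1 ≤ D := hr.trans hRD
  -- There are at most two vertices per boundary edge and three per triangle, and both sets are
  -- nonempty: the factors are at most `7 * (boundary R).card` and `8 * R.card`. The coefficients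
  -- 400 and 300 of `totalTime` exceed `7 * 56` and `4 * 56`.
  have hBN : ((boundaryVerts R).card + 5) * (vs.length + 5) ≤ 56 * D :=
    (Nat.mul_le_mul (show _ ≤ 7 * (boundary R).card by omega)
      (show _ ≤ 8 * R.card by omega)).trans (le_of_eq (by rw [hD]; ring))
  have b₁ : n₁ ≤ 20 * readTime * (D + M) := by
    have h1 := card_constraints_le R (Finset.subset_union_left (s₁ := X₁) (s₂ := X₂))
    have h2 := card_constraints_le R (Finset.subset_union_right (s₁ := X₁) (s₂ := X₂))
    rw [← hl₁.length] at h1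
    rw [← hl₂.length] at h2
    have h3 := hlR.length
    refine hn₁.trans ((Nat.mul_le_mul_right readTime
      (show _ ≤ 20 * (D + M) by omega)).trans (le_of_eq (by ring)))
  have b₂ : n₂ ≤ 400 * firstTime * (D + M) := by
    refine hn₂.trans ?_
    rw [← mul_assoc ((boundaryVerts R).card + 5)]
    refine (Nat.mul_le_mul_left 7 (Nat.mul_le_mul_right firstTime
      (hBN.trans (Nat.mul_le_mul_left 56 (Nat.le_add_right D M))))).trans ?_
    nlinarith [Nat.zero_le (firstTime * (D + M))]
  have htotal : totalTime * (D + M) = 20 * readTime * (D + M) + 400 * firstTime * (D + M) +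
      300 * secondTime * (D + M) + 10 * writeTime * (D + M) +
      100 * (D + M) := by
    have hring : ∀ a b c d x : ℕ, (20 * a + 400 * b + 300 * c + 10 * d + 100) * x =
        20 * a * x + 400 * b * x + 300 * c * x + 10 * d * x + 100 * x := by
      intros; ring
    rw [totalTime, hring]
  have hcost : (Test.eq (Expr.reg .ok) 0).cost = 3 := rfl
  have hcost' : (Test.eq (Expr.reg .fail) 1).cost = 3 := rfl
  by_cases hok₂ : s₂.reg .ok = 1
  · have hok₀ : ¬ (Test.eq (Expr.reg .ok) 0).holds s₂ := by simp [hok₂]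
    obtain ⟨n₃, s₃, hn₃, e₃, hg, hc⟩ := exec_secondStep henv₂ (hC hok₂)
    have b₃ : n₃ ≤ 300 * secondTime * (D + M) := by
      refine hn₃.trans ?_
      rw [← mul_assoc ((boundaryVerts R).card + 5)]
      refine (Nat.mul_le_mul_left 4 (Nat.mul_le_mul_right secondTime
        (hBN.trans (Nat.mul_le_mul_left 56 (Nat.le_add_right D M))))).trans ?_
      nlinarith [Nat.zero_le (secondTime * (D + M))]
    rcases hg.fail with hf | ⟨hf, hsub⟩
    · have hf' : ¬ (Test.eq (Expr.reg .fail) 1).holds s₃ := by simp [hf]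
      obtain ⟨n₄, s₄, hn₄, e₄, hout⟩ := exec_writeTiling hg.env fun p q r => by
        rw [e₃.tab_eq rfl, e₂.tab_eq rfl, e₁.tab_eq rfl]; rfl
      have b₄ : n₄ ≤ 10 * writeTime * (D + M) :=
        hn₄.trans ((Nat.mul_le_mul_right _ (show _ ≤ 10 * (D + M) by omega)).trans
          (le_of_eq (by ring)))
      refine ⟨_, s₄.setReg .status 2, .seq e₁ (.seq e₂ (.seq (.ite_false hok₀ (.seq e₃ (.seq
        (.ite_false hf' (.seq e₄ (.seq (.set _ _ _) (.skip _)))) (.skip _)))) (.skip _))), ?_, ?_⟩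
      · rw [hcost, hcost', cost_two, htotal]
        generalize 20 * readTime * (D + M) = t₁ at *
        generalize 400 * firstTime * (D + M) = t₂ at *
        generalize 300 * secondTime * (D + M) = t₃ at *
        generalize 10 * writeTime * (D + M) = t₄ at *
        clear hn₁ hn₂ hn₃ hn₄
        omega
      · exact correct_of_closed hR hg (hc hf) (by simp) (e₄.tab_eq rfl) (e₄.tab_eq rfl)
          (e₄.tab_eq rfl) hout
    · refine ⟨_, s₃.setReg .status 1, .seq e₁ (.seq e₂ (.seq (.ite_false hok₀ (.seq e₃ (.seq
        (.ite_true (p := .eq Reg.fail 1) hf (.set _ _ _)) (.skip _)))) (.skip _))), ?_, ?_⟩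
      · rw [hcost, hcost', cost_one, htotal]
        generalize 20 * readTime * (D + M) = t₁ at *
        generalize 400 * firstTime * (D + M) = t₂ at *
        generalize 300 * secondTime * (D + M) = t₃ at *
        generalize 10 * writeTime * (D + M) = t₄ at *
        clear hn₁ hn₂ hn₃
        omega
      · exact correct_of_fail hR (hg.cuts.congr rfl rfl rfl) (by simp) hsub
  · refine ⟨_, s₂.setReg .status 0, .seq e₁ (.seq e₂ (.seq (.ite_true (p := .eq Reg.ok 0)
      (hok.resolve_right hok₂) (.set _ _ _)) (.skip _))), ?_, ?_⟩
    · rw [hcost, cost_zero, htotal]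
      generalize 20 * readTime * (D + M) = t₁ at *
      generalize 400 * firstTime * (D + M) = t₂ at *
      generalize 300 * secondTime * (D + M) = t₃ at *
      generalize 10 * writeTime * (D + M) = t₄ at *
      clear hn₁ hn₂
      omega
    · exact correct_of_no_tiling (by simp) fun h => hok₂ (hT h)

end

end Calisson

theorem theorem1 :
    ∃ C : ℕ, ∀ (R : Finset Tri) (X₁ X₂ : Finset Edge), IsSimplyConnectedRegion R →
      ∀ (lR : List Tri) (l₁ l₂ : List Edge),
        Enumerates lR R → Enumerates l₁ X₁ → Enumerates l₂ X₂ →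
      ∃ (n : ℕ) (s : State), Exec advancingSurface (input lR l₁ l₂) n s ∧
        -- running time
        n ≤ C * ((boundary R).card * R.card + ((X₁ ∪ X₂) \ edges R).card) ∧
        -- the algorithm solves the tiling problem
        ((∃ T, Solves R X₁ X₂ T) → s.reg .status = 2) ∧
        (s.reg .status = 2 → Solves R X₁ X₂ (output s)) ∧
        -- the first step rejects the regions without tiling
        (s.reg .status = 0 ↔ ¬ ∃ T, IsTiling R T) ∧
        -- otherwise, it computes the lower and upper cuts, from which the second step starts
        (s.reg .status = 0 ∨
          ∃ L : Set Cube, IsBoundaryLift R L ∧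
            IsDicut R ∅ ∅ (below R s .low) ∧ below R s .low = lowerCutBottom R L ∧
            IsDicut R ∅ ∅ (below R s .upp) ∧ cubes R \ below R s .upp = upperCutTop R L ∧
            (s.reg .status = 1 ∧ ¬ grown R X₁ X₂ (below R s .low) ⊆ below R s .upp ∨
              s.reg .status = 2 ∧ grown R X₁ X₂ (below R s .low) ⊆ below R s .upp ∧
                below R s .hgt = grown R X₁ X₂ (below R s .low) ∧
                IsDicut R X₁ X₂ (below R s .hgt) ∧
                output s = projection R (below R s .hgt))) := by
  refine ⟨totalTime, fun R X₁ X₂ hR lR l₁ l₂ hlR hl₁ hl₂ => ?_⟩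
  obtain ⟨n, s, he, hn, hc⟩ := exec_advancingSurface hR hlR hl₁ hl₂
  exact ⟨n, s, he, hn, hc⟩
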